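/- For $p\in[0,1]$ let $\mathsf G(n,p)$ be the Erdős–Rényi distribution on graphs with vertex set $[n]=\{1,\dots,n\}$ (each edge present independently with probability $p$), and let $\mathsf{RGG}(n,\mathbb S^{d-1},p)$ be the spherical random geometric graph: $V_1,\dots,V_n$ are independent and uniform on the unit sphere $\mathbb S^{d-1}\subset\mathbb R^d$, and distinct $i,j$ are joined if and only if $\langle V_i,V_j\rangle\ge\tau_d^p$, where $\tau_d^p$ is chosen so that $\Pr[\langle V_i,V_j\rangle\ge\tau_d^p]=p$. For each $n$ let $\mathcal P_n$ be a monotone property, that is, a set of graphs on $[n]$ that is closed under adding edges (increasing) or closed under deleting edges (decreasing). Given distributions $\mathcal D_{n,p}$, $p\in[0,1]$, on graphs on $[n]$ (above, $\mathsf G(n,p)$ or $\mathsf{RGG}(n,\mathbb S^{d_n-1},p)$), put $f_n(p)=\Pr_{X\sim\mathcal D_{n,p}}[X\in\mathcal P_n]$, and write $f_n^{-1}(a)$ for the unique $p\in[0,1]$ with $f_n(p)=a$, if there is one. The critical probability is $f_n^{-1}(1/2)$. We say that $(\mathcal P_n)$ has a sharp threshold with respect to $(\mathcal D_{n,p})$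 if $f_n^{-1}(1/2)$ exists for all large $n$ and, for every fixed $\epsilon\in(0,1/2)$, $f_n^{-1}(\epsilon)$ and $f_n^{-1}(1-\epsilon)$ exist for all large $n$ and $$|f_n^{-1}(1-\epsilon)-f_n^{-1}(\epsilon)|=o\big(f_n^{-1}(1/2)\big)\qquad(n\to\infty).$$ Theorem. Suppose that the monotone properties $\mathcal P_n$ have a sharp threshold with respect to $\mathsf G(n,p)$, with critical probabilities $p^c_n$ satisfying $p^c_n=\Omega(1/n)$. Let $d_n$ be positive integers (for large $n$) with $d_n=\omega\big(\max(n\,p^c_n\log^4 n,\ \log^5 n)\big)$. Then $(\mathcal P_n)$ also has a sharp threshold with respect to $\mathsf{RGG}(n,\mathbb S^{d_n-1},p)$, with critical probabilities $q^c_n=p^c_n(1+o(1))$. -/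

import Mathlib

open MeasureTheory Filter Asymptotics

noncomputable section

namespace SharpThresholds

/-- The uniform probability distribution on the unit sphere `S^{d-1}` of `ℝ^d` (for `d ≥ 1`):
the normalised surface measure. -/
def unifSphere (d : ℕ) : Measure (Metric.sphere (0 : EuclideanSpace ℝ (Fin d)) 1) :=
  ((volume : Measure (EuclideanSpace ℝ (Fin d))).toSphere Set.univ)⁻¹ •
    (volume : Measure (EuclideanSpace ℝ (Fin d))).toSphere

/-- The probability `Pr[⟨V, W⟩ ≥ t]` for independent uniform `V, W` on `S^{d-1}`. -/
def capProb (d : ℕ) (t : ℝ) : ℝ :=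
  ((unifSphere d).prod (unifSphere d)).real
    {v | t ≤ inner ℝ (v.1 : EuclideanSpace ℝ (Fin d)) (v.2 : EuclideanSpace ℝ (Fin d))}

/-- The threshold `τ` in `[-1, 1]` with `Pr[⟨V, W⟩ ≥ τ] = p` for independent uniform `V, W` on
`S^{d-1}`, written as the largest `t` in `[-1, 1]` with `Pr[⟨V, W⟩ ≥ t] ≥ p`.
That it satisfies the equation for all `d ≥ 2` is `capProb_threshold` below. -/
def threshold (d : ℕ) (p : unitInterval) : ℝ :=
  sSup {t : ℝ | t ∈ Set.Icc (-1 : ℝ) 1 ∧ (p : ℝ) ≤ capProb d t}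

/-- The graph on `{1, …, n}` (here `Fin n`) in which distinct `i, j` are joined if and only if
`⟨V i, V j⟩ ≥ τ`. -/
def geomGraph {n d : ℕ} (τ : ℝ) (V : Fin n → Metric.sphere (0 : EuclideanSpace ℝ (Fin d)) 1) :
    SimpleGraph (Fin n) where
  Adj i j := i ≠ j ∧
    τ ≤ inner ℝ (V i : EuclideanSpace ℝ (Fin d)) (V j : EuclideanSpace ℝ (Fin d))
  symm := ⟨fun i j h => ⟨h.1.symm, by rw [real_inner_comm]; exact h.2⟩⟩
  loopless := ⟨fun _ h => h.1 rfl⟩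

/-- The law `RGG(n, S^{d-1}, p)` of the spherical random geometric graph: the law of
`geomGraph τ V` for independent uniform `V 1, …, V n` on `S^{d-1}` and the threshold `τ` of
density `p`. -/
def rgg (n d : ℕ) (p : unitInterval) : Measure (SimpleGraph (Fin n)) :=
  (Measure.pi fun _ : Fin n => unifSphere d).map (geomGraph (threshold d p))

/-! Proved facts showing that these definitions mean what they say. -/

theorem isProbabilityMeasure_unifSphere {d : ℕ} (hd : 1 ≤ d) :
    IsProbabilityMeasure (unifSphere d) := by
  have : NeZero d := ⟨by omega⟩
  have hne : (volume : Measure (EuclideanSpace ℝ (Fin d))).toSphere ≠ 0 :=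
    Measure.toSphere_ne_zero _
  refine ⟨?_⟩
  rw [unifSphere, Measure.smul_apply, smul_eq_mul]
  exact ENNReal.inv_mul_cancel (Measure.measure_univ_ne_zero.2 hne) (measure_ne_top _ _)

theorem measurable_geomGraph {n d : ℕ} (τ : ℝ) :
    Measurable (geomGraph τ : (Fin n → Metric.sphere (0 : EuclideanSpace ℝ (Fin d)) 1) → _) := by
  rw [SimpleGraph.measurable_iff_adj]
  intro u v
  have h : MeasurableSet {V : Fin n → Metric.sphere (0 : EuclideanSpace ℝ (Fin d)) 1 |
      τ ≤ inner ℝ (V u : EuclideanSpace ℝ (Fin d)) (V v : EuclideanSpace ℝ (Fin d))} :=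
    measurableSet_le measurable_const (by fun_prop)
  exact measurable_const.and (measurableSet_setOfPred.1 h)

theorem isProbabilityMeasure_rgg {n d : ℕ} (hd : 1 ≤ d) (p : unitInterval) :
    IsProbabilityMeasure (rgg n d p) := by
  have := isProbabilityMeasure_unifSphere hd
  exact Measure.isProbabilityMeasure_map (measurable_geomGraph _).aemeasurable

theorem volume_cone_eq_zero {d : ℕ} (hd : 2 ≤ d) {v : EuclideanSpace ℝ (Fin d)} (hv : v ≠ 0)
    {t : ℝ} (ht : 0 ≤ t) : volume {x : EuclideanSpace ℝ (Fin d) | inner ℝ v x = t * ‖x‖} = 0 := by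
  have hconv : Convex ℝ {x : EuclideanSpace ℝ (Fin d) | t * ‖x‖ ≤ inner ℝ v x} := by
    intro x hx y hy a b ha hb _
    simp only [Set.mem_ofPred_eq] at *
    have h1 : ‖a • x + b • y‖ ≤ a * ‖x‖ + b * ‖y‖ := by
      refine (norm_add_le _ _).trans_eq ?_
      rw [norm_smul, norm_smul, Real.norm_of_nonneg ha, Real.norm_of_nonneg hb]
    rw [inner_add_right, inner_smul_right, inner_smul_right]
    nlinarith [mul_le_mul_of_nonneg_left h1 ht, mul_le_mul_of_nonneg_left hx ha,
      mul_le_mul_of_nonneg_left hy hb]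
  refine measure_mono_null ?_ (hconv.addHaar_frontier volume)
  intro x hx
  refine ⟨subset_closure (le_of_eq (Eq.symm hx)), fun hint => ?_⟩
  have key : ∀ y : EuclideanSpace ℝ (Fin d), ∀ᶠ s : ℝ in nhdsWithin 0 (Set.Ioi 0),
      t * ‖x + s • y‖ ≤ inner ℝ v (x + s • y) := by
    intro y
    have hc : Tendsto (fun s : ℝ => x + s • y) (nhds 0) (nhds x) := by
      have : Continuous (fun s : ℝ => x + s • y) := by fun_prop
      simpa using this.tendsto 0
    exact (hc.eventually (mem_interior_iff_mem_nhds.1 hint)).filter_mono nhdsWithin_le_nhds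
  have hx' : inner ℝ v x = t * ‖x‖ := hx
  rcases ht.eq_or_lt with rfl | ht
  · obtain ⟨s, h, hs⟩ := ((key (-v)).and self_mem_nhdsWithin).exists
    have hs : 0 < s := hs
    simp only [zero_mul, inner_add_right, hx', inner_smul_right, inner_neg_right,
      real_inner_self_eq_norm_sq] at h
    have := mul_pos hs (pow_pos (norm_pos_iff.2 hv) 2)
    linarith
  · obtain ⟨u, hu, hu0⟩ : ∃ u : EuclideanSpace ℝ (Fin d), inner ℝ v u = 0 ∧ u ≠ 0 := by
      have : (ℝ ∙ v)ᗮ ≠ ⊥ := by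
        intro h
        have h1 := Submodule.finrank_add_finrank_orthogonal (ℝ ∙ v)
        rw [h, finrank_bot, finrank_span_singleton hv, finrank_euclideanSpace_fin] at h1
        omega
      obtain ⟨u, hu, hu0⟩ := Submodule.exists_mem_ne_zero_of_ne_bot this
      exact ⟨u, Submodule.mem_orthogonal_singleton_iff_inner_right.1 hu, hu0⟩
    obtain ⟨s, ⟨h1, h2⟩, hs⟩ := (((key u).and (key (-u))).and self_mem_nhdsWithin).exists
    have hs : 0 < s := hs
    simp only [inner_add_right, hx', inner_smul_right, inner_neg_right, hu, mul_zero, neg_zero,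
      add_zero] at h1 h2
    have h1 := le_of_mul_le_mul_left h1 ht
    have h2 := le_of_mul_le_mul_left h2 ht
    have hp := parallelogram_law_with_norm ℝ x (s • u)
    rw [smul_neg, ← sub_eq_add_neg] at h2
    have h3 : 0 < ‖s • u‖ := norm_pos_iff.2 (smul_ne_zero hs.ne' hu0)
    nlinarith [norm_nonneg (x + s • u), norm_nonneg (x - s • u)]

theorem unifSphere_level_eq_zero {d : ℕ} (hd : 2 ≤ d)
    (v : Metric.sphere (0 : EuclideanSpace ℝ (Fin d)) 1) (t : ℝ) :
    unifSphere d {w | inner ℝ (v : EuclideanSpace ℝ (Fin d)) (w : EuclideanSpace ℝ (Fin d)) = t}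
      = 0 := by
  have hm : MeasurableSet {w : Metric.sphere (0 : EuclideanSpace ℝ (Fin d)) 1 |
      inner ℝ (v : EuclideanSpace ℝ (Fin d)) (w : EuclideanSpace ℝ (Fin d)) = t} :=
    (isClosed_eq (by fun_prop) continuous_const).measurableSet
  have hv : (v : EuclideanSpace ℝ (Fin d)) ≠ 0 := ne_zero_of_mem_unit_sphere v
  have hcone : volume {x | inner ℝ (v : EuclideanSpace ℝ (Fin d)) x = t * ‖x‖} = 0 := by
    rcases le_total 0 t with ht | ht
    · exact volume_cone_eq_zero hd hv ht
    · have := volume_cone_eq_zero hd (neg_ne_zero.2 hv) (neg_nonneg.2 ht)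
      simpa only [inner_neg_left, neg_mul, neg_inj] using this
  rw [unifSphere, Measure.smul_apply, Measure.toSphere_apply' _ hm, smul_eq_mul, mul_eq_zero]
  refine Or.inr (mul_eq_zero.2 (Or.inr (measure_mono_null ?_ hcone)))
  rintro _ ⟨r, hr, _, ⟨w, hw, rfl⟩, rfl⟩
  have hw : inner ℝ (v : EuclideanSpace ℝ (Fin d)) (w : EuclideanSpace ℝ (Fin d)) = t := hw
  simp only [Set.mem_ofPred_eq, inner_smul_right, hw, norm_smul,
    Real.norm_of_nonneg hr.1.le, norm_eq_of_mem_sphere]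
  ring

theorem continuous_capProb {d : ℕ} (hd : 2 ≤ d) : Continuous (capProb d) := by
  have := isProbabilityMeasure_unifSphere (d := d) (by omega)
  set X : Metric.sphere (0 : EuclideanSpace ℝ (Fin d)) 1 ×
    Metric.sphere (0 : EuclideanSpace ℝ (Fin d)) 1 → ℝ :=
    fun v => inner ℝ (v.1 : EuclideanSpace ℝ (Fin d)) (v.2 : EuclideanSpace ℝ (Fin d)) with hX
  have hXc : Continuous X := by fun_prop
  have hlev : ∀ t, ∀ᵐ v ∂((unifSphere d).prod (unifSphere d)), X v ≠ t := by
    intro t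
    have hm : MeasurableSet {v | X v = t} := (isClosed_eq hXc continuous_const).measurableSet
    have h0 : ((unifSphere d).prod (unifSphere d)) {v | X v = t} = 0 := by
      rw [Measure.measure_prod_null hm]
      exact Eventually.of_forall fun v => unifSphere_level_eq_zero hd v t
    simpa [ae_iff] using h0
  have heq : capProb d = fun t => ∫ v, (Set.Ici t).indicator (fun _ => (1 : ℝ)) (X v)
      ∂((unifSphere d).prod (unifSphere d)) := by
    funext t
    have hm : MeasurableSet {v | t ≤ X v} := (isClosed_le continuous_const hXc).measurableSet
    rw [capProb, ← integral_indicator_one hm]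
    rfl
  rw [heq, continuous_iff_continuousAt]
  intro t
  refine tendsto_integral_filter_of_dominated_convergence (fun _ => (1 : ℝ)) ?_ ?_
    (integrable_const _) ?_
  · refine Eventually.of_forall fun s => ?_
    exact ((measurable_const.indicator measurableSet_Ici).comp hXc.measurable).aestronglyMeasurable
  · refine Eventually.of_forall fun s => Eventually.of_forall fun v => ?_
    by_cases h : X v ∈ Set.Ici s <;> simp [h]
  · filter_upwards [hlev t] with v hv
    refine tendsto_const_nhds.congr' ?_
    rcases lt_or_gt_of_ne hv with h | h
    · filter_upwards [lt_mem_nhds h] with s hs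
      simp [Set.indicator, not_le.2 h, not_le.2 hs]
    · filter_upwards [gt_mem_nhds h] with s hs
      simp [Set.indicator, h.le, hs.le]

/-- The defining equation of the threshold, `Pr[⟨V, W⟩ ≥ τ] = p`. -/
theorem capProb_threshold {d : ℕ} (hd : 2 ≤ d) (p : unitInterval) :
    threshold d p ∈ Set.Icc (-1 : ℝ) 1 ∧ capProb d (threshold d p) = p := by
  have := isProbabilityMeasure_unifSphere (d := d) (by omega)
  have hc := continuous_capProb hd
  have hneg : capProb d (-1) = 1 := by
    have : {v : Metric.sphere (0 : EuclideanSpace ℝ (Fin d)) 1 ×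
        Metric.sphere (0 : EuclideanSpace ℝ (Fin d)) 1 | (-1 : ℝ) ≤
        inner ℝ (v.1 : EuclideanSpace ℝ (Fin d)) (v.2 : EuclideanSpace ℝ (Fin d))} =
        Set.univ := by
      refine Set.eq_univ_of_forall fun v => ?_
      have h := abs_real_inner_le_norm (v.1 : EuclideanSpace ℝ (Fin d))
        (v.2 : EuclideanSpace ℝ (Fin d))
      rw [norm_eq_of_mem_sphere, norm_eq_of_mem_sphere, one_mul] at h
      exact (abs_le.1 h).1
    rw [capProb, this, probReal_univ]
  have hgt : ∀ t : ℝ, 1 < t → capProb d t = 0 := by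
    intro t ht
    have : {v : Metric.sphere (0 : EuclideanSpace ℝ (Fin d)) 1 ×
        Metric.sphere (0 : EuclideanSpace ℝ (Fin d)) 1 | t ≤
        inner ℝ (v.1 : EuclideanSpace ℝ (Fin d)) (v.2 : EuclideanSpace ℝ (Fin d))} = ∅ := by
      refine Set.eq_empty_of_forall_notMem fun v hv => ?_
      have h := abs_real_inner_le_norm (v.1 : EuclideanSpace ℝ (Fin d))
        (v.2 : EuclideanSpace ℝ (Fin d))
      rw [norm_eq_of_mem_sphere, norm_eq_of_mem_sphere, one_mul] at h
      exact absurd (le_trans hv (abs_le.1 h).2) (not_le.2 ht)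
    rw [capProb, this, measureReal_empty]
  have hone : capProb d 1 = 0 := by
    have h1 : Tendsto (capProb d) (nhdsWithin 1 (Set.Ioi 1)) (nhds (capProb d 1)) :=
      (hc.tendsto 1).mono_left nhdsWithin_le_nhds
    refine tendsto_nhds_unique h1 (tendsto_const_nhds.congr' ?_)
    filter_upwards [self_mem_nhdsWithin] with t ht
    exact (hgt t ht).symm
  have hcl : IsCompact {t : ℝ | t ∈ Set.Icc (-1 : ℝ) 1 ∧ (p : ℝ) ≤ capProb d t} :=
    isCompact_Icc.inter_right (isClosed_le continuous_const hc)
  have hmem : threshold d p ∈ {t : ℝ | t ∈ Set.Icc (-1 : ℝ) 1 ∧ (p : ℝ) ≤ capProb d t} :=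
    hcl.sSup_mem ⟨-1, by norm_num, by rw [hneg]; exact p.2.2⟩
  refine ⟨hmem.1, le_antisymm ?_ hmem.2⟩
  obtain ⟨t, ht, htp⟩ : (p : ℝ) ∈ capProb d '' Set.Icc (threshold d p) 1 :=
    intermediate_value_Icc' hmem.1.2 hc.continuousOn ⟨by rw [hone]; exact p.2.1, hmem.2⟩
  have hle : t ≤ threshold d p :=
    le_csSup hcl.bddAbove ⟨⟨hmem.1.1.trans ht.1, ht.2⟩, htp.ge⟩
  rw [← htp, le_antisymm hle ht.1]

/-- `p = f⁻¹(a)`: the function `f` takes the value `a` at `p` and nowhere else. -/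
def IsInverseValue (f : unitInterval → ℝ) (a : ℝ) (p : unitInterval) : Prop :=
  ∀ q, f q = a ↔ q = p

/-- `p` is the critical probability `f⁻¹(1/2)`, where `f p` is the probability of the property
at density `p`. -/
def IsCriticalProb (f : unitInterval → ℝ) (p : unitInterval) : Prop :=
  IsInverseValue f (1 / 2) p

/-- Let `f n p` be the probability of the `n`-th property at density `p`. The properties have
critical probabilities `pc n` (for all large `n`) and a (multiplicative) sharp threshold: for
each fixed `ε`, the critical window, of length `|f⁻¹(1 - ε) - f⁻¹(ε)|`, is `o(pc)`. (For
increasing properties the difference is positive, for decreasing ones it is negative;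
`=o` compares absolute values.) -/
def HasSharpThreshold (f : ℕ → unitInterval → ℝ) (pc : ℕ → unitInterval) : Prop :=
  (∀ᶠ n in atTop, IsCriticalProb (f n) (pc n)) ∧
  ∀ ε : ℝ, 0 < ε → ε < 1 / 2 → ∃ a b : ℕ → unitInterval,
    (∀ᶠ n in atTop, IsInverseValue (f n) ε (a n) ∧ IsInverseValue (f n) (1 - ε) (b n)) ∧
    (fun n => (b n : ℝ) - (a n : ℝ)) =o[atTop] (fun n => (pc n : ℝ))

end SharpThresholds

end

/-! The plan is to compare the geometric graph with two binomial random graphs. For increasing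
properties, and for densities p comparable to the critical one, the geometric graph of density p
lies between G(n, (1 - δ)p) and G(n, (1 + δ)p), up to an error 12/n² in probability
(`geomGraph_real_sandwich`). For G(n, p) the probability passes from ε to 1 - ε within a factor 1 ±
δ of the critical density. Hence the geometric graph attains every level y in (0, 1) within a factor
1 ± 7δ of the same density (`exists_isInverseValue_near`). Letting δ tend to 0 makes each inverse
value asymptotic to the critical density, which gives both the sharp threshold and the location.
Decreasing properties follow by complements.

The sandwich comes from replacing edges one at a time by independent ones, in order of the larger
endpoint k and then of the smaller one j (`neg_mul_le_integral_sub_binomialRandom`). Given the other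
points and the adjacencies of k to the vertices below j, the point V k is uniform on a set L cut out
by caps and complements of caps. The edge jk is then present with probability σ(L ∩ cap(V j)) /
σ(L), where σ is the uniform measure. Since L does not involve V j, this is the proportion of a
fixed set that a random cap captures. It has to be within a factor 1 ± δ of p, outside an event of
probability O(n⁻⁴). Sets L with too many neighbours or too small a measure have negligible total
mass (`integral_patternError_le`), so only L with σ(L) ≥ exp(-8(np + log n) log n) matter.

The geometric core is therefore `cap_inter_deviation_le`: a random cap captures about p σ(A) of a
set A that is not too small. The centre is taken to be the direction of a Gaussian vector v, and the
indicator of the cap is replaced by a sigmoid of slope l in ⟨z, v⟩, giving `smoothCap`. The gradient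
of the logarithm of this function of v is bounded by l times the mean of |⟨z, u⟩| (u a unit vector)
under a density on A that is at most 2/(pσ(A)). Linear functionals on the sphere are subgaussian at
scale d^(-1/2), so an entropy inequality bounds the gradient by O(l √(log(8/(pσ(A))) / d))
(`norm_fderiv_log_smoothCap_le`). The Maurey–Pisier inequality then gives multiplicative
concentration. With l of order log n, the required dimension is a large multiple of (np + log n)
log⁴ n, which is the hypothesis on d.

Inverse values for the geometric graph exist and are unique because its probability is continuous in
the threshold and strictly monotone wherever it is not 0 or 1. Strictness comes from connectedness
of the sphere (`geomProb_lt`). -/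

namespace SharpThresholds

open ProbabilityTheory Real
open scoped ENNReal RealInnerProductSpace

noncomputable section

/-! ### Gaussian vectors and the uniform measure on the sphere. -/

/-- The unit sphere of `ℝ^d`. -/
abbrev USphere (d : ℕ) : Type := Metric.sphere (0 : EuclideanSpace ℝ (Fin d)) 1

/-- The standard Gaussian measure on `ℝ^d`. -/
abbrev gauss (d : ℕ) : Measure (EuclideanSpace ℝ (Fin d)) := stdGaussian (EuclideanSpace ℝ (Fin d))

/-- The density of the standard Gaussian measure on `ℝ^d`, as a function of the norm. -/
def gaussDensity (d : ℕ) (r : ℝ) : ℝ := (2 * π) ^ (-(d / 2 : ℝ)) * exp (-(1 / 2) * r ^ 2)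

theorem gaussDensity_nonneg (d : ℕ) (r : ℝ) : 0 ≤ gaussDensity d r := by
  unfold gaussDensity; positivity

/-- The two characteristic functions agree. The density form is what polar coordinates and exact
moments of the norm require. -/
theorem gauss_eq_withDensity (d : ℕ) :
    gauss d = volume.withDensity fun x => ENNReal.ofReal (gaussDensity d ‖x‖) := by
  have hmeas : Measurable fun x : EuclideanSpace ℝ (Fin d) => gaussDensity d ‖x‖ := by
    unfold gaussDensity; fun_prop
  have hcpow : ((2 * π : ℝ) : ℂ) ^ (d / 2 : ℂ) = (((2 * π) ^ (d / 2 : ℝ) : ℝ) : ℂ) := by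
    rw [Complex.ofReal_cpow (by positivity)]; push_cast; rfl
  have hint : Integrable (fun x : EuclideanSpace ℝ (Fin d) => gaussDensity d ‖x‖) := by
    have h := (GaussianFourier.integrable_cexp_neg_mul_sq_norm_add (V := EuclideanSpace ℝ (Fin d))
      (b := 1 / 2) (by norm_num) 0 0).norm
    simp only [gaussDensity]
    refine (h.congr (Eventually.of_forall fun x => ?_)).const_mul _
    simp only [Complex.norm_exp]
    congr 1
    simp [← Complex.ofReal_pow]
  have : IsFiniteMeasure (volume.withDensity fun x : EuclideanSpace ℝ (Fin d) =>
      ENNReal.ofReal (gaussDensity d ‖x‖)) :=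
    isFiniteMeasure_withDensity_ofReal hint.2
  refine Measure.ext_of_charFun (E := EuclideanSpace ℝ (Fin d)) ?_
  ext t
  rw [charFun_stdGaussian, charFun_apply, integral_withDensity_eq_integral_toReal_smul
    (by fun_prop) (Eventually.of_forall fun _ => ENNReal.ofReal_lt_top)]
  have h := GaussianFourier.integral_cexp_neg_mul_sq_norm_add (V := EuclideanSpace ℝ (Fin d))
      (b := 1 / 2) (by norm_num) Complex.I t
  have h2 : ∀ x : EuclideanSpace ℝ (Fin d),
      (ENNReal.ofReal (gaussDensity d ‖x‖)).toReal • Complex.exp (((⟪x, t⟫ : ℝ) : ℂ) * Complex.I) =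
      ((2 * π) ^ (-(d / 2 : ℝ)) : ℝ) *
        Complex.exp (-(1 / 2) * ‖x‖ ^ 2 + Complex.I * ((⟪t, x⟫ : ℝ) : ℂ)) := by
    intro x
    rw [ENNReal.toReal_ofReal (gaussDensity_nonneg _ _), gaussDensity, Complex.real_smul,
      Complex.ofReal_mul, mul_assoc, Complex.ofReal_exp, ← Complex.exp_add, real_inner_comm t x]
    congr 2
    push_cast
    ring
  simp_rw [h2]
  rw [integral_const_mul, h]
  have h3 : (π / (1 / 2) : ℂ) = ((2 * π : ℝ) : ℂ) := by push_cast; ring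
  have h4 : (Module.finrank ℝ (EuclideanSpace ℝ (Fin d)) : ℂ) = d := by simp
  rw [h3, h4, hcpow, ← mul_assoc, ← Complex.ofReal_mul, ← Real.rpow_add (by positivity)]
  simp only [neg_add_cancel, Real.rpow_zero, Complex.ofReal_one, one_mul, Complex.I_sq]
  congr 1
  ring

/-- Polar decomposition of the standard Gaussian measure: direction and length are independent,
and the direction is uniform on the sphere. -/
theorem exists_polar_gauss {d : ℕ} (hd : 1 ≤ d) :
    ∃ ρ : Measure (Set.Ioi (0 : ℝ)), IsProbabilityMeasure ρ ∧
      ∀ f : EuclideanSpace ℝ (Fin d) → ℝ≥0∞, Measurable f →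
        ∫⁻ x, f x ∂(gauss d) = ∫⁻ q, f (q.2.1 • q.1.1) ∂((unifSphere d).prod ρ) := by
  have hne : NeZero d := ⟨by omega⟩
  have := isProbabilityMeasure_unifSphere hd
  set m := (volume : Measure (EuclideanSpace ℝ (Fin d))).toSphere with hm
  have hK0 : m Set.univ ≠ 0 := Measure.measure_univ_ne_zero.2 (Measure.toSphere_ne_zero _)
  have hKt : m Set.univ ≠ ∞ := measure_ne_top _ _
  have hmu : m = m Set.univ • unifSphere d := by
    rw [unifSphere, smul_smul, ENNReal.mul_inv_cancel hK0 hKt, one_smul]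
  set v := Measure.volumeIoiPow (Module.finrank ℝ (EuclideanSpace ℝ (Fin d)) - 1) with hv
  set g : Set.Ioi (0 : ℝ) → ℝ≥0∞ := fun r => ENNReal.ofReal (gaussDensity d r.1) with hg
  have hgm : Measurable g := by
    simp only [hg, gaussDensity]; fun_prop
  set ρ : Measure (Set.Ioi (0 : ℝ)) := m Set.univ • v.withDensity g with hρ
  have hsig : SigmaFinite (v.withDensity g) := by
    have : SFinite (v.withDensity g) := inferInstance
    exact SigmaFinite.withDensity_of_ne_top (Eventually.of_forall fun _ => ENNReal.ofReal_ne_top)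
  have hsigρ : SFinite ρ := inferInstance
  have hdens : Measurable fun x : EuclideanSpace ℝ (Fin d) => ENNReal.ofReal (gaussDensity d ‖x‖) := by
    unfold gaussDensity; fun_prop
  have key : ∀ f : EuclideanSpace ℝ (Fin d) → ℝ≥0∞, Measurable f →
        ∫⁻ x, f x ∂(gauss d) = ∫⁻ q, f (q.2.1 • q.1.1) ∂((unifSphere d).prod ρ) := by
    intro f hf
    have hsm : Measurable fun q : USphere d × Set.Ioi (0 : ℝ) => f (q.2.1 • q.1.1) := by
      fun_prop
    rw [gauss_eq_withDensity, lintegral_withDensity_eq_lintegral_mul _ hdens hf]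
    have h1 : ∫⁻ x, ((fun x : EuclideanSpace ℝ (Fin d) => ENNReal.ofReal (gaussDensity d ‖x‖)) * f) x =
        ∫⁻ x : ({0}ᶜ : Set (EuclideanSpace ℝ (Fin d))),
          ENNReal.ofReal (gaussDensity d ‖x.1‖) * f x.1
          ∂(volume.comap (Subtype.val : ({0}ᶜ : Set (EuclideanSpace ℝ (Fin d))) → _)) := by
      rw [lintegral_subtype_comap (measurableSet_singleton _).compl
        (fun x : EuclideanSpace ℝ (Fin d) => ENNReal.ofReal (gaussDensity d ‖x‖) * f x),
        restrict_compl_singleton]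
      rfl
    have h2 := (volume : Measure (EuclideanSpace ℝ (Fin d))).measurePreserving_homeomorphUnitSphereProd
    have h3 := h2.lintegral_comp_emb (Homeomorph.measurableEmbedding _)
      (fun q => g q.2 * f (q.2.1 • q.1.1))
    rw [h1]
    have h4 : ∀ x : ({0}ᶜ : Set (EuclideanSpace ℝ (Fin d))),
        g (homeomorphUnitSphereProd (EuclideanSpace ℝ (Fin d)) x).2 *
          f ((homeomorphUnitSphereProd (EuclideanSpace ℝ (Fin d)) x).2.1 •
            (homeomorphUnitSphereProd (EuclideanSpace ℝ (Fin d)) x).1.1) =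
        ENNReal.ofReal (gaussDensity d ‖x.1‖) * f x.1 := by
      intro x
      have : ‖x.1‖ ≠ 0 := norm_ne_zero_iff.2 x.2
      simp [hg, smul_smul, this]
    simp_rw [h4] at h3
    rw [h3, ← hm, ← hv]
    conv_lhs => rw [hmu]
    rw [Measure.prod_smul_left, lintegral_smul_measure, hρ, Measure.prod_smul_right,
      lintegral_smul_measure]
    congr 1
    rw [prod_withDensity_right hgm, lintegral_withDensity_eq_lintegral_mul _ (by fun_prop) hsm]
    rfl
  refine ⟨ρ, ⟨?_⟩, key⟩
  -- Testing on the constant 1 shows that the radial law has mass one, so its normalisation is never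
  -- computed.
  have := key (fun _ => 1) measurable_const
  simp only [lintegral_const, one_mul, measure_univ] at this
  rw [← Set.univ_prod_univ, Measure.prod_prod, measure_univ, one_mul] at this
  exact this.symm

/-- A unit vector, used as the direction of the zero vector. -/
def poleVec (d : ℕ) [NeZero d] : USphere d :=
  ⟨EuclideanSpace.single 0 1, by simp⟩

open Classical in
/-- The direction of a vector. -/
def dir {d : ℕ} [NeZero d] (x : EuclideanSpace ℝ (Fin d)) : USphere d :=
  if h : x = 0 then poleVec d else ⟨‖x‖⁻¹ • x, by simp [norm_smul, h]⟩

theorem norm_smul_dir {d : ℕ} [NeZero d] (x : EuclideanSpace ℝ (Fin d)) :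
    ‖x‖ • (dir x).1 = x := by
  by_cases h : x = 0
  · simp [h]
  · simp [dir, h, smul_smul]

theorem measurable_dir {d : ℕ} [NeZero d] : Measurable (dir : EuclideanSpace ℝ (Fin d) → USphere d) := by
  refine (MeasurableEmbedding.subtype_coe
    Metric.isClosed_sphere.measurableSet).measurable_comp_iff.1 ?_
  have : (fun x : EuclideanSpace ℝ (Fin d) => (dir x : EuclideanSpace ℝ (Fin d))) =
      fun x => if x = 0 then (poleVec d : EuclideanSpace ℝ (Fin d)) else ‖x‖⁻¹ • x := by
    funext x; by_cases h : x = 0 <;> simp [dir, h]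
  refine Eq.mpr (congrArg Measurable this) ?_
  exact Measurable.ite (measurableSet_singleton _) measurable_const (by fun_prop)

theorem dir_smul {d : ℕ} [NeZero d] {r : ℝ} (hr : 0 < r) (u : USphere d) :
    dir (r • (u : EuclideanSpace ℝ (Fin d))) = u := by
  have hu : (u : EuclideanSpace ℝ (Fin d)) ≠ 0 := ne_zero_of_mem_unit_sphere u
  have h : r • (u : EuclideanSpace ℝ (Fin d)) ≠ 0 := smul_ne_zero hr.ne' hu
  ext1
  simp [dir, hr.ne', norm_smul, abs_of_pos hr, smul_smul, hu]

/-- The direction of r • u is u, so the radial factor of the polar decomposition integrates out.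
Through this identity a uniform cap centre is replaced by a Gaussian vector. -/
theorem map_dir_gauss (d : ℕ) [NeZero d] : (gauss d).map dir = unifSphere d := by
  obtain ⟨ρ, hρ, h⟩ := exists_polar_gauss (d := d) (NeZero.one_le)
  ext s hs
  rw [Measure.map_apply measurable_dir hs, ← lintegral_indicator_one (measurable_dir hs),
    h _ (measurable_one.indicator (measurable_dir hs))]
  have : ∀ q : USphere d × Set.Ioi (0 : ℝ),
      (dir ⁻¹' s).indicator (1 : EuclideanSpace ℝ (Fin d) → ℝ≥0∞) (q.2.1 • q.1.1) =
        (s ×ˢ Set.univ).indicator 1 q := by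
    intro q
    have h1 : q.2.1 • (q.1 : EuclideanSpace ℝ (Fin d)) ∈ dir ⁻¹' s ↔ q ∈ s ×ˢ Set.univ := by
      rw [Set.mem_preimage, dir_smul (Set.mem_Ioi.1 q.2.2) q.1]
      simp
    by_cases h2 : q ∈ s ×ˢ Set.univ
    · rw [Set.indicator_of_mem h2, Set.indicator_of_mem (h1.2 h2)]; rfl
    · rw [Set.indicator_of_notMem h2, Set.indicator_of_notMem (mt h1.1 h2)]
  simp_rw [this]
  rw [lintegral_indicator_one (hs.prod MeasurableSet.univ), Measure.prod_prod, measure_univ,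
    mul_one]

/-- A linear functional of norm `‖u‖` is a centred Gaussian variable. -/
theorem map_inner_gauss {d : ℕ} (z : USphere d) :
    (gauss d).map (fun v => ⟪(z : EuclideanSpace ℝ (Fin d)), v⟫) = gaussianReal 0 1 := by
  have : IsProbabilityMeasure ((gauss d).map (fun v => ⟪(z : EuclideanSpace ℝ (Fin d)), v⟫)) :=
    Measure.isProbabilityMeasure_map (by fun_prop)
  refine Measure.ext_of_charFun ?_
  ext t
  rw [charFun_gaussianReal, charFun_apply_real, integral_map (by fun_prop) (by fun_prop)]
  have h := charFun_stdGaussian (E := EuclideanSpace ℝ (Fin d)) (t • (z : EuclideanSpace ℝ (Fin d)))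
  rw [charFun_apply] at h
  simp only [inner_smul_right, norm_smul, norm_eq_of_mem_sphere, mul_one] at h
  simp only [real_inner_comm] at h ⊢
  convert h using 2
  all_goals try push_cast
  · rfl
  · have : ((‖t‖ : ℝ) : ℂ) ^ 2 = (t : ℂ) ^ 2 := by
      rw [← Complex.ofReal_pow, Real.norm_eq_abs, sq_abs, Complex.ofReal_pow]
    rw [this]
    simp [neg_div]

/-- The caps all have the same measure. -/
theorem unifSphere_real_cap {d : ℕ} [NeZero d] (τ : ℝ) (z : USphere d) :
    (unifSphere d).real {w | τ ≤ ⟪(z : EuclideanSpace ℝ (Fin d)), (w : EuclideanSpace ℝ (Fin d))⟫} =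
      capProb d τ := by
  have hprob := isProbabilityMeasure_unifSphere (d := d) (NeZero.one_le)
  have hmeas : ∀ z : USphere d, MeasurableSet {w : USphere d |
      τ ≤ ⟪(z : EuclideanSpace ℝ (Fin d)), (w : EuclideanSpace ℝ (Fin d))⟫} := fun z =>
    measurableSet_le measurable_const (by fun_prop)
  have hg : ∀ z : USphere d, unifSphere d
      {w | τ ≤ ⟪(z : EuclideanSpace ℝ (Fin d)), (w : EuclideanSpace ℝ (Fin d))⟫} =
      gauss d {x | τ ≤ ⟪(z : EuclideanSpace ℝ (Fin d)), (dir x : EuclideanSpace ℝ (Fin d))⟫} := by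
    intro z
    rw [← map_dir_gauss, Measure.map_apply measurable_dir (hmeas z)]
    rfl
  have hinv : ∀ z z' : USphere d, unifSphere d
      {w | τ ≤ ⟪(z : EuclideanSpace ℝ (Fin d)), (w : EuclideanSpace ℝ (Fin d))⟫} = unifSphere d
      {w | τ ≤ ⟪(z' : EuclideanSpace ℝ (Fin d)), (w : EuclideanSpace ℝ (Fin d))⟫} := by
    intro z z'
    -- This reflection exchanges the two centres and preserves the Gaussian measure. It commutes
    -- with `dir` off the origin, where the default direction would spoil equivariance.
    set R := ((ℝ ∙ ((z : EuclideanSpace ℝ (Fin d)) - z'))ᗮ).reflection with hR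
    have hz : R z = z' := Submodule.reflection_sub (by simp)
    have hdir : ∀ x, x ≠ 0 → (dir (R x) : EuclideanSpace ℝ (Fin d)) = R (dir x) := by
      intro x hx
      have : R x ≠ 0 := by simpa using hx
      simp [dir, hx]
    have hn0 : ∀ᵐ x ∂(gauss d), x ≠ 0 := by
      rw [gauss_eq_withDensity]
      refine (withDensity_absolutelyContinuous _ _).ae_le ?_
      change ∀ᵐ x ∂volume, x ≠ 0
      rw [ae_iff]
      simp
    have hm : MeasurableSet {x : EuclideanSpace ℝ (Fin d) |
        τ ≤ ⟪(z' : EuclideanSpace ℝ (Fin d)), (dir x : EuclideanSpace ℝ (Fin d))⟫} :=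
      measurable_dir (hmeas z')
    rw [hg z, hg z']
    conv_rhs => rw [gauss, ← stdGaussian_map R, Measure.map_apply (by fun_prop) hm]
    refine measure_congr ?_
    filter_upwards [hn0] with x hx
    simp only [Set.preimage_ofPred_eq, eq_iff_iff, ← hz]
    change τ ≤ _ ↔ τ ≤ _
    rw [hdir x hx, LinearIsometryEquiv.inner_map_map]
  rw [capProb, measureReal_def, measureReal_def,
    Measure.prod_apply (measurableSet_le measurable_const (by fun_prop))]
  congr 1
  symm
  change ∫⁻ a : USphere d, unifSphere d
    {w | τ ≤ ⟪(a : EuclideanSpace ℝ (Fin d)), (w : EuclideanSpace ℝ (Fin d))⟫} ∂(unifSphere d) = _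
  rw [lintegral_congr (g := fun _ => unifSphere d
    {w | τ ≤ ⟪(z : EuclideanSpace ℝ (Fin d)), (w : EuclideanSpace ℝ (Fin d))⟫})
    (fun z' => hinv z' z), lintegral_const, measure_univ, mul_one]

/-! ### Gaussian moments, concentration of the norm, subgaussian functionals on the sphere. -/

theorem integral_comp_inner_gauss {d : ℕ} (z : USphere d) (f : ℝ → ℝ) (hf : Measurable f) :
    ∫ v, f ⟪(z : EuclideanSpace ℝ (Fin d)), v⟫ ∂(gauss d) = ∫ x, f x ∂(gaussianReal 0 1) := by
  rw [← map_inner_gauss z, integral_map (by fun_prop) hf.aestronglyMeasurable]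

theorem integral_exp_mul_gaussianReal (t : ℝ) :
    ∫ x, exp (t * x) ∂(gaussianReal 0 1) = exp (t ^ 2 / 2) := by
  have := congrFun (mgf_id_gaussianReal (μ := 0) (v := 1)) t
  simpa [mgf] using this

theorem integral_exp_mul_norm_sq_gauss (d : ℕ) {θ : ℝ} (hθ : θ < 1 / 2) :
    ∫ x, exp (θ * ‖x‖ ^ 2) ∂(gauss d) = (1 - 2 * θ) ^ (-(d / 2 : ℝ)) := by
  rw [gauss_eq_withDensity, integral_withDensity_eq_integral_toReal_smul
    (by unfold gaussDensity; fun_prop) (Eventually.of_forall fun _ => ENNReal.ofReal_lt_top)]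
  have h2 : ∀ x : EuclideanSpace ℝ (Fin d),
      (ENNReal.ofReal (gaussDensity d ‖x‖)).toReal • exp (θ * ‖x‖ ^ 2) =
      (2 * π) ^ (-(d / 2 : ℝ)) * exp (-(1 / 2 - θ) * ‖x‖ ^ 2) := by
    intro x
    rw [ENNReal.toReal_ofReal (gaussDensity_nonneg _ _), gaussDensity, smul_eq_mul, mul_assoc,
      ← exp_add]
    ring_nf
  simp_rw [h2]
  have h0 : 0 < 1 / 2 - θ := by linarith
  rw [integral_const_mul, GaussianFourier.integral_rexp_neg_mul_sq_norm h0,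
    finrank_euclideanSpace_fin, Real.rpow_neg (by positivity), Real.rpow_neg (by linarith),
    ← Real.inv_rpow (by positivity), ← Real.mul_rpow (by positivity) (by positivity),
    ← Real.inv_rpow (by linarith)]
  congr 1
  have : 1 - 2 * θ ≠ 0 := by linarith
  field_simp

theorem integrable_exp_mul_norm_sq_gauss (d : ℕ) {θ : ℝ} (hθ : θ < 1 / 2) :
    Integrable (fun x => exp (θ * ‖x‖ ^ 2)) (gauss d) := by
  -- A non-integrable function has integral zero by convention, but the closed form is positive.
  by_contra h
  have h1 := integral_exp_mul_norm_sq_gauss d hθ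
  rw [integral_undef h] at h1
  have : 0 < (1 - 2 * θ) ^ (-(d / 2 : ℝ)) := Real.rpow_pos_of_pos (by linarith) _
  linarith

theorem exp_neg_sub_sq_le {x : ℝ} (hx : |x| ≤ 1 / 2) : exp (-(x + x ^ 2)) ≤ 1 - x := by
  obtain ⟨h1, h2⟩ := abs_le.1 hx
  rw [exp_neg, inv_le_comm₀ (exp_pos _) (by linarith)]
  rw [inv_le_iff_one_le_mul₀ (by linarith)]
  rcases le_total 0 x with h | h
  · have h3 := Real.quadratic_le_exp_of_nonneg (x := x + x ^ 2) (by positivity)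
    have h4 : 0 ≤ x ^ 2 * ((1 - x) * (1 + x) ^ 2 / 2 - x) := by
      refine mul_nonneg (sq_nonneg _) ?_
      nlinarith
    nlinarith
  · have h3 := Real.add_one_le_exp (x + x ^ 2)
    nlinarith [pow_nonneg (neg_nonneg.2 h) 3]

theorem integral_exp_mul_norm_sq_gauss_le (d : ℕ) {θ : ℝ} (hθ : |θ| ≤ 1 / 4) :
    ∫ x, exp (θ * ‖x‖ ^ 2) ∂(gauss d) ≤ exp (d * (θ + 2 * θ ^ 2)) := by
  obtain ⟨h1, h2⟩ := abs_le.1 hθ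
  rw [integral_exp_mul_norm_sq_gauss d (by linarith)]
  have h := exp_neg_sub_sq_le (x := 2 * θ) (by rw [abs_mul, abs_two]; linarith)
  calc (1 - 2 * θ) ^ (-(d / 2 : ℝ)) ≤ exp (-(2 * θ + (2 * θ) ^ 2)) ^ (-(d / 2 : ℝ)) :=
        Real.rpow_le_rpow_of_nonpos (exp_pos _) h (by simp; positivity)
    _ = exp (d * (θ + 2 * θ ^ 2)) := by
        rw [← exp_mul]; ring_nf

/-- Concentration of the norm of a Gaussian vector. -/
theorem gauss_norm_deviation_le (d : ℕ) {η : ℝ} (h0 : 0 ≤ η) (h1 : η ≤ 1) :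
    (gauss d).real {x | η * √d < |‖x‖ - √d|} ≤ 2 * exp (-(η ^ 2 * d / 8)) := by
  have hd : √(d : ℝ) ^ 2 = d := Real.sq_sqrt (by positivity)
  have hs : (0 : ℝ) ≤ √d := Real.sqrt_nonneg _
  have key : ∀ θ : ℝ, |θ| ≤ 1 / 4 → ∀ s : ℝ,
      (gauss d).real {x | s ≤ θ * ‖x‖ ^ 2} ≤ exp (-s) * exp (d * (θ + 2 * θ ^ 2)) := by
    intro θ hθ s
    have hθ' := (abs_le.1 hθ).2
    have hm := mul_meas_ge_le_integral_of_nonneg (μ := gauss d)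
      (f := fun x => exp (θ * ‖x‖ ^ 2)) (Eventually.of_forall fun x => (exp_pos _).le)
      (integrable_exp_mul_norm_sq_gauss d (by linarith)) (exp s)
    simp only [exp_le_exp] at hm
    rw [exp_neg, ← div_eq_inv_mul, le_div_iff₀' (exp_pos _)]
    exact hm.trans (integral_exp_mul_norm_sq_gauss_le d hθ)
  have hsub : {x : EuclideanSpace ℝ (Fin d) | η * √d < |‖x‖ - √d|} ⊆
      {x | η / 4 * ((1 + η) * d) ≤ η / 4 * ‖x‖ ^ 2} ∪
      {x | -η / 4 * ((1 - η) * d) ≤ -η / 4 * ‖x‖ ^ 2} := by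
    intro x hx
    simp only [Set.mem_ofPred_eq] at hx
    rcases lt_abs.1 hx with h | h
    · left
      have h2 : (1 + η) * √d ≤ ‖x‖ := by linarith
      have h3 : ((1 + η) * √d) ^ 2 ≤ ‖x‖ ^ 2 := by gcongr
      rw [mul_pow, hd] at h3
      refine mul_le_mul_of_nonneg_left (le_trans ?_ h3) (by positivity)
      gcongr
      nlinarith
    · right
      have h2 : ‖x‖ ≤ (1 - η) * √d := by linarith
      have h3 : ‖x‖ ^ 2 ≤ ((1 - η) * √d) ^ 2 := by gcongr
      rw [mul_pow, hd] at h3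
      refine mul_le_mul_of_nonpos_left (h3.trans ?_) (by linarith)
      gcongr
      nlinarith
  refine (measureReal_mono hsub).trans ((measureReal_union_le _ _).trans ?_)
  -- The values θ = ±η/4 minimise the Chernoff exponent -|θ|ηd + 2θ²d.
  have k1 := key (η / 4) (by rw [abs_of_nonneg (by positivity)]; linarith) (η / 4 * ((1 + η) * d))
  have k2 := key (-η / 4) (by rw [neg_div, abs_neg, abs_of_nonneg (by positivity)]; linarith)
    (-η / 4 * ((1 - η) * d))
  rw [← exp_add] at k1 k2
  have e1 : -(η / 4 * ((1 + η) * d)) + d * (η / 4 + 2 * (η / 4) ^ 2) = -(η ^ 2 * d / 8) := by ring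
  have e2 : -(-η / 4 * ((1 - η) * d)) + d * (-η / 4 + 2 * (-η / 4) ^ 2) = -(η ^ 2 * d / 8) := by
    ring
  rw [e1] at k1
  rw [e2] at k2
  linarith

/-- Markov's inequality for exp(-8‖x‖²/d), whose mean (1 + 16/d)^(-d/2) is at most 1/4 by Bernoulli.
It holds in every dimension, which is why the subgaussian bound on the sphere needs no lower bound
on d beyond 1. -/
theorem half_le_gauss_norm {d : ℕ} (hd : 1 ≤ d) :
    1 / 2 ≤ (gauss d).real {x | √d / 4 ≤ ‖x‖} := by
  have hd' : (1 : ℝ) ≤ d := by exact_mod_cast hd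
  have hd0 : (0 : ℝ) < d := by linarith
  have hsd : √(d : ℝ) ^ 2 = d := Real.sq_sqrt (by positivity)
  have hneg : -8 / (d : ℝ) < 1 / 2 := by
    have : -8 / (d : ℝ) < 0 := div_neg_of_neg_of_pos (by norm_num) hd0
    linarith
  have hm := mul_meas_ge_le_integral_of_nonneg (μ := gauss d)
      (f := fun x => exp (-8 / d * ‖x‖ ^ 2)) (Eventually.of_forall fun x => (exp_pos _).le)
      (integrable_exp_mul_norm_sq_gauss d hneg) (exp (-1 / 2))
  rw [integral_exp_mul_norm_sq_gauss d hneg] at hm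
  have hb : (1 - 2 * (-8 / (d : ℝ))) ^ (-(d / 2 : ℝ)) ≤ 1 / 4 := by
    have h1 : 1 + (d : ℝ) * (16 / d) ≤ (1 + 16 / (d : ℝ)) ^ d :=
      one_add_mul_le_pow (le_trans (by norm_num) (by positivity : (0 : ℝ) ≤ 16 / d)) d
    have h2 : (16 : ℝ) ≤ (1 + 16 / (d : ℝ)) ^ d := by
      refine le_trans ?_ h1
      rw [mul_div_cancel₀ _ hd0.ne']
      norm_num
    have h3 : (1 - 2 * (-8 / (d : ℝ))) ^ (-(d / 2 : ℝ)) =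
        (((1 + 16 / (d : ℝ)) ^ d) ^ (1 / 2 : ℝ))⁻¹ := by
      rw [Real.rpow_neg (by ring_nf; positivity), ← Real.rpow_natCast,
        ← Real.rpow_mul (by positivity)]
      ring_nf
    rw [h3]
    have h4 : (4 : ℝ) ≤ ((1 + 16 / (d : ℝ)) ^ d) ^ (1 / 2 : ℝ) := by
      rw [← Real.sqrt_eq_rpow]
      exact Real.le_sqrt_of_sq_le (by linarith)
    rw [inv_le_comm₀ (by linarith) (by norm_num)]
    linarith
  have hsub : {x : EuclideanSpace ℝ (Fin d) | √d / 4 ≤ ‖x‖}ᶜ ⊆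
      {x | exp (-1 / 2) ≤ exp (-8 / d * ‖x‖ ^ 2)} := by
    intro x hx
    simp only [Set.mem_compl_iff, Set.mem_ofPred_eq, not_le, exp_le_exp] at hx ⊢
    have h5 : ‖x‖ ^ 2 ≤ (√d / 4) ^ 2 := by gcongr
    rw [div_pow, hsd] at h5
    rw [div_mul_eq_mul_div, le_div_iff₀ hd0]
    linarith
  have h6 := measureReal_mono (μ := gauss d) hsub
  rw [probReal_compl_eq_one_sub (measurableSet_le measurable_const (by fun_prop))] at h6
  have h7 : 1 / 2 ≤ exp (-1 / 2 : ℝ) := by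
    have := Real.add_one_le_exp (-1 / 2 : ℝ)
    linarith
  have h8 : 0 ≤ (gauss d).real {x | exp (-1 / 2) ≤ exp (-8 / d * ‖x‖ ^ 2)} := measureReal_nonneg
  nlinarith

/-- Linear functionals on the sphere are subgaussian with variance proxy of order `1 / d`. -/
theorem integral_exp_abs_inner_unifSphere_le {d : ℕ} (hd : 1 ≤ d) (u : USphere d) (θ : ℝ) :
    ∫ z, exp (θ * |⟪(z : EuclideanSpace ℝ (Fin d)), (u : EuclideanSpace ℝ (Fin d))⟫|)
      ∂(unifSphere d) ≤ 4 * exp (8 * θ ^ 2 / d) := by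
  have := isProbabilityMeasure_unifSphere hd
  obtain ⟨ρ, hρ, hpol⟩ := exists_polar_gauss hd
  have hd0 : (0 : ℝ) < d := by exact_mod_cast hd
  have hsd : √(d : ℝ) ^ 2 = d := Real.sq_sqrt (by positivity)
  have hs0 : 0 < √(d : ℝ) := Real.sqrt_pos.2 hd0
  -- At radius √d/4 the factor κr equals θ. Larger radii have probability at least 1/2, and cosh
  -- grows with |·|, so half of the spherical mean of cosh(θ⟨z, u⟩) is at most the Gaussian mean of
  -- cosh(κ⟨x, u⟩), which is exp(8θ²/d). The constant 4 collects this factor 2 and the one in exp|x|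
  -- ≤ 2 cosh x.
  set κ := 4 * θ / √d with hκ
  have hκ2 : κ * (√d / 4) = θ := by rw [hκ]; field_simp
  have hcosh : ∫⁻ x, ENNReal.ofReal (cosh (κ * ⟪x, (u : EuclideanSpace ℝ (Fin d))⟫)) ∂(gauss d) =
      ENNReal.ofReal (exp (8 * θ ^ 2 / d)) := by
    have hi : ∀ t : ℝ, Integrable (fun x => exp (t * ⟪(u : EuclideanSpace ℝ (Fin d)), x⟫))
        (gauss d) := by
      intro t
      have h := integrable_exp_mul_gaussianReal (μ := 0) (v := 1) t
      rw [← map_inner_gauss u] at h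
      exact h.comp_measurable (by fun_prop)
    have hcong : ∀ x : EuclideanSpace ℝ (Fin d), cosh (κ * ⟪x, (u : EuclideanSpace ℝ (Fin d))⟫) =
        (exp (κ * ⟪(u : EuclideanSpace ℝ (Fin d)), x⟫) +
          exp (-κ * ⟪(u : EuclideanSpace ℝ (Fin d)), x⟫)) / 2 := by
      intro x
      rw [cosh_eq, real_inner_comm, neg_mul]
    simp_rw [hcong]
    have hI : Integrable (fun x => (exp (κ * ⟪(u : EuclideanSpace ℝ (Fin d)), x⟫) +
        exp (-κ * ⟪(u : EuclideanSpace ℝ (Fin d)), x⟫)) / 2) (gauss d) :=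
      ((hi κ).add (hi (-κ))).div_const 2
    rw [← ofReal_integral_eq_lintegral_ofReal hI (Eventually.of_forall fun x => by positivity)]
    congr 1
    rw [integral_div, integral_add (hi κ) (hi (-κ)),
      integral_comp_inner_gauss u (fun y => exp (κ * y)) (by fun_prop),
      integral_comp_inner_gauss u (fun y => exp (-κ * y)) (by fun_prop),
      integral_exp_mul_gaussianReal, integral_exp_mul_gaussianReal, neg_sq, add_self_div_two]
    congr 1
    rw [hκ, div_pow, hsd]
    ring
  have hhalf : (1 / 2 : ℝ≥0∞) ≤ ρ {r | √d / 4 ≤ r.1} := by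
    have hms : MeasurableSet {x : EuclideanSpace ℝ (Fin d) | √d / 4 ≤ ‖x‖} :=
      measurableSet_le measurable_const (by fun_prop)
    have hms' : MeasurableSet {r : Set.Ioi (0 : ℝ) | √d / 4 ≤ r.1} :=
      measurableSet_le measurable_const (by fun_prop)
    have h1 := hpol ({x | √d / 4 ≤ ‖x‖}.indicator 1) (measurable_one.indicator hms)
    rw [lintegral_indicator_one hms] at h1
    have h2 : ∀ q : USphere d × Set.Ioi (0 : ℝ),
        ({x : EuclideanSpace ℝ (Fin d) | √d / 4 ≤ ‖x‖}.indicator 1 (q.2.1 • q.1.1) : ℝ≥0∞) =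
          (Set.univ ×ˢ {r : Set.Ioi (0 : ℝ) | √d / 4 ≤ r.1}).indicator 1 q := by
      intro q
      have hq : ‖q.2.1 • (q.1 : EuclideanSpace ℝ (Fin d))‖ = q.2.1 := by
        rw [norm_smul, norm_eq_of_mem_sphere, mul_one, Real.norm_of_nonneg (le_of_lt q.2.2)]
      simp only [Set.indicator, Set.mem_ofPred_eq, hq, Set.mem_prod, Set.mem_univ, true_and]
      rfl
    simp_rw [h2] at h1
    rw [lintegral_indicator_one (MeasurableSet.univ.prod hms'), Measure.prod_prod, measure_univ,
      one_mul] at h1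
    rw [← h1]
    have h3 := half_le_gauss_norm hd
    rw [← ENNReal.ofReal_toReal (measure_ne_top (gauss d) {x | √d / 4 ≤ ‖x‖})]
    have h4 : (1 / 2 : ℝ≥0∞) = ENNReal.ofReal (1 / 2) := by
      rw [ENNReal.ofReal_div_of_pos (by norm_num)]; simp
    rw [h4]
    exact ENNReal.ofReal_le_ofReal h3
  have hmc : Measurable fun z : USphere d =>
      ENNReal.ofReal (cosh (θ * ⟪(z : EuclideanSpace ℝ (Fin d)), (u : EuclideanSpace ℝ (Fin d))⟫)) := by
    have := continuous_cosh
    fun_prop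
  have hlow : (1 / 2) * ∫⁻ z, ENNReal.ofReal (cosh (θ * ⟪(z : EuclideanSpace ℝ (Fin d)),
      (u : EuclideanSpace ℝ (Fin d))⟫)) ∂(unifSphere d) ≤ ENNReal.ofReal (exp (8 * θ ^ 2 / d)) := by
    have hmc2 : Measurable fun x : EuclideanSpace ℝ (Fin d) =>
        ENNReal.ofReal (cosh (κ * ⟪x, (u : EuclideanSpace ℝ (Fin d))⟫)) := by
      have := continuous_cosh
      fun_prop
    have hms' : MeasurableSet {r : Set.Ioi (0 : ℝ) | √d / 4 ≤ r.1} :=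
      measurableSet_le measurable_const (by fun_prop)
    rw [← hcosh, hpol _ hmc2]
    calc _ ≤ ρ {r | √d / 4 ≤ r.1} * ∫⁻ z, ENNReal.ofReal (cosh (θ * ⟪(z : EuclideanSpace ℝ (Fin d)),
            (u : EuclideanSpace ℝ (Fin d))⟫)) ∂(unifSphere d) := by gcongr
      _ = ∫⁻ q, ENNReal.ofReal (cosh (θ * ⟪(q.1 : EuclideanSpace ℝ (Fin d)),
            (u : EuclideanSpace ℝ (Fin d))⟫)) * {r : Set.Ioi (0 : ℝ) | √d / 4 ≤ r.1}.indicator 1 q.2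
            ∂((unifSphere d).prod ρ) := by
          rw [lintegral_prod_mul hmc.aemeasurable (measurable_one.indicator hms').aemeasurable,
            lintegral_indicator_one hms', mul_comm]
      _ ≤ _ := by
          refine lintegral_mono fun q => ?_
          by_cases hq : q.2 ∈ {r : Set.Ioi (0 : ℝ) | √d / 4 ≤ r.1}
          · rw [Set.indicator_of_mem hq, Pi.one_apply, mul_one]
            refine ENNReal.ofReal_le_ofReal ?_
            rw [cosh_le_cosh, real_inner_smul_left, ← hκ2, mul_assoc, abs_mul, abs_mul κ]
            refine mul_le_mul_of_nonneg_left ?_ (abs_nonneg _)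
            rw [abs_mul, abs_mul]
            refine mul_le_mul_of_nonneg_right ?_ (abs_nonneg _)
            have hq' : √d / 4 ≤ q.2.1 := hq
            rw [abs_of_nonneg (by positivity), abs_of_nonneg (le_trans (by positivity) hq')]
            exact hq'
          · rw [Set.indicator_of_notMem hq, mul_zero]
            exact zero_le
  have hbd : ∀ z : USphere d,
      |⟪(z : EuclideanSpace ℝ (Fin d)), (u : EuclideanSpace ℝ (Fin d))⟫| ≤ 1 := by
    intro z
    simpa using abs_real_inner_le_norm (z : EuclideanSpace ℝ (Fin d)) (u : EuclideanSpace ℝ (Fin d))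
  have hle : ∀ z : USphere d,
      exp (θ * |⟪(z : EuclideanSpace ℝ (Fin d)), (u : EuclideanSpace ℝ (Fin d))⟫|) ≤
      2 * cosh (θ * ⟪(z : EuclideanSpace ℝ (Fin d)), (u : EuclideanSpace ℝ (Fin d))⟫) := by
    intro z
    rw [cosh_eq, mul_div_cancel₀ _ two_ne_zero]
    rcases abs_choice ⟪(z : EuclideanSpace ℝ (Fin d)), (u : EuclideanSpace ℝ (Fin d))⟫ with h | h <;>
      rw [h]
    · linarith [exp_pos (-(θ * ⟪(z : EuclideanSpace ℝ (Fin d)), (u : EuclideanSpace ℝ (Fin d))⟫))]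
    · rw [mul_neg]
      linarith [exp_pos (θ * ⟪(z : EuclideanSpace ℝ (Fin d)), (u : EuclideanSpace ℝ (Fin d))⟫)]
  rw [integral_eq_lintegral_of_nonneg_ae (Eventually.of_forall fun z => (exp_pos _).le)
    (by fun_prop)]
  refine ENNReal.toReal_le_of_le_ofReal (by positivity) ?_
  calc _ ≤ ∫⁻ z, 2 * ENNReal.ofReal (cosh (θ * ⟪(z : EuclideanSpace ℝ (Fin d)),
      (u : EuclideanSpace ℝ (Fin d))⟫)) ∂(unifSphere d) := by
        refine lintegral_mono fun z => ?_
        refine (ENNReal.ofReal_le_ofReal (hle z)).trans_eq ?_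
        rw [ENNReal.ofReal_mul (by norm_num)]; simp
    _ = 4 * ((1 / 2) * ∫⁻ z, ENNReal.ofReal (cosh (θ * ⟪(z : EuclideanSpace ℝ (Fin d)),
      (u : EuclideanSpace ℝ (Fin d))⟫)) ∂(unifSphere d)) := by
        rw [lintegral_const_mul _ hmc, ← mul_assoc]
        congr 1
        rw [show (4 : ℝ≥0∞) = 2 * 2 by norm_num, mul_assoc, one_div,
          ENNReal.mul_inv_cancel (by norm_num) (by norm_num), mul_one]
    _ ≤ 4 * ENNReal.ofReal (exp (8 * θ ^ 2 / d)) := by gcongr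
    _ = _ := by rw [ENNReal.ofReal_mul (by norm_num)]; simp

/-! ### Gaussian concentration for functions whose logarithm is Lipschitz. -/

section MaureyPisier

variable {d : ℕ}

local notation "𝔼" => EuclideanSpace ℝ (Fin d)

theorem integrable_exp_mul_norm_gauss (C : ℝ) :
    Integrable (fun x : 𝔼 => exp (C * ‖x‖)) (gauss d) := by
  have h := (integrable_exp_mul_norm_sq_gauss d (θ := 1 / 4) (by norm_num)).const_mul (exp (C ^ 2))
  refine h.mono' (by fun_prop) (Eventually.of_forall fun x => ?_)
  rw [Real.norm_of_nonneg (exp_pos _).le, ← exp_add, exp_le_exp]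
  nlinarith [sq_nonneg (C - ‖x‖ / 2)]

theorem integrable_exp_mul_norm_add_norm (C : ℝ) :
    Integrable (fun q : 𝔼 × 𝔼 => exp (C * (‖q.1‖ + ‖q.2‖))) ((gauss d).prod (gauss d)) := by
  have := (integrable_exp_mul_norm_gauss (d := d) C).mul_prod
    (integrable_exp_mul_norm_gauss (d := d) C)
  refine this.congr (Eventually.of_forall fun q => ?_)
  simp only [← exp_add, mul_add]

theorem integral_exp_clm_gauss [NeZero d] (l : 𝔼 →L[ℝ] ℝ) :
    Integrable (fun y => exp (l y)) (gauss d) ∧ ∫ y, exp (l y) ∂(gauss d) = exp (‖l‖ ^ 2 / 2) := by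
  set u := (InnerProductSpace.toDual ℝ 𝔼).symm l with hu
  have hl : ∀ y, l y = ‖u‖ * ⟪(dir u : 𝔼), y⟫ := by
    intro y
    rw [← real_inner_smul_left, norm_smul_dir, hu, InnerProductSpace.toDual_symm_apply]
  have hn : ‖u‖ = ‖l‖ := by rw [hu, LinearIsometryEquiv.norm_map]
  simp_rw [hl]
  constructor
  · have h := integrable_exp_mul_gaussianReal (μ := 0) (v := 1) ‖u‖
    rw [← map_inner_gauss (dir u)] at h
    exact h.comp_measurable (by fun_prop)
  · rw [integral_comp_inner_gauss (dir u) (fun y => exp (‖u‖ * y)) (by fun_prop),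
      integral_exp_mul_gaussianReal, hn]

theorem norm_sub_rotate_le {ε : ℝ} (h0 : 0 ≤ ε) (h2 : ε ≤ 2) (x y : 𝔼) :
    ‖x - (cos ε • x + sin ε • y)‖ ≤ ε * (‖x‖ + ‖y‖) := by
  have h : x - (cos ε • x + sin ε • y) = (1 - cos ε) • x - sin ε • y := by
    rw [sub_smul, one_smul]; abel
  rw [h]
  refine (norm_sub_le _ _).trans ?_
  rw [norm_smul, norm_smul, mul_add, Real.norm_eq_abs, Real.norm_eq_abs,
    abs_of_nonneg (by linarith [cos_le_one ε])]
  have h1 := Real.one_sub_sq_div_two_le_cos (x := ε)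
  have h3 : |sin ε| ≤ ε := by
    have := Real.abs_sin_le_abs (x := ε)
    rwa [abs_of_nonneg h0] at this
  gcongr
  nlinarith

theorem lipschitz_of_norm_fderiv_le {h : 𝔼 → ℝ} (hd : Differentiable ℝ h) {L : ℝ}
    (hL : ∀ x, ‖fderiv ℝ h x‖ ≤ L) (x y : 𝔼) : |h x - h y| ≤ L * ‖x - y‖ := by
  have := convex_univ.norm_image_sub_le_of_norm_fderiv_le (𝕜 := ℝ)
    (fun z _ => hd z) (fun z _ => hL z) (Set.mem_univ y) (Set.mem_univ x)
  rwa [Real.norm_eq_abs] at this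

/-- **Maurey–Pisier inequality**: if `h` has gradient at most `L`, then the difference of `h` at
two independent Gaussian points is subgaussian. -/
theorem integral_exp_sub_le [NeZero d] {h : 𝔼 → ℝ} (hdiff : Differentiable ℝ h) {L : ℝ}
    (hL : ∀ x, ‖fderiv ℝ h x‖ ≤ L) :
    ∫ q, exp (h q.1 - h q.2) ∂((gauss d).prod (gauss d)) ≤ exp (π ^ 2 * L ^ 2 / 8) := by
  have hL0 : 0 ≤ L := (norm_nonneg _).trans (hL 0)
  have hcont : Continuous h := hdiff.continuous
  have hlip := lipschitz_of_norm_fderiv_le hdiff hL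
  set γ2 := (gauss d).prod (gauss d) with hγ2
  have hrot : ∀ t : ℝ, MeasurePreserving (ContinuousLinearMap.rotation (E := 𝔼) t) γ2 γ2 := by
    intro t
    exact ⟨by fun_prop, IsGaussian.map_rotation_eq_self (by simp) t⟩
  -- Rotation by angle π/2 in N equal steps carries the first point to the second. By Jensen, the
  -- exponential of the total difference is at most the average of the exponentials of N times the
  -- increments. By rotation invariance all these have the mean of `G N`.
  set G : ℕ → 𝔼 × 𝔼 → ℝ := fun N q =>
    exp (N * (h q.1 - h (cos (π / (2 * N)) • q.1 + sin (π / (2 * N)) • q.2))) with hG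
  have heps : ∀ N : ℕ, 1 ≤ N → 0 ≤ π / (2 * N) ∧ π / (2 * N) ≤ 2 := by
    intro N hN
    have hN' : (1 : ℝ) ≤ N := by exact_mod_cast hN
    refine ⟨by positivity, ?_⟩
    rw [div_le_iff₀ (by positivity)]
    nlinarith [pi_le_four]
  have hGm : ∀ N, Continuous (G N) := by
    intro N; simp only [hG]; fun_prop
  have hdom : ∀ N : ℕ, 1 ≤ N → ∀ q, ‖G N q‖ ≤ exp (L * (π / 2) * (‖q.1‖ + ‖q.2‖)) := by
    intro N hN q
    have hN' : (0 : ℝ) < N := by exact_mod_cast hN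
    simp only [hG]
    rw [Real.norm_of_nonneg (exp_pos _).le, exp_le_exp]
    have h1 := (le_abs_self _).trans
      (hlip q.1 (cos (π / (2 * N)) • q.1 + sin (π / (2 * N)) • q.2))
    have h2 := norm_sub_rotate_le (heps N hN).1 (heps N hN).2 q.1 q.2
    calc _ ≤ N * (L * (π / (2 * N) * (‖q.1‖ + ‖q.2‖))) := by
          gcongr
          exact h1.trans (by gcongr)
      _ = _ := by field_simp
  have hdomI := integrable_exp_mul_norm_add_norm (d := d) (L * (π / 2))
  have hGI : ∀ N : ℕ, 1 ≤ N → Integrable (G N) γ2 := fun N hN =>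
    hdomI.mono' (hGm N).aestronglyMeasurable (Eventually.of_forall (hdom N hN))
  have hstep : ∀ N : ℕ, 1 ≤ N → ∫ q, exp (h q.1 - h q.2) ∂γ2 ≤ ∫ q, G N q ∂γ2 := by
    intro N hN
    have hN' : (0 : ℝ) < N := by exact_mod_cast hN
    set c : ℕ → 𝔼 × 𝔼 → 𝔼 × 𝔼 := fun i => ContinuousLinearMap.rotation (i * (π / (2 * N))) with hc
    have hcI : ∀ i, Integrable (fun q => G N (c i q)) γ2 := fun i =>
      (hrot _).integrable_comp_of_integrable (hGI N hN)
    have hcE : ∀ i, ∫ q, G N (c i q) ∂γ2 = ∫ q, G N q ∂γ2 := by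
      intro i
      have h1 := integral_map (μ := γ2) (φ := c i) (f := G N) (by fun_prop)
        (hGm N).aestronglyMeasurable
      rw [← h1, (hrot _).map_eq]
    have hsucc : ∀ i q, (cos (π / (2 * N)) • (c i q).1 + sin (π / (2 * N)) • (c i q).2) =
        (c (i + 1) q).1 := by
      intro i q
      simp only [hc, ContinuousLinearMap.rotation_apply]
      have : ((i + 1 : ℕ) : ℝ) * (π / (2 * N)) = i * (π / (2 * N)) + π / (2 * N) := by
        push_cast; ring
      rw [this, cos_add, sin_add]
      module
    have h0 : ∀ q, (c 0 q).1 = q.1 := by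
      intro q; simp [hc, ContinuousLinearMap.rotation_apply]
    have hNend : ∀ q, (c N q).1 = q.2 := by
      intro q
      have : (N : ℝ) * (π / (2 * N)) = π / 2 := by field_simp
      simp [hc, ContinuousLinearMap.rotation_apply, this]
    have hpt : ∀ q, exp (h q.1 - h q.2) ≤ ∑ i ∈ Finset.range N, (1 / (N : ℝ)) * G N (c i q) := by
      intro q
      have htel : h q.1 - h q.2 = ∑ i ∈ Finset.range N, (1 / (N : ℝ)) •
          (N * (h (c i q).1 - h (c (i + 1) q).1)) := by
        have := Finset.sum_range_sub' (fun i => h (c i q).1) N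
        rw [h0, hNend] at this
        rw [← this]
        refine Finset.sum_congr rfl fun i _ => ?_
        rw [smul_eq_mul]; field_simp
      rw [htel]
      have := convexOn_exp.map_sum_le (t := Finset.range N) (w := fun _ => 1 / (N : ℝ))
        (p := fun i => N * (h (c i q).1 - h (c (i + 1) q).1)) (fun i _ => by positivity)
        (by simp [hN'.ne']) (fun i _ => Set.mem_univ _)
      refine this.trans_eq (Finset.sum_congr rfl fun i _ => ?_)
      simp only [hG, hsucc, smul_eq_mul]
    calc ∫ q, exp (h q.1 - h q.2) ∂γ2
        ≤ ∫ q, ∑ i ∈ Finset.range N, (1 / (N : ℝ)) * G N (c i q) ∂γ2 := by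
          refine integral_mono_of_nonneg (Eventually.of_forall fun q => (exp_pos _).le) ?_
            (Eventually.of_forall hpt)
          exact integrable_finsetSum _ fun i _ => (hcI i).const_mul _
      _ = ∫ q, G N q ∂γ2 := by
          rw [integral_finsetSum _ fun i _ => (hcI i).const_mul _]
          simp_rw [integral_const_mul, hcE]
          simp [hN'.ne']
  -- The limit of `G N`. For fixed first point it is the exponential of a linear functional of an
  -- independent Gaussian vector, so its mean is explicit.
  set F : 𝔼 × 𝔼 → ℝ := fun q => exp (-(π / 2) * fderiv ℝ h q.1 q.2) with hF
  have hlim : ∀ q, Tendsto (fun N => G N q) atTop (nhds (F q)) := by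
    intro q
    simp only [hG, hF]
    refine (continuous_exp.tendsto _).comp ?_
    have hder : HasDerivAt (fun s : ℝ => h (cos s • q.1 + sin s • q.2)) (fderiv ℝ h q.1 q.2) 0 := by
      have hc : HasDerivAt (fun s : ℝ => cos s • q.1 + sin s • q.2)
          (-sin 0 • q.1 + cos 0 • q.2) 0 :=
        ((hasDerivAt_cos 0).smul_const q.1).add ((hasDerivAt_sin 0).smul_const q.2)
      have hh := (hdiff (cos 0 • q.1 + sin 0 • q.2)).hasFDerivAt.comp_hasDerivAt (0 : ℝ) hc
      simp only [cos_zero, sin_zero, one_smul, zero_smul, add_zero, neg_zero, zero_add] at hh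
      exact hh
    rw [hasDerivAt_iff_tendsto_slope] at hder
    have hε : Tendsto (fun N : ℕ => π / (2 * N)) atTop (nhdsWithin 0 {0}ᶜ) := by
      rw [tendsto_nhdsWithin_iff]
      constructor
      · have : Tendsto (fun N : ℕ => (π / 2) / (N : ℝ)) atTop (nhds 0) :=
          tendsto_const_div_atTop_nhds_zero_nat _
        refine this.congr fun N => ?_
        rw [div_div]
      · filter_upwards [eventually_ge_atTop 1] with N hN
        have hN' : (0 : ℝ) < N := by exact_mod_cast hN
        have : π / (2 * N) ≠ 0 := by positivity
        exact this
    have := (hder.comp hε).const_mul (-(π / 2))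
    refine this.congr' ?_
    filter_upwards [eventually_ge_atTop 1] with N hN
    have hN' : (0 : ℝ) < N := by exact_mod_cast hN
    simp only [Function.comp, slope_def_field, cos_zero, sin_zero, one_smul, zero_smul, add_zero,
      sub_zero]
    field_simp
    ring
  have hDCT : Tendsto (fun N => ∫ q, G N q ∂γ2) atTop (nhds (∫ q, F q ∂γ2)) := by
    refine tendsto_integral_filter_of_dominated_convergence _ ?_ ?_ hdomI
      (Eventually.of_forall hlim)
    · exact Eventually.of_forall fun N => (hGm N).aestronglyMeasurable
    · filter_upwards [eventually_ge_atTop 1] with N hN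
      exact Eventually.of_forall (hdom N hN)
  have hFm : AEStronglyMeasurable F γ2 :=
    aestronglyMeasurable_of_tendsto_ae atTop (fun N => (hGm N).aestronglyMeasurable)
      (Eventually.of_forall hlim)
  have hFI : Integrable F γ2 := by
    refine hdomI.mono' hFm (Eventually.of_forall fun q => ?_)
    exact le_of_tendsto (hlim q).norm (by
      filter_upwards [eventually_ge_atTop 1] with N hN using hdom N hN q)
  refine (ge_of_tendsto hDCT (by
    filter_upwards [eventually_ge_atTop 1] with N hN using hstep N hN)).trans ?_
  rw [hγ2, integral_prod _ hFI]
  have hin : ∀ x, ∫ y, F (x, y) ∂(gauss d) ≤ exp (π ^ 2 * L ^ 2 / 8) := by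
    intro x
    have := (integral_exp_clm_gauss (-(π / 2) • fderiv ℝ h x)).2
    simp only [hF]
    simp only [smul_apply, smul_eq_mul] at this
    rw [this, exp_le_exp, norm_smul, mul_pow, norm_neg, Real.norm_of_nonneg (by positivity)]
    have := pow_le_pow_left₀ (norm_nonneg _) (hL x) 2
    nlinarith [mul_le_mul_of_nonneg_left this (sq_nonneg π)]
  calc ∫ x, ∫ y, F (x, y) ∂(gauss d) ∂(gauss d) ≤ ∫ _, exp (π ^ 2 * L ^ 2 / 8) ∂(gauss d) :=
        integral_mono (hFI.integral_prod_left) (integrable_const _) hin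
    _ = _ := by simp

/-- Concentration of a positive function around its mean, when its logarithm has small gradient. -/
theorem gauss_mul_deviation_le [NeZero d] {H : 𝔼 → ℝ} (hpos : ∀ x, 0 < H x)
    (hdiff : Differentiable ℝ fun x => log (H x)) (hint : Integrable H (gauss d)) {L : ℝ}
    (hL : ∀ x, ‖fderiv ℝ (fun x => log (H x)) x‖ ≤ L) {θ : ℝ} (hθ : 1 ≤ θ) (ε : ℝ) :
    (gauss d).real {x | ¬(exp (-ε) * ∫ y, H y ∂(gauss d) < H x ∧
      H x < exp ε * ∫ y, H y ∂(gauss d))} ≤ 2 * exp (-(θ * ε) + π ^ 2 * (θ * L) ^ 2 / 8) := by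
  set m := ∫ y, H y ∂(gauss d) with hm
  set h := fun x => log (H x) with hh
  have hθ0 : 0 < θ := by linarith
  have hcont : Continuous h := hdiff.continuous
  have hm0 : 0 < m := by
    rw [hm, integral_pos_iff_support_of_nonneg (fun x => (hpos x).le) hint]
    have : Function.support H = Set.univ := by
      ext x; simp [(hpos x).ne']
    rw [this]; simp
  have hgrow : ∀ x, |h x| ≤ |h 0| + L * ‖x‖ := by
    intro x
    have h1 := lipschitz_of_norm_fderiv_le hdiff hL x 0
    rw [sub_zero] at h1
    have h2 := abs_sub_abs_le_abs_sub (h x) (h 0)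
    linarith
  have hexpI : ∀ t : ℝ, Integrable (fun x => exp (t * h x)) (gauss d) := by
    intro t
    refine ((integrable_exp_mul_norm_gauss (d := d) (|t| * L)).const_mul
      (exp (|t| * |h 0|))).mono' (by fun_prop) (Eventually.of_forall fun x => ?_)
    rw [Real.norm_of_nonneg (exp_pos _).le, ← exp_add, exp_le_exp]
    calc t * h x ≤ |t| * |h x| := by rw [← abs_mul]; exact le_abs_self _
      _ ≤ |t| * (|h 0| + L * ‖x‖) := by gcongr; exact hgrow x
      _ = _ := by ring
  -- Maurey–Pisier for θ log H factors by independence into the means of H^θ and H^(-θ). Each factor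
  -- is bounded below by the same power of m = E H, so Markov's inequality for one of them gives a
  -- tail around m itself, not around exp(E log H).
  have hprod : (∫ x, exp (θ * h x) ∂(gauss d)) * ∫ x, exp (-θ * h x) ∂(gauss d) ≤
      exp (π ^ 2 * (θ * L) ^ 2 / 8) := by
    have h1 := integral_exp_sub_le (h := fun x => θ * h x) (hdiff.const_mul θ) (L := θ * L)
      (fun x => by
        rw [fderiv_const_mul (hdiff x), norm_smul, Real.norm_of_nonneg hθ0.le]
        gcongr
        exact hL x)
    rw [← integral_prod_mul]
    refine le_of_eq_of_le (integral_congr_ae (Eventually.of_forall fun q => ?_)) h1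
    simp only [← exp_add]
    ring_nf
  have hI : Integrable (fun x => H x / m - 1) (gauss d) :=
    (hint.div_const m).sub (integrable_const 1)
  have hzero : ∫ x, (H x / m - 1) ∂(gauss d) = 0 := by
    rw [integral_sub (hint.div_const m) (integrable_const 1), integral_div, ← hm,
      div_self hm0.ne']
    simp
  -- Bernoulli's inequality at H/m - 1, which has mean zero; this is where θ ≥ 1 is needed.
  have hA : exp (θ * log m) ≤ ∫ x, exp (θ * h x) ∂(gauss d) := by
    have hpt : ∀ x, exp (θ * log m) * (1 + θ * (H x / m - 1)) ≤ exp (θ * h x) := by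
      intro x
      have h1 := one_add_mul_self_le_rpow_one_add (s := H x / m - 1) (p := θ)
        (by have := div_pos (hpos x) hm0; linarith) hθ
      rw [add_sub_cancel] at h1
      calc _ ≤ exp (θ * log m) * (H x / m) ^ θ := by gcongr
        _ = _ := by
          rw [Real.rpow_def_of_pos (div_pos (hpos x) hm0), log_div (hpos x).ne' hm0.ne', ← exp_add]
          simp only [hh]
          ring_nf
    have hI1 : Integrable (fun x => 1 + θ * (H x / m - 1)) (gauss d) :=
      (integrable_const 1).add (hI.const_mul θ)
    have h2 := integral_mono (hI1.const_mul (exp (θ * log m))) (hexpI θ) hpt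
    rw [integral_const_mul, integral_add (integrable_const 1) (hI.const_mul θ),
      integral_const_mul, hzero] at h2
    simpa using h2
  have hB : exp (-θ * log m) ≤ ∫ x, exp (-θ * h x) ∂(gauss d) := by
    have hpt : ∀ x, exp (-θ * log m) * (1 - θ * (H x / m - 1)) ≤ exp (-θ * h x) := by
      intro x
      have h1 := Real.log_le_sub_one_of_pos (div_pos (hpos x) hm0)
      have h2 := Real.add_one_le_exp (-θ * log (H x / m))
      calc _ ≤ exp (-θ * log m) * exp (-θ * log (H x / m)) := by
            gcongr
            nlinarith
        _ = _ := by
          rw [log_div (hpos x).ne' hm0.ne', ← exp_add]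
          simp only [hh]
          ring_nf
    have hI1 : Integrable (fun x => 1 - θ * (H x / m - 1)) (gauss d) :=
      (integrable_const 1).sub (hI.const_mul θ)
    have h2 := integral_mono (hI1.const_mul (exp (-θ * log m))) (hexpI (-θ)) hpt
    rw [integral_const_mul, integral_sub (integrable_const 1) (hI.const_mul θ),
      integral_const_mul, hzero] at h2
    simpa using h2
  set K := exp (π ^ 2 * (θ * L) ^ 2 / 8) with hK
  have hup : (gauss d).real {x | exp ε * m ≤ H x} ≤ exp (-(θ * ε)) * K := by
    have hm1 := mul_meas_ge_le_integral_of_nonneg (μ := gauss d)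
      (f := fun x => exp (θ * h x)) (Eventually.of_forall fun x => (exp_pos _).le)
      (hexpI θ) (exp (θ * (ε + log m)))
    have hset : {x | exp ε * m ≤ H x} = {x | exp (θ * (ε + log m)) ≤ exp (θ * h x)} := by
      ext x
      simp only [Set.mem_ofPred_eq, exp_le_exp, mul_le_mul_iff_right₀ hθ0, hh]
      rw [Real.le_log_iff_exp_le (hpos x), exp_add, exp_log hm0]
    rw [hset]
    set P := (gauss d).real {x | exp (θ * (ε + log m)) ≤ exp (θ * h x)} with hP
    have h1 : exp (θ * (ε + log m)) * P * exp (-θ * log m) ≤ K :=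
      (mul_le_mul hm1 hB (exp_pos _).le (integral_nonneg fun x => (exp_pos _).le)).trans hprod
    calc P = exp (-(θ * ε)) * (exp (θ * (ε + log m)) * P * exp (-θ * log m)) := by
          rw [mul_right_comm _ P, ← exp_add, ← mul_assoc, ← exp_add]
          ring_nf
          simp
      _ ≤ _ := by gcongr
  have hlow : (gauss d).real {x | H x ≤ exp (-ε) * m} ≤ exp (-(θ * ε)) * K := by
    have hm1 := mul_meas_ge_le_integral_of_nonneg (μ := gauss d)
      (f := fun x => exp (-θ * h x)) (Eventually.of_forall fun x => (exp_pos _).le)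
      (hexpI (-θ)) (exp (-θ * (-ε + log m)))
    have hset : {x | H x ≤ exp (-ε) * m} = {x | exp (-θ * (-ε + log m)) ≤ exp (-θ * h x)} := by
      ext x
      simp only [Set.mem_ofPred_eq, exp_le_exp, neg_mul, neg_le_neg_iff,
        mul_le_mul_iff_right₀ hθ0, hh]
      rw [Real.log_le_iff_le_exp (hpos x), exp_add, exp_log hm0]
    rw [hset]
    set P := (gauss d).real {x | exp (-θ * (-ε + log m)) ≤ exp (-θ * h x)} with hP
    have h1 : exp (θ * log m) * (exp (-θ * (-ε + log m)) * P) ≤ K :=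
      (mul_le_mul hA hm1 (by positivity) (integral_nonneg fun x => (exp_pos _).le)).trans hprod
    calc P = exp (-(θ * ε)) * (exp (θ * log m) * (exp (-θ * (-ε + log m)) * P)) := by
          rw [← mul_assoc (exp (θ * log m)), ← exp_add, ← mul_assoc, ← exp_add]
          ring_nf
          simp
      _ ≤ _ := by gcongr
  have hsub : {x | ¬(exp (-ε) * m < H x ∧ H x < exp ε * m)} ⊆
      {x | exp ε * m ≤ H x} ∪ {x | H x ≤ exp (-ε) * m} := by
    intro x hx
    by_contra hcon
    simp only [Set.mem_union, Set.mem_ofPred_eq, not_or, not_le] at hcon hx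
    exact hx ⟨hcon.2, hcon.1⟩
  refine (measureReal_mono hsub).trans ((measureReal_union_le _ _).trans ?_)
  rw [exp_add]
  linarith

end MaureyPisier

/-! ### The entropy inequality and shifts of Gaussian means. -/

/-- A probability density bounded by `K` integrates `X` to at most
`(log K + log ∫ exp (θ X)) / θ`. -/
theorem mul_integral_density_mul_le {Ω : Type*} [MeasurableSpace Ω] {μ : Measure Ω}
    {ω X : Ω → ℝ} {K B θ : ℝ} (hK : 0 < K) (hB : 0 < B)
    (hω0 : ∀ x, 0 ≤ ω x) (hωK : ∀ x, ω x ≤ K) (hωI : Integrable ω μ) (hω1 : ∫ x, ω x ∂μ = 1)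
    (hXI : Integrable (fun x => ω x * X x) μ) (hEI : Integrable (fun x => exp (θ * X x)) μ)
    (hE : ∫ x, exp (θ * X x) ∂μ ≤ B) :
    θ * ∫ x, ω x * X x ∂μ ≤ log (K * B) := by
  set a := log (K * B) with ha
  have hKB : 0 < K * B := by positivity
  -- The Gibbs variational inequality in pointwise form: 1 + u ≤ exp u at u = θX - log(KB), weighted
  -- by ω, with ω ≤ K used on the exponential only.
  have hpt : ∀ x, θ * (ω x * X x) ≤ B⁻¹ * exp (θ * X x) + (a - 1) * ω x := by
    intro x
    have h1 := Real.add_one_le_exp (θ * X x - a)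
    rw [exp_sub, ha, exp_log hKB, ← ha] at h1
    have h2 : ω x * (exp (θ * X x) / (K * B)) ≤ B⁻¹ * exp (θ * X x) := by
      calc _ ≤ K * (exp (θ * X x) / (K * B)) := by gcongr; exact hωK x
        _ = _ := by field_simp
    have h3 := mul_le_mul_of_nonneg_left h1 (hω0 x)
    nlinarith
  have h := integral_mono (hXI.const_mul θ) ((hEI.const_mul B⁻¹).add (hωI.const_mul (a - 1))) hpt
  rw [integral_const_mul] at h
  refine h.trans ?_
  simp only [Pi.add_apply]
  rw [integral_add (hEI.const_mul B⁻¹) (hωI.const_mul (a - 1)), integral_const_mul,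
    integral_const_mul, hω1]
  have : B⁻¹ * ∫ x, exp (θ * X x) ∂μ ≤ 1 := by
    rw [inv_mul_le_iff₀ hB, mul_one]; exact hE
  linarith

/-- Translation invariance of Lebesgue measure turns the shift into a quotient of Gaussian
densities: Cameron–Martin in dimension one. -/
theorem integral_gaussianReal_comp_sub {f : ℝ → ℝ} (κ : ℝ) :
    ∫ x, f (x - κ) ∂(gaussianReal 0 1) =
      ∫ x, f x * exp (-κ * x - κ ^ 2 / 2) ∂(gaussianReal 0 1) := by
  rw [integral_gaussianReal_eq_integral_smul one_ne_zero,
    integral_gaussianReal_eq_integral_smul one_ne_zero,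
    ← integral_add_right_eq_self (fun x => gaussianPDFReal 0 1 x • f (x - κ)) κ]
  refine integral_congr_ae (Eventually.of_forall fun x => ?_)
  simp only [gaussianPDFReal, add_sub_cancel_right, smul_eq_mul]
  rw [mul_comm (f x), ← mul_assoc, mul_assoc _ (exp _) (exp _), ← exp_add]
  congr 3
  push_cast
  ring

/-- Shifting a `[0, 1]`-valued function changes its Gaussian mean by a bounded factor only. -/
theorem le_integral_gaussianReal_comp_sub {f : ℝ → ℝ} (hf : Measurable f) (h0 : ∀ x, 0 ≤ f x)
    (h1 : ∀ x, f x ≤ 1) {κ θ : ℝ} (hκ : 0 ≤ κ) (hθ : 0 < θ)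
    (hm : 0 < ∫ x, f x ∂(gaussianReal 0 1)) :
    (∫ x, f x ∂(gaussianReal 0 1)) * exp (-(κ * (log (1 / ∫ x, f x ∂(gaussianReal 0 1)) / θ + θ / 2) +
      κ ^ 2 / 2)) ≤ ∫ x, f (x - κ) ∂(gaussianReal 0 1) := by
  set g := gaussianReal 0 1 with hg
  set m := ∫ x, f x ∂g with hmdef
  have hbd : ∀ x, ‖f x‖ ≤ 1 := fun x => by rw [Real.norm_of_nonneg (h0 x)]; exact h1 x
  have hmulI : ∀ φ : ℝ → ℝ, Integrable φ g → Integrable (fun x => f x * φ x) g := fun φ hφ =>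
    hφ.bdd_mul (c := 1) hf.aestronglyMeasurable (Eventually.of_forall hbd)
  have hfI : Integrable f g := by simpa using hmulI (fun _ => 1) (integrable_const _)
  have hidI : Integrable (fun x : ℝ => x) g := IsGaussian.integrable_id
  have hexpI : ∀ t, Integrable (fun x => exp (t * x)) g := integrable_exp_mul_gaussianReal
  have hfx := hmulI _ hidI
  -- The mean of x under the density f/m. Replacing exp(-κx) by its tangent at a makes the linear
  -- term cancel, and the entropy inequality with K = 1/m bounds a.
  set a := (∫ x, f x * x ∂g) / m with ha
  have hale : a ≤ log (1 / m) / θ + θ / 2 := by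
    have h := mul_integral_density_mul_le (μ := g) (ω := fun x => f x / m) (X := fun x => x)
      (K := 1 / m) (B := exp (θ ^ 2 / 2)) (θ := θ) (by positivity) (exp_pos _)
      (fun x => div_nonneg (h0 x) hm.le) (fun x => div_le_div_of_nonneg_right (h1 x) hm.le)
      (hfI.div_const m) (by rw [integral_div]; exact div_self hm.ne')
      (by simpa only [div_mul_eq_mul_div] using hfx.div_const m) (hexpI θ)
      (integral_exp_mul_gaussianReal θ).le
    rw [log_mul (by positivity) (exp_pos _).ne', log_exp] at h
    simp only [div_mul_eq_mul_div] at h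
    rw [integral_div, ← ha] at h
    rw [div_add_div _ _ hθ.ne' two_ne_zero, le_div_iff₀ (by positivity)]
    nlinarith
  rw [integral_gaussianReal_comp_sub]
  have hpt : ∀ x, exp (-κ * a - κ ^ 2 / 2) * (f x * (1 + κ * a) - κ * (f x * x)) ≤
      f x * exp (-κ * x - κ ^ 2 / 2) := by
    intro x
    have h2 := Real.add_one_le_exp (-κ * (x - a))
    have h3 : exp (-κ * x - κ ^ 2 / 2) = exp (-κ * a - κ ^ 2 / 2) * exp (-κ * (x - a)) := by
      rw [← exp_add]; ring_nf
    rw [h3]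
    calc _ = exp (-κ * a - κ ^ 2 / 2) * (f x * (-κ * (x - a) + 1)) := by ring
      _ ≤ exp (-κ * a - κ ^ 2 / 2) * (f x * exp (-κ * (x - a))) := by
        gcongr
        exact h0 x
      _ = _ := by ring
  have hI2 : Integrable (fun x => f x * exp (-κ * x - κ ^ 2 / 2)) g := by
    refine hmulI _ ?_
    simp only [sub_eq_add_neg, exp_add]
    exact (hexpI (-κ)).mul_const _
  have hI1 : Integrable (fun x => f x * (1 + κ * a) - κ * (f x * x)) g :=
    (hfI.mul_const _).sub (hfx.const_mul κ)
  refine le_trans ?_ (integral_mono (hI1.const_mul _) hI2 hpt)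
  rw [integral_const_mul, integral_sub (hfI.mul_const _) (hfx.const_mul κ), integral_mul_const,
    integral_const_mul, ← hmdef]
  have : ∫ x, f x * x ∂g = a * m := by rw [ha]; field_simp
  rw [this]
  have h4 : m * (1 + κ * a) - κ * (a * m) = m := by ring
  rw [h4, mul_comm]
  gcongr
  nlinarith

/-! ### Smoothed caps and the gradient of their logarithm. -/

section SmoothCap

variable {d : ℕ}

local notation "𝔼" => EuclideanSpace ℝ (Fin d)

/-- The smoothed measure of the part of `A` in the half-space `{z | t ≤ ⟪z, v⟫}`, increased by
`p` times the measure of `A`. -/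
def smoothCap (A : Set (USphere d)) (l t p : ℝ) (v : 𝔼) : ℝ :=
  ∫ z in A, (sigmoid (l * (⟪(z : 𝔼), v⟫ - t)) + p) ∂(unifSphere d)

/-- The mean of the smoothed indicator of `[t, ∞)` under the standard Gaussian measure. -/
def smoothTail (l t : ℝ) : ℝ := ∫ x, sigmoid (l * (x - t)) ∂(gaussianReal 0 1)

theorem integrable_sigmoid_inner [NeZero d] (A : Set (USphere d)) (l t : ℝ) (v : 𝔼) :
    IntegrableOn (fun z : USphere d => sigmoid (l * (⟪(z : 𝔼), v⟫ - t))) A (unifSphere d) := by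
  have := isProbabilityMeasure_unifSphere (d := d) NeZero.one_le
  refine (integrable_const (1 : ℝ)).mono' (by fun_prop) (Eventually.of_forall fun z => ?_)
  rw [Real.norm_of_nonneg (sigmoid_nonneg _)]
  exact sigmoid_le_one _

theorem smoothCap_eq [NeZero d] (A : Set (USphere d)) (l t p : ℝ) (v : 𝔼) :
    smoothCap A l t p v =
      ∫ z in A, sigmoid (l * (⟪(z : 𝔼), v⟫ - t)) ∂(unifSphere d) + (unifSphere d).real A * p := by
  have := isProbabilityMeasure_unifSphere (d := d) NeZero.one_le
  rw [smoothCap, integral_add (integrable_sigmoid_inner A l t v) (integrable_const _)]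
  simp

theorem smoothCap_ge [NeZero d] (A : Set (USphere d)) (l t p : ℝ) (v : 𝔼) :
    p * (unifSphere d).real A ≤ smoothCap A l t p v := by
  rw [smoothCap_eq, mul_comm]
  have := integral_nonneg (μ := (unifSphere d).restrict A)
    (f := fun z : USphere d => sigmoid (l * (⟪(z : 𝔼), v⟫ - t))) (fun z => sigmoid_nonneg _)
  linarith

theorem smoothCap_le [NeZero d] (A : Set (USphere d)) (l t p : ℝ) (v : 𝔼) :
    smoothCap A l t p v ≤ (1 + p) * (unifSphere d).real A := by
  have := isProbabilityMeasure_unifSphere (d := d) NeZero.one_le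
  rw [smoothCap_eq]
  have := integral_mono (integrable_sigmoid_inner A l t v) (integrable_const (1 : ℝ))
    (fun z => sigmoid_le_one _)
  simp only [integral_const, smul_eq_mul, mul_one, measureReal_restrict_apply_univ] at this
  linarith

theorem continuous_sigmoid_smul_innerSL (l t : ℝ) (v : 𝔼) :
    Continuous fun z : USphere d => (l * (sigmoid (l * (⟪(z : 𝔼), v⟫ - t)) *
      (1 - sigmoid (l * (⟪(z : 𝔼), v⟫ - t))))) • innerSL ℝ (z : 𝔼) := by
  have h : Continuous fun z : USphere d => l * (sigmoid (l * (⟪(z : 𝔼), v⟫ - t)) *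
      (1 - sigmoid (l * (⟪(z : 𝔼), v⟫ - t)))) := by fun_prop
  exact h.smul ((innerSL ℝ).continuous.comp continuous_subtype_val)

theorem hasFDerivAt_smoothCap [NeZero d] (A : Set (USphere d)) (l t p : ℝ) (v : 𝔼) :
    HasFDerivAt (smoothCap A l t p)
      (∫ z in A, (l * (sigmoid (l * (⟪(z : 𝔼), v⟫ - t)) *
        (1 - sigmoid (l * (⟪(z : 𝔼), v⟫ - t))))) • innerSL ℝ (z : 𝔼) ∂(unifSphere d)) v := by
  have := isProbabilityMeasure_unifSphere (d := d) NeZero.one_le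
  refine hasFDerivAt_integral_of_dominated_of_fderiv_le (bound := fun _ => |l|)
    (F' := fun v (z : USphere d) => (l * (sigmoid (l * (⟪(z : 𝔼), v⟫ - t)) *
        (1 - sigmoid (l * (⟪(z : 𝔼), v⟫ - t))))) • innerSL ℝ (z : 𝔼)) univ_mem ?_ ?_ ?_ ?_ ?_ ?_
  · exact Eventually.of_forall fun x => by fun_prop
  · exact (integrable_sigmoid_inner A l t v).add (integrable_const _)
  · exact (continuous_sigmoid_smul_innerSL l t v).aestronglyMeasurable
  · refine Eventually.of_forall fun z x _ => ?_
    have h1 := sigmoid_nonneg (l * (⟪(z : 𝔼), x⟫ - t))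
    have h2 := sigmoid_le_one (l * (⟪(z : 𝔼), x⟫ - t))
    have h3 : 0 ≤ sigmoid (l * (⟪(z : 𝔼), x⟫ - t)) * (1 - sigmoid (l * (⟪(z : 𝔼), x⟫ - t))) :=
      mul_nonneg h1 (by linarith)
    rw [norm_smul, innerSL_apply_norm, norm_eq_of_mem_sphere, mul_one, norm_mul,
      Real.norm_of_nonneg h3, Real.norm_eq_abs]
    refine mul_le_of_le_one_right (abs_nonneg _) ?_
    nlinarith
  · exact integrable_const _
  · refine Eventually.of_forall fun z x _ => ?_
    have h1 : HasFDerivAt (fun x : 𝔼 => l * (⟪(z : 𝔼), x⟫ - t)) (l • innerSL ℝ (z : 𝔼)) x :=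
      ((innerSL ℝ (z : 𝔼)).hasFDerivAt.sub_const t).const_mul l
    have h2 := ((hasDerivAt_sigmoid (l * (⟪(z : 𝔼), x⟫ - t))).comp_hasFDerivAt x h1).add_const p
    rw [smul_smul, mul_comm _ l] at h2
    exact h2

/-- Since s(1 - s) ≤ s + p for a sigmoid value s, the derivative of the logarithm in a unit
direction u is at most l times the mean of |⟨z, u⟩| under the density ω = (s + p)/H on A. The
summand p keeps H ≥ p σ(A), hence ω ≤ 2/(pσ(A)), and the entropy inequality applies with the
subgaussian bound on the sphere. -/
theorem norm_fderiv_log_smoothCap_le [NeZero d] {A : Set (USphere d)}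
    (hA : 0 < (unifSphere d).real A) {l t p : ℝ} (hl : 0 ≤ l) (hp : 0 < p) (hp1 : p ≤ 1) (v : 𝔼) :
    ‖fderiv ℝ (fun v => log (smoothCap A l t p v)) v‖ ≤
      9 * l * √(log (8 / (p * (unifSphere d).real A)) / d) := by
  have := isProbabilityMeasure_unifSphere (d := d) NeZero.one_le
  have hd0 : (0 : ℝ) < d := by exact_mod_cast Nat.pos_of_ne_zero (NeZero.ne d)
  set a := (unifSphere d).real A with ha
  have ha1 : a ≤ 1 := measureReal_le_one
  set S := log (8 / (p * a)) with hS
  have hS0 : 0 < S := by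
    refine log_pos ?_
    rw [lt_div_iff₀ (by positivity)]
    nlinarith
  have hH0 : 0 < smoothCap A l t p v := lt_of_lt_of_le (by positivity) (smoothCap_ge A l t p v)
  set H := smoothCap A l t p v with hH
  have hfd := (hasFDerivAt_smoothCap A l t p v).log hH0.ne'
  rw [hfd.fderiv]
  refine ContinuousLinearMap.opNorm_le_bound _ (by positivity) fun w => ?_
  have hFI : IntegrableOn (fun z : USphere d => (l * (sigmoid (l * (⟪(z : 𝔼), v⟫ - t)) *
        (1 - sigmoid (l * (⟪(z : 𝔼), v⟫ - t))))) • innerSL ℝ (z : 𝔼)) A (unifSphere d) := by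
    have hc := continuous_sigmoid_smul_innerSL l t v
    exact (hc.integrable_of_hasCompactSupport (HasCompactSupport.of_compactSpace _)).integrableOn
  set ω : USphere d → ℝ := fun z => (sigmoid (l * (⟪(z : 𝔼), v⟫ - t)) + p) / H with hω
  have hωc : Continuous ω := by simp only [hω]; fun_prop
  have hω0 : ∀ z, 0 ≤ ω z := fun z =>
    div_nonneg (add_nonneg (sigmoid_nonneg _) hp.le) hH0.le
  set X : USphere d → ℝ := fun z => |⟪(z : 𝔼), (dir w : 𝔼)⟫| with hX
  have hXc : Continuous X := by simp only [hX]; fun_prop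
  have hcI : ∀ φ : USphere d → ℝ, Continuous φ → IntegrableOn φ A (unifSphere d) := fun φ hφ =>
    (hφ.integrable_of_hasCompactSupport (HasCompactSupport.of_compactSpace _)).integrableOn
  have hmain : ∫ z in A, ω z * X z ∂(unifSphere d) ≤ 9 * √(S / d) := by
    -- This θ makes the moment term 8θ²/d equal to 8S, next to S = log(8/(pσ(A))) from the density;
    -- together they are the 9S below.
    set θ := √(d * S) with hθ
    have hθ0 : 0 < θ := Real.sqrt_pos.2 (by positivity)
    have hθ2 : θ ^ 2 = d * S := Real.sq_sqrt (by positivity)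
    have h := mul_integral_density_mul_le (μ := (unifSphere d).restrict A) (ω := ω) (X := X)
      (K := 2 / (p * a)) (B := 4 * exp (8 * θ ^ 2 / d)) (θ := θ) (by positivity) (by positivity)
      hω0 (fun z => by
        simp only [hω]
        have h1 := sigmoid_le_one (l * (⟪(z : 𝔼), v⟫ - t))
        refine div_le_div₀ (by norm_num) (by linarith) (by positivity) (smoothCap_ge A l t p v))
      (hcI _ hωc)
      (by
        simp only [hω]
        rw [integral_div, hH]
        exact div_self hH0.ne')
      (hcI _ (by fun_prop)) (hcI _ (by fun_prop))
      (by
        refine le_trans ?_ (integral_exp_abs_inner_unifSphere_le NeZero.one_le (dir w) θ)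
        refine setIntegral_le_integral ?_ (Eventually.of_forall fun z => (exp_pos _).le)
        exact (Continuous.integrable_of_hasCompactSupport (by fun_prop)
          (HasCompactSupport.of_compactSpace _)))
    have hlog : log (2 / (p * a) * (4 * exp (8 * θ ^ 2 / d))) = 9 * S := by
      rw [← mul_assoc, log_mul (by positivity) (exp_pos _).ne', log_exp, hθ2, div_mul_eq_mul_div,
        hS]
      norm_num
      field_simp
      ring
    rw [hlog] at h
    have hsq : θ * √(S / d) = S := by
      rw [hθ, ← Real.sqrt_mul (by positivity)]
      rw [show (d : ℝ) * S * (S / d) = S ^ 2 by field_simp]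
      exact Real.sqrt_sq hS0.le
    refine le_of_mul_le_mul_left (h.trans ?_) hθ0
    rw [mul_left_comm, hsq]
  rw [smul_apply, smul_eq_mul, norm_mul, Real.norm_of_nonneg (by positivity),
    ContinuousLinearMap.integral_apply hFI]
  have hbd : ‖∫ z in A, ((l * (sigmoid (l * (⟪(z : 𝔼), v⟫ - t)) *
        (1 - sigmoid (l * (⟪(z : 𝔼), v⟫ - t))))) • innerSL ℝ (z : 𝔼)) w ∂(unifSphere d)‖ ≤
      ∫ z in A, (H * l * ‖w‖) * (ω z * X z) ∂(unifSphere d) := by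
    refine norm_integral_le_of_norm_le (hcI _ (by fun_prop)) (Eventually.of_forall fun z => ?_)
    have h1 := sigmoid_nonneg (l * (⟪(z : 𝔼), v⟫ - t))
    have h2 := sigmoid_le_one (l * (⟪(z : 𝔼), v⟫ - t))
    have hw : |⟪(z : 𝔼), w⟫| = ‖w‖ * X z := by
      conv_lhs => rw [← norm_smul_dir w]
      rw [inner_smul_right, abs_mul, abs_norm]
    rw [smul_apply, smul_eq_mul, innerSL_apply_apply, norm_mul, Real.norm_eq_abs ⟪_, _⟫, hw,
      Real.norm_of_nonneg (mul_nonneg hl (mul_nonneg h1 (by linarith)))]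
    have hX0 : 0 ≤ X z := abs_nonneg _
    have hHω : H * ω z = sigmoid (l * (⟪(z : 𝔼), v⟫ - t)) + p := by
      simp only [hω]; field_simp
    calc _ ≤ l * (H * ω z) * (‖w‖ * X z) := by
          rw [hHω]
          gcongr
          nlinarith
      _ = _ := by ring
  rw [integral_const_mul] at hbd
  calc _ ≤ H⁻¹ * (H * l * ‖w‖ * (9 * √(S / d))) := by gcongr; exact hbd.trans (by gcongr)
    _ = _ := by field_simp

theorem integral_smoothCap [NeZero d] (A : Set (USphere d)) (l t p : ℝ) :
    ∫ v, smoothCap A l t p v ∂(gauss d) = (unifSphere d).real A * (smoothTail l t + p) := by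
  have := isProbabilityMeasure_unifSphere (d := d) NeZero.one_le
  unfold smoothCap
  rw [integral_integral_swap]
  · have : ∀ z : USphere d, ∫ v, (sigmoid (l * (⟪(z : 𝔼), v⟫ - t)) + p) ∂(gauss d) =
        smoothTail l t + p := by
      intro z
      have hs : Continuous fun x => sigmoid (l * (x - t)) + p := by fun_prop
      rw [integral_comp_inner_gauss z (fun x => sigmoid (l * (x - t)) + p) hs.measurable,
        integral_add, smoothTail]
      · simp
      · refine (integrable_const (1 : ℝ)).mono' (by fun_prop) (Eventually.of_forall fun x => ?_)
        rw [Real.norm_of_nonneg (sigmoid_nonneg _)]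
        exact sigmoid_le_one _
      · exact integrable_const _
    simp_rw [this]
    simp
  · refine (integrable_const (1 + |p|)).mono' ?_ (Eventually.of_forall fun q => ?_)
    · have : Continuous fun q : 𝔼 × USphere d => sigmoid (l * (⟪(q.2 : 𝔼), q.1⟫ - t)) + p := by
        fun_prop
      exact this.aestronglyMeasurable
    · refine (norm_add_le _ _).trans ?_
      rw [Real.norm_of_nonneg (sigmoid_nonneg _), Real.norm_eq_abs p]
      gcongr
      exact sigmoid_le_one _

/-- Concentration of the smoothed measure of a random cap of `A`. -/
theorem smoothCap_deviation_le [NeZero d] {A : Set (USphere d)}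
    (hA : 0 < (unifSphere d).real A) {l t p : ℝ} (hl : 0 ≤ l) (hp : 0 < p) (hp1 : p ≤ 1)
    {θ : ℝ} (hθ : 1 ≤ θ) (ε : ℝ) :
    (gauss d).real {v | ¬(exp (-ε) * ((unifSphere d).real A * (smoothTail l t + p)) <
        smoothCap A l t p v ∧
      smoothCap A l t p v < exp ε * ((unifSphere d).real A * (smoothTail l t + p)))} ≤
      2 * exp (-(θ * ε) + π ^ 2 *
        (θ * (9 * l * √(log (8 / (p * (unifSphere d).real A)) / d))) ^ 2 / 8) := by
  have hpos : ∀ v : 𝔼, 0 < smoothCap A l t p v := fun v =>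
    lt_of_lt_of_le (by positivity) (smoothCap_ge A l t p v)
  have hdiff : Differentiable ℝ (smoothCap A l t p) := fun v =>
    (hasFDerivAt_smoothCap A l t p v).differentiableAt
  have h := gauss_mul_deviation_le hpos (fun v => (hdiff v).log (hpos v).ne')
    ((integrable_const ((1 + p) * (unifSphere d).real A)).mono'
      hdiff.continuous.aestronglyMeasurable (Eventually.of_forall fun v => by
        rw [Real.norm_of_nonneg (hpos v).le]
        exact smoothCap_le A l t p v))
    (norm_fderiv_log_smoothCap_le hA hl hp hp1) hθ ε
  rwa [integral_smoothCap] at h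

end SmoothCap

/-! ### Comparison of caps with smoothed caps. -/

theorem one_le_mul_sigmoid {l κ T x : ℝ} (hl : 0 ≤ l) (hx : T - κ ≤ x) :
    1 ≤ (1 + exp (-(l * κ))) * sigmoid (l * (x - (T - 2 * κ))) := by
  have h1 : l * κ ≤ l * (x - (T - 2 * κ)) := by gcongr; linarith
  have h2 := sigmoid_le h1
  calc (1 : ℝ) = (1 + exp (-(l * κ))) * sigmoid (l * κ) := by
        rw [sigmoid_def, mul_inv_cancel₀ (by positivity)]
    _ ≤ _ := by gcongr

theorem sigmoid_sub_le {a y : ℝ} (hy : y ≤ 0) : sigmoid (y - a) ≤ 2 * exp (-a) * sigmoid y := by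
  rw [sigmoid_def, sigmoid_def, ← div_eq_mul_inv, inv_eq_one_div,
    div_le_div_iff₀ (by positivity) (by positivity)]
  have h1 : 1 ≤ exp (-y) := one_le_exp (by linarith)
  have h2 : exp (-a) * exp (-(y - a)) = exp (-y) := by rw [← exp_add]; ring_nf
  nlinarith [exp_pos (-a), exp_pos (-y)]

/-- Left of its centre a sigmoid decays exponentially. What the smoothed indicator leaks outside the
half-space is thus charged to another sigmoid with a small factor. An additive error exp(-lκ) could
exceed a small density p; this relative one does not. -/
theorem sigmoid_sub_le_of_le {l κ T x : ℝ} (hl : 0 ≤ l) (hx : x ≤ T + κ) :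
    sigmoid (l * (x - (T + 2 * κ))) ≤
      2 * exp (-(l * κ)) * sigmoid (l * (x - (T + κ))) := by
  have h := sigmoid_sub_le (a := l * κ) (y := l * (x - (T + κ)))
    (mul_nonpos_of_nonneg_of_nonpos hl (by linarith))
  convert h using 2
  ring

theorem integrable_sigmoid_gaussianReal (l t : ℝ) :
    Integrable (fun x => sigmoid (l * (x - t))) (gaussianReal 0 1) := by
  refine (integrable_const (1 : ℝ)).mono' (by fun_prop) (Eventually.of_forall fun x => ?_)
  rw [Real.norm_of_nonneg (sigmoid_nonneg _)]
  exact sigmoid_le_one _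

theorem smoothTail_antitone {l : ℝ} (hl : 0 ≤ l) : Antitone (smoothTail l) := by
  intro s t hst
  refine integral_mono (integrable_sigmoid_gaussianReal l t) (integrable_sigmoid_gaussianReal l s)
    fun x => sigmoid_le ?_
  gcongr

theorem smoothTail_shift {l t κ θ : ℝ} (hκ : 0 ≤ κ) (hθ : 0 < θ) (hm : 0 < smoothTail l t) :
    smoothTail l t * exp (-(κ * (log (1 / smoothTail l t) / θ + θ / 2) + κ ^ 2 / 2)) ≤
      smoothTail l (t + κ) := by
  have hc : Continuous fun x => sigmoid (l * (x - t)) := by fun_prop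
  have h := le_integral_gaussianReal_comp_sub hc.measurable (fun x => sigmoid_nonneg _)
    (fun x => sigmoid_le_one _) hκ hθ hm
  refine h.trans_eq (integral_congr_ae (Eventually.of_forall fun x => ?_))
  simp only
  ring_nf

section

variable {d : ℕ}

local notation "𝔼" => EuclideanSpace ℝ (Fin d)

/-- The cap `{z | τ ≤ ⟪z, w⟫}` of the sphere. -/
def cap (τ : ℝ) (w : USphere d) : Set (USphere d) :=
  {z | τ ≤ ⟪(z : EuclideanSpace ℝ (Fin d)), (w : EuclideanSpace ℝ (Fin d))⟫}

theorem measurableSet_cap (τ : ℝ) (w : USphere d) : MeasurableSet (cap τ w) :=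
  measurableSet_le measurable_const (by fun_prop)

theorem inner_eq_norm_mul_inner_dir [NeZero d] (z : USphere d) (v : 𝔼) :
    ⟪(z : 𝔼), v⟫ = ‖v‖ * ⟪(z : 𝔼), (dir v : 𝔼)⟫ := by
  conv_lhs => rw [← norm_smul_dir v]
  rw [inner_smul_right]

/-- The cap condition at direction `dir v` reads τ‖v‖ ≤ ⟨z, v⟩ for a nonzero vector v. Concentration
of the norm fixes the level at τ√d up to κ, which the smoothing absorbs. -/
theorem abs_mul_norm_sub_le {τ η κ : ℝ} (hκ : η * |τ * √d| ≤ κ) {v : 𝔼}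
    (hv : |‖v‖ - √d| ≤ η * √d) : |τ * ‖v‖ - τ * √d| ≤ κ := by
  rw [← mul_sub, abs_mul]
  refine le_trans ?_ hκ
  rw [abs_mul, abs_of_nonneg (Real.sqrt_nonneg _)]
  calc |τ| * |‖v‖ - √d| ≤ |τ| * (η * √d) := by gcongr
    _ = _ := by ring

theorem indicator_cap_le [NeZero d] {τ η κ l : ℝ} (hl : 0 ≤ l) (hκ : η * |τ * √d| ≤ κ) {v : 𝔼}
    (hv : |‖v‖ - √d| ≤ η * √d) (z : USphere d) :
    (cap τ (dir v)).indicator 1 z ≤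
      (1 + exp (-(l * κ))) * sigmoid (l * (⟪(z : 𝔼), v⟫ - (τ * √d - 2 * κ))) := by
  by_cases hz : z ∈ cap τ (dir v)
  · rw [Set.indicator_of_mem hz]
    refine one_le_mul_sigmoid hl ?_
    have h1 := (abs_le.1 (abs_mul_norm_sub_le hκ hv)).1
    have hz' : τ ≤ ⟪(z : 𝔼), (dir v : 𝔼)⟫ := hz
    rw [inner_eq_norm_mul_inner_dir]
    nlinarith [mul_le_mul_of_nonneg_left hz' (norm_nonneg v)]
  · rw [Set.indicator_of_notMem hz]
    have := sigmoid_nonneg (l * (⟪(z : 𝔼), v⟫ - (τ * √d - 2 * κ)))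
    positivity

theorem le_indicator_cap [NeZero d] {τ η κ l : ℝ} (hl : 0 ≤ l) (hκ : η * |τ * √d| ≤ κ) {v : 𝔼}
    (hv : |‖v‖ - √d| ≤ η * √d) (z : USphere d) :
    sigmoid (l * (⟪(z : 𝔼), v⟫ - (τ * √d + 2 * κ))) -
      2 * exp (-(l * κ)) * sigmoid (l * (⟪(z : 𝔼), v⟫ - (τ * √d + κ))) ≤
      (cap τ (dir v)).indicator 1 z := by
  by_cases hz : z ∈ cap τ (dir v)
  · rw [Set.indicator_of_mem hz, Pi.one_apply]
    have h1 := sigmoid_le_one (l * (⟪(z : 𝔼), v⟫ - (τ * √d + 2 * κ)))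
    have h2 := sigmoid_nonneg (l * (⟪(z : 𝔼), v⟫ - (τ * √d + κ)))
    have h3 := mul_nonneg (exp_pos (-(l * κ))).le h2
    linarith
  · rw [Set.indicator_of_notMem hz, sub_nonpos]
    refine sigmoid_sub_le_of_le hl ?_
    have h1 := (abs_le.1 (abs_mul_norm_sub_le hκ hv)).2
    have hz' : ⟪(z : 𝔼), (dir v : 𝔼)⟫ ≤ τ := le_of_not_ge hz
    rw [inner_eq_norm_mul_inner_dir]
    nlinarith [mul_le_mul_of_nonneg_left hz' (norm_nonneg v)]

theorem gauss_real_dir_cap [NeZero d] (τ : ℝ) (z : USphere d) :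
    (gauss d).real {v | z ∈ cap τ (dir v)} = capProb d τ := by
  rw [← unifSphere_real_cap τ z, ← map_dir_gauss, map_measureReal_apply measurable_dir
    (measurableSet_le (f := fun _ => τ)
      (g := fun w : USphere d => ⟪(z : 𝔼), (w : 𝔼)⟫) measurable_const (by fun_prop))]
  rfl

theorem measurableSet_dir_cap [NeZero d] (τ : ℝ) (z : USphere d) :
    MeasurableSet {v : 𝔼 | z ∈ cap τ (dir v)} := by
  have : MeasurableSet {w : USphere d | τ ≤ ⟪(z : 𝔼), (w : 𝔼)⟫} :=
    measurableSet_le measurable_const (by fun_prop)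
  exact measurable_dir this

theorem measurableSet_norm_deviation (η : ℝ) :
    MeasurableSet {v : 𝔼 | η * √d < |‖v‖ - √d|} :=
  measurableSet_lt measurable_const (by fun_prop)

/-- The cap probability compared with smoothed Gaussian tails. -/
theorem capProb_le_smoothTail [NeZero d] {τ η κ l : ℝ} (hl : 0 ≤ l) (hκ : η * |τ * √d| ≤ κ) :
    capProb d τ ≤ (1 + exp (-(l * κ))) * smoothTail l (τ * √d - 2 * κ) +
      (gauss d).real {v | η * √d < |‖v‖ - √d|} := by
  set z := poleVec d
  have hN := measurableSet_norm_deviation (d := d) η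
  set N := {v : 𝔼 | η * √d < |‖v‖ - √d|}
  have hs : Continuous fun x => sigmoid (l * (x - (τ * √d - 2 * κ))) := by fun_prop
  have hsI : Integrable (fun v : 𝔼 => sigmoid (l * (⟪(z : 𝔼), v⟫ - (τ * √d - 2 * κ)))) (gauss d) := by
    have := integrable_sigmoid_gaussianReal l (τ * √d - 2 * κ)
    rw [← map_inner_gauss z] at this
    exact this.comp_measurable (by fun_prop)
  have hNI : Integrable (N.indicator (1 : 𝔼 → ℝ)) (gauss d) :=
    (integrable_const 1).indicator hN
  rw [← gauss_real_dir_cap τ z, ← integral_indicator_one (measurableSet_dir_cap τ z),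
    ← integral_indicator_one hN, smoothTail, ← integral_comp_inner_gauss z _ hs.measurable,
    ← integral_const_mul, ← integral_add (hsI.const_mul _) hNI]
  refine integral_mono ((integrable_const 1).indicator (measurableSet_dir_cap τ z))
    ((hsI.const_mul _).add hNI) fun v => ?_
  have heq : {v : 𝔼 | z ∈ cap τ (dir v)}.indicator (1 : 𝔼 → ℝ) v =
    (cap τ (dir v)).indicator (1 : USphere d → ℝ) z := rfl
  by_cases hv : v ∈ N
  · have h0 := sigmoid_nonneg (l * (⟪(z : 𝔼), v⟫ - (τ * √d - 2 * κ)))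
    have h1 : {v : 𝔼 | z ∈ cap τ (dir v)}.indicator (1 : 𝔼 → ℝ) v ≤ 1 :=
      Set.indicator_le_self' (fun _ _ => zero_le_one) v
    simp only [Set.indicator_of_mem hv, Pi.one_apply]
    have : 0 ≤ (1 + exp (-(l * κ))) * sigmoid (l * (⟪(z : 𝔼), v⟫ - (τ * √d - 2 * κ))) := by
      positivity
    linarith
  · rw [heq]
    simp only [Set.indicator_of_notMem hv, add_zero]
    exact indicator_cap_le hl hκ (not_lt.1 hv) z

theorem smoothTail_le_capProb [NeZero d] {τ η κ l : ℝ} (hl : 0 ≤ l) (hκ : η * |τ * √d| ≤ κ) :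
    smoothTail l (τ * √d + 2 * κ) - 2 * exp (-(l * κ)) * smoothTail l (τ * √d + κ) -
      (gauss d).real {v | η * √d < |‖v‖ - √d|} ≤ capProb d τ := by
  set z := poleVec d
  have hN := measurableSet_norm_deviation (d := d) η
  set N := {v : 𝔼 | η * √d < |‖v‖ - √d|}
  have hs : ∀ t, Measurable fun x => sigmoid (l * (x - t)) := fun t =>
    Continuous.measurable (by fun_prop)
  have hsI : ∀ t, Integrable (fun v : 𝔼 => sigmoid (l * (⟪(z : 𝔼), v⟫ - t))) (gauss d) := by
    intro t
    have := integrable_sigmoid_gaussianReal l t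
    rw [← map_inner_gauss z] at this
    exact this.comp_measurable (by fun_prop)
  have hNI : Integrable (N.indicator (1 : 𝔼 → ℝ)) (gauss d) :=
    (integrable_const 1).indicator hN
  have hdI : Integrable (fun v : 𝔼 => sigmoid (l * (⟪(z : 𝔼), v⟫ - (τ * √d + 2 * κ))) -
      2 * exp (-(l * κ)) * sigmoid (l * (⟪(z : 𝔼), v⟫ - (τ * √d + κ)))) (gauss d) :=
    (hsI _).sub ((hsI _).const_mul _)
  rw [← gauss_real_dir_cap τ z, ← integral_indicator_one (measurableSet_dir_cap τ z),
    ← integral_indicator_one hN, smoothTail, smoothTail, ← integral_comp_inner_gauss z _ (hs _),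
    ← integral_comp_inner_gauss z _ (hs _), ← integral_const_mul,
    ← integral_sub (hsI _) ((hsI _).const_mul _), ← integral_sub hdI hNI]
  refine integral_mono (hdI.sub hNI)
    ((integrable_const 1).indicator (measurableSet_dir_cap τ z)) fun v => ?_
  have heq : {v : 𝔼 | z ∈ cap τ (dir v)}.indicator (1 : 𝔼 → ℝ) v =
    (cap τ (dir v)).indicator (1 : USphere d → ℝ) z := rfl
  by_cases hv : v ∈ N
  · have h0 := sigmoid_nonneg (l * (⟪(z : 𝔼), v⟫ - (τ * √d + κ)))
    have h2 := sigmoid_le_one (l * (⟪(z : 𝔼), v⟫ - (τ * √d + 2 * κ)))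
    have h1 : 0 ≤ {v : 𝔼 | z ∈ cap τ (dir v)}.indicator (1 : 𝔼 → ℝ) v :=
      Set.indicator_nonneg (fun _ _ => zero_le_one) v
    simp only [Set.indicator_of_mem hv, Pi.one_apply]
    have : 0 ≤ 2 * exp (-(l * κ)) * sigmoid (l * (⟪(z : 𝔼), v⟫ - (τ * √d + κ))) := by
      positivity
    linarith
  · rw [heq]
    simp only [Set.indicator_of_notMem hv, sub_zero]
    exact le_indicator_cap hl hκ (not_lt.1 hv) z

theorem real_inter_cap_le [NeZero d] {A : Set (USphere d)} {τ η κ l : ℝ}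
    (hl : 0 ≤ l) (hκ : η * |τ * √d| ≤ κ) {v : 𝔼} (hv : |‖v‖ - √d| ≤ η * √d) (p : ℝ) :
    (unifSphere d).real (A ∩ cap τ (dir v)) ≤ (1 + exp (-(l * κ))) *
      (smoothCap A l (τ * √d - 2 * κ) p v - (unifSphere d).real A * p) := by
  have := isProbabilityMeasure_unifSphere (d := d) NeZero.one_le
  rw [smoothCap_eq, add_sub_cancel_right, Set.inter_comm,
    ← measureReal_restrict_apply (measurableSet_cap τ (dir v)),
    ← integral_indicator_one (measurableSet_cap τ (dir v)), ← integral_const_mul]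
  exact integral_mono ((integrable_const 1).indicator (measurableSet_cap τ (dir v)))
    ((integrable_sigmoid_inner A l _ v).const_mul _) fun z => indicator_cap_le hl hκ hv z

theorem le_real_inter_cap [NeZero d] {A : Set (USphere d)} {τ η κ l : ℝ}
    (hl : 0 ≤ l) (hκ : η * |τ * √d| ≤ κ) {v : 𝔼} (hv : |‖v‖ - √d| ≤ η * √d) (p : ℝ) :
    (smoothCap A l (τ * √d + 2 * κ) p v - (unifSphere d).real A * p) -
      2 * exp (-(l * κ)) * (smoothCap A l (τ * √d + κ) p v - (unifSphere d).real A * p) ≤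
    (unifSphere d).real (A ∩ cap τ (dir v)) := by
  have := isProbabilityMeasure_unifSphere (d := d) NeZero.one_le
  rw [smoothCap_eq, smoothCap_eq, add_sub_cancel_right, add_sub_cancel_right, Set.inter_comm,
    ← measureReal_restrict_apply (measurableSet_cap τ (dir v)),
    ← integral_indicator_one (measurableSet_cap τ (dir v)), ← integral_const_mul,
    ← integral_sub (integrable_sigmoid_inner A l _ v)
      ((integrable_sigmoid_inner A l _ v).const_mul _)]
  exact integral_mono ((integrable_sigmoid_inner A l _ v).sub
    ((integrable_sigmoid_inner A l _ v).const_mul _))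
    ((integrable_const 1).indicator (measurableSet_cap τ (dir v)))
    fun z => le_indicator_cap hl hκ hv z

/-- The smoothed Gaussian tails near the threshold of density `p` are all close to `p`. -/
theorem smoothTail_bounds [NeZero d] {τ η κ l ε b θ : ℝ} (hl : 0 ≤ l) (hκ0 : 0 ≤ κ)
    (hκ : η * |τ * √d| ≤ κ) (hε0 : 0 < ε) (hε : ε ≤ 1 / 10)
    (hp : 0 < capProb d τ) (hβ : exp (-(l * κ)) ≤ ε)
    (hζ : (gauss d).real {v | η * √d < |‖v‖ - √d|} ≤ ε * capProb d τ) (hθ : 0 < θ)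
    (hb : log (2 / capProb d τ) / θ + θ / 2 ≤ b) (hshift : 4 * κ * b + 8 * κ ^ 2 ≤ ε) :
    smoothTail l (τ * √d - 2 * κ) ≤ (1 + 6 * ε) * capProb d τ ∧
      (1 - 3 * ε) * capProb d τ ≤ smoothTail l (τ * √d + 2 * κ) := by
  have h1 := capProb_le_smoothTail (d := d) hl hκ
  have h2 := smoothTail_le_capProb (d := d) hl hκ
  set p := capProb d τ
  set β := exp (-(l * κ)) with hβdef
  have hβ0 : 0 < β := exp_pos _
  set ζ := (gauss d).real {v : 𝔼 | η * √d < |‖v‖ - √d|}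
  set M₀ := smoothTail l (τ * √d - 2 * κ) with hM₀
  set M₁ := smoothTail l (τ * √d + κ) with hM₁
  set M₂ := smoothTail l (τ * √d + 2 * κ) with hM₂
  have hM₁₀ : M₁ ≤ M₀ := smoothTail_antitone hl (by linarith)
  -- A crude lower bound comes first, because the loss in the shift estimate involves log(1/M₀).
  have hlow : (1 - 2 * ε) * p ≤ M₀ := by
    have h3 : (1 - ε) * p ≤ (1 + ε) * M₀ := by
      have : 0 ≤ M₀ := integral_nonneg fun x => sigmoid_nonneg _
      nlinarith
    have h4 : (1 + ε) * ((1 - 2 * ε) * p) ≤ (1 - ε) * p := by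
      have : (1 + ε) * (1 - 2 * ε) ≤ 1 - ε := by nlinarith
      nlinarith
    exact le_of_mul_le_mul_left (h4.trans h3) (by linarith)
  have hM₀pos : 0 < M₀ := by nlinarith
  -- A single shift by 4κ takes the largest tail M₀ to the smallest M₂ at the cost of a factor 1 -
  -- ε. As p lies between them up to small errors, both are close to p.
  have hsh := smoothTail_shift (l := l) (t := τ * √d - 2 * κ) (κ := 4 * κ) (θ := θ)
    (by linarith) hθ hM₀pos
  rw [show τ * √d - 2 * κ + 4 * κ = τ * √d + 2 * κ by ring, ← hM₀, ← hM₂] at hsh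
  have hlog : log (1 / M₀) ≤ log (2 / p) := by
    refine log_le_log (by positivity) ?_
    rw [div_le_div_iff₀ hM₀pos hp]
    nlinarith
  have hex : 1 - ε ≤ exp (-(4 * κ * (log (1 / M₀) / θ + θ / 2) + (4 * κ) ^ 2 / 2)) := by
    have h4 : log (1 / M₀) / θ + θ / 2 ≤ b := le_trans (by gcongr) hb
    have h5 : 4 * κ * (log (1 / M₀) / θ + θ / 2) ≤ 4 * κ * b := by gcongr
    have h6 := Real.add_one_le_exp (-(4 * κ * (log (1 / M₀) / θ + θ / 2) + (4 * κ) ^ 2 / 2))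
    nlinarith
  have hM₂₀ : (1 - ε) * M₀ ≤ M₂ := by
    refine le_trans ?_ hsh
    rw [mul_comm]
    gcongr
  have hup : M₀ ≤ (1 + 6 * ε) * p := by
    have h7 : β * M₁ ≤ ε * M₀ := mul_le_mul hβ hM₁₀ (integral_nonneg fun x => sigmoid_nonneg _)
      hε0.le
    have h8 : (1 - 3 * ε) * M₀ ≤ (1 + ε) * p := by nlinarith
    have h9 : (1 + ε) * p ≤ (1 - 3 * ε) * ((1 + 6 * ε) * p) := by
      have : 1 + ε ≤ (1 - 3 * ε) * (1 + 6 * ε) := by nlinarith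
      nlinarith
    exact le_of_mul_le_mul_left (h8.trans h9) (by linarith)
  refine ⟨hup, ?_⟩
  nlinarith

/-- The smoothed caps concentrate around a(M + p), about 2pa, so removing the artificial pa roughly
doubles the relative error. The upper bound 1 + 11.2ε is 10ε from first-order terms and 12ε² ≤ 1.2ε;
the leakage weighted by β fits into 15ε. -/
theorem cap_bounds_of_smooth_bounds {p a ε β M₀ M₁ M₂ H₀ H₁ H₂ : ℝ} (hε0 : 0 < ε)
    (hε : ε ≤ 1 / 10) (hp : 0 < p) (ha : 0 < a) (hβ0 : 0 < β) (hβ : β ≤ ε)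
    (hM₀ : M₀ ≤ (1 + 6 * ε) * p) (hM₁ : M₁ ≤ (1 + 6 * ε) * p) (hM₂ : (1 - 3 * ε) * p ≤ M₂)
    (h₀ : H₀ < exp ε * (a * (M₀ + p))) (h₁ : H₁ < exp ε * (a * (M₁ + p)))
    (h₂ : exp (-ε) * (a * (M₂ + p)) < H₂) :
    (1 - 15 * ε) * p * a ≤ (H₂ - a * p) - 2 * β * (H₁ - a * p) ∧
      (1 + β) * (H₀ - a * p) ≤ (1 + 15 * ε) * p * a := by
  have hen : 1 - ε ≤ exp (-ε) := by linarith [Real.add_one_le_exp (-ε)]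
  have hep : exp ε ≤ 1 + 2 * ε := by
    have h3 : exp ε * exp (-ε) = 1 := by rw [← exp_add]; simp
    have h4 : exp ε * (1 - ε) ≤ 1 :=
      (mul_le_mul_of_nonneg_left hen (exp_pos ε).le).trans h3.le
    have h5 : exp ε * (1 - ε) ≤ (1 + 2 * ε) * (1 - ε) := h4.trans (by nlinarith)
    exact le_of_mul_le_mul_right h5 (by linarith)
  have hpa : 0 < p * a := by positivity
  have hsq : ε ^ 2 ≤ ε / 10 := by nlinarith
  have hsq' : (p * a) * ε ^ 2 ≤ (p * a) * (ε / 10) := mul_le_mul_of_nonneg_left hsq hpa.le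
  have hupper : ∀ M H : ℝ, M ≤ (1 + 6 * ε) * p → H < exp ε * (a * (M + p)) →
      H - a * p ≤ (1 + 11.2 * ε) * (p * a) := by
    intro M H hM hH
    have h3 : exp ε * (a * (M + p)) ≤ exp ε * (a * ((1 + 6 * ε) * p + p)) := by gcongr
    have h4 : exp ε * (a * ((1 + 6 * ε) * p + p)) ≤ (1 + 2 * ε) * (a * ((1 + 6 * ε) * p + p)) := by
      gcongr
    have h5 : (1 + 2 * ε) * (a * ((1 + 6 * ε) * p + p)) =
      2 * (p * a) + 10 * ε * (p * a) + 12 * ((p * a) * ε ^ 2) := by ring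
    linarith
  have h7 : 0 ≤ (1 + 11.2 * ε) * (p * a) := by positivity
  constructor
  · have h3 := hupper _ _ hM₁ h₁
    have h5 : (1 - ε) * (a * ((1 - 3 * ε) * p + p)) ≤ exp (-ε) * (a * (M₂ + p)) := by
      have : 0 ≤ 1 - 3 * ε := by linarith
      gcongr
    have h5' : (1 - ε) * (a * ((1 - 3 * ε) * p + p)) =
      2 * (p * a) - 5 * ε * (p * a) + 3 * ((p * a) * ε ^ 2) := by ring
    have h6 : 2 * β * (H₁ - a * p) ≤ 2 * ε * ((1 + 11.2 * ε) * (p * a)) := by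
      calc _ ≤ 2 * β * ((1 + 11.2 * ε) * (p * a)) := by gcongr
        _ ≤ _ := by gcongr
    have h6' : 2 * ε * ((1 + 11.2 * ε) * (p * a)) =
      2 * ε * (p * a) + 22.4 * ((p * a) * ε ^ 2) := by ring
    have h9 : 0 ≤ (p * a) * ε ^ 2 := by positivity
    have h10 : 0 ≤ ε * (p * a) := by positivity
    have h11 : (1 - 15 * ε) * p * a = p * a - 15 * (ε * (p * a)) := by ring
    linarith
  · have h3 := hupper _ _ hM₀ h₀
    have h10 : 0 ≤ ε * (p * a) := by positivity
    calc _ ≤ (1 + β) * ((1 + 11.2 * ε) * (p * a)) := by gcongr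
      _ ≤ (1 + ε) * ((1 + 11.2 * ε) * (p * a)) := by gcongr
      _ = p * a + 12.2 * (ε * (p * a)) + 11.2 * ((p * a) * ε ^ 2) := by ring
      _ ≤ p * a + 15 * (ε * (p * a)) := by linarith
      _ = _ := by ring

/-- The measure of the intersection of a set `A` with a random cap of density `p` is close to
`p` times the measure of `A`, with high probability, unless `A` is very small. -/
theorem cap_inter_deviation_le [NeZero d] {A : Set (USphere d)} (hAm : MeasurableSet A)
    (hA : 0 < (unifSphere d).real A)
    {τ η κ l ε b θ ϑ : ℝ} (hl : 0 ≤ l) (hκ0 : 0 ≤ κ)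
    (hκ : η * |τ * √d| ≤ κ) (hε0 : 0 < ε) (hε : ε ≤ 1 / 10)
    (hp : 0 < capProb d τ) (hβ : exp (-(l * κ)) ≤ ε)
    (hζ : (gauss d).real {v | η * √d < |‖v‖ - √d|} ≤ ε * capProb d τ) (hθ : 0 < θ)
    (hb : log (2 / capProb d τ) / θ + θ / 2 ≤ b) (hshift : 4 * κ * b + 8 * κ ^ 2 ≤ ε)
    (hϑ : 1 ≤ ϑ) :
    (unifSphere d).real {w | ¬((1 - 15 * ε) * capProb d τ * (unifSphere d).real A ≤
        (unifSphere d).real (A ∩ cap τ w) ∧ (unifSphere d).real (A ∩ cap τ w) ≤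
        (1 + 15 * ε) * capProb d τ * (unifSphere d).real A)} ≤
      (gauss d).real {v | η * √d < |‖v‖ - √d|} + 6 * exp (-(ϑ * ε) + π ^ 2 *
        (ϑ * (9 * l * √(log (8 / (capProb d τ * (unifSphere d).real A)) / d))) ^ 2 / 8) := by
  have := isProbabilityMeasure_unifSphere (d := d) NeZero.one_le
  obtain ⟨hup, hlow⟩ := smoothTail_bounds hl hκ0 hκ hε0 hε hp hβ hζ hθ hb hshift
  have hp1 : capProb d τ ≤ 1 := by
    rw [← unifSphere_real_cap τ (poleVec d)]; exact measureReal_le_one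
  set p := capProb d τ
  set a := (unifSphere d).real A
  have hdev := fun t => smoothCap_deviation_le (t := t) hA hl hp hp1 hϑ ε
  set D := exp (-(ϑ * ε) + π ^ 2 * (ϑ * (9 * l * √(log (8 / (p * a)) / d))) ^ 2 / 8)
  -- Three levels are needed: τ√d - 2κ for the upper bound, τ√d + κ and τ√d + 2κ for the lower one.
  -- Each fails with probability at most 2D, whence the factor 6.
  set bad : ℝ → Set 𝔼 := fun t => {v | ¬(exp (-ε) * (a * (smoothTail l t + p)) <
        smoothCap A l t p v ∧ smoothCap A l t p v < exp ε * (a * (smoothTail l t + p)))} with hbad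
  have hmono : (unifSphere d).real {w | ¬((1 - 15 * ε) * p * a ≤
        (unifSphere d).real (A ∩ cap τ w) ∧ (unifSphere d).real (A ∩ cap τ w) ≤
        (1 + 15 * ε) * p * a)} ≤ (gauss d).real ({v | η * √d < |‖v‖ - √d|} ∪
          (bad (τ * √d - 2 * κ) ∪ (bad (τ * √d + κ) ∪ bad (τ * √d + 2 * κ)))) := by
    have hfm : Measurable fun w : USphere d => (unifSphere d).real (A ∩ cap τ w) := by
      have hS : MeasurableSet {q : USphere d × USphere d | τ ≤ ⟪(q.2 : 𝔼), (q.1 : 𝔼)⟫} :=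
        measurableSet_le measurable_const (by fun_prop)
      exact (measurable_measure_prodMk_left ((measurable_snd hAm).inter hS)).ennreal_toReal
    have hB : MeasurableSet {w : USphere d | ¬((1 - 15 * ε) * p * a ≤
        (unifSphere d).real (A ∩ cap τ w) ∧ (unifSphere d).real (A ∩ cap τ w) ≤
        (1 + 15 * ε) * p * a)} :=
      ((measurableSet_le measurable_const hfm).inter
        (measurableSet_le hfm measurable_const)).compl
    have hmap : ∀ B : Set (USphere d), MeasurableSet B →
        (unifSphere d).real B = (gauss d).real (dir ⁻¹' B) := fun B hB => by
      rw [← map_dir_gauss, map_measureReal_apply measurable_dir hB]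
    rw [hmap _ hB]
    refine measureReal_mono fun v hv => ?_
    by_contra hcon
    simp only [Set.mem_union, not_or, hbad, Set.mem_ofPred_eq, not_not, not_lt] at hcon
    obtain ⟨hv0, ⟨-, h0⟩, ⟨-, h1⟩, ⟨h2, -⟩⟩ := hcon
    refine hv ?_
    have hu := real_inter_cap_le (A := A) hl hκ hv0 p
    have hd := le_real_inter_cap (A := A) hl hκ hv0 p
    have hM₁ : smoothTail l (τ * √d + κ) ≤ (1 + 6 * ε) * p :=
      (smoothTail_antitone hl (by linarith)).trans hup
    have hb := cap_bounds_of_smooth_bounds hε0 hε hp hA (exp_pos (-(l * κ))) hβ hup hM₁ hlow h0 h1 h2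
    exact ⟨hb.1.trans hd, hu.trans hb.2⟩
  refine hmono.trans ((measureReal_union_le _ _).trans ?_)
  have h3 := measureReal_union_le (μ := gauss d) (bad (τ * √d - 2 * κ))
    (bad (τ * √d + κ) ∪ bad (τ * √d + 2 * κ))
  have h4 := measureReal_union_le (μ := gauss d) (bad (τ * √d + κ)) (bad (τ * √d + 2 * κ))
  have h5 := hdev (τ * √d - 2 * κ)
  have h6 := hdev (τ * √d + κ)
  have h7 := hdev (τ * √d + 2 * κ)
  linarith

/-! ### Size of the threshold and choice of parameters in terms of n. -/

theorem unifSphere_real_abs_inner_ge_le [NeZero d] (u : USphere d) {s : ℝ} (hs : 0 ≤ s) :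
    (unifSphere d).real {w | s ≤ |⟪(w : 𝔼), (u : 𝔼)⟫|} ≤ 4 * exp (-(d * s ^ 2 / 32)) := by
  have := isProbabilityMeasure_unifSphere (d := d) NeZero.one_le
  have hd0 : (0 : ℝ) < d := by exact_mod_cast Nat.pos_of_ne_zero (NeZero.ne d)
  rcases hs.eq_or_lt with rfl | hs
  · refine measureReal_le_one.trans ?_
    simp
  set θ := d * s / 16 with hθ
  have hθ0 : 0 < θ := by positivity
  have hm := mul_meas_ge_le_integral_of_nonneg (μ := unifSphere d)
    (f := fun w : USphere d => exp (θ * |⟪(w : 𝔼), (u : 𝔼)⟫|))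
    (Eventually.of_forall fun x => (exp_pos _).le)
    (Continuous.integrable_of_hasCompactSupport (by fun_prop)
      (HasCompactSupport.of_compactSpace _)) (exp (θ * s))
  simp only [exp_le_exp, mul_le_mul_iff_right₀ hθ0] at hm
  have h2 := hm.trans (integral_exp_abs_inner_unifSphere_le NeZero.one_le u θ)
  rw [← le_div_iff₀' (exp_pos _), mul_div_assoc, ← exp_sub] at h2
  refine h2.trans_eq ?_
  congr 2
  rw [hθ]
  field_simp
  ring

/-- The threshold of density `p` is of order at most `√(log (1 / min p (1 - p)) / d)`. -/
theorem mul_sq_le_of_capProb [NeZero d] {τ B : ℝ} (hp0 : 0 < capProb d τ) (hp1 : capProb d τ < 1)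
    (hB : log (4 / capProb d τ) ≤ B) (hB' : log (4 / (1 - capProb d τ)) ≤ B) :
    d * τ ^ 2 ≤ 32 * B := by
  have := isProbabilityMeasure_unifSphere (d := d) NeZero.one_le
  have key : ∀ x : ℝ, 0 < x → log (4 / x) ≤ B → x ≤ 4 * exp (-(d * |τ| ^ 2 / 32)) →
      d * τ ^ 2 ≤ 32 * B := by
    intro x hx hxB hle
    rw [sq_abs] at hle
    have h1 : exp (d * τ ^ 2 / 32) ≤ 4 / x := by
      rw [le_div_iff₀ hx]
      calc _ ≤ exp (d * τ ^ 2 / 32) * (4 * exp (-(d * τ ^ 2 / 32))) := by gcongr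
        _ = 4 := by rw [mul_left_comm, ← exp_add]; simp
    have h2 := (le_log_iff_exp_le (by positivity)).2 h1
    linarith
  have hcap := unifSphere_real_cap τ (poleVec d)
  have hm : MeasurableSet {w : USphere d | τ ≤ ⟪(poleVec d : 𝔼), (w : 𝔼)⟫} :=
    measurableSet_le measurable_const (by fun_prop)
  rcases le_total 0 τ with h | h
  · refine key _ hp0 hB (le_trans ?_ (unifSphere_real_abs_inner_ge_le (poleVec d) (abs_nonneg τ)))
    rw [← hcap]
    refine measureReal_mono fun w hw => ?_
    have hw' : τ ≤ ⟪(poleVec d : 𝔼), (w : 𝔼)⟫ := hw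
    change |τ| ≤ |_|
    rw [abs_of_nonneg h, real_inner_comm]
    exact hw'.trans (le_abs_self _)
  · refine key _ (by linarith) hB'
      (le_trans ?_ (unifSphere_real_abs_inner_ge_le (poleVec d) (abs_nonneg τ)))
    rw [← hcap, ← probReal_compl_eq_one_sub hm]
    refine measureReal_mono fun w hw => ?_
    have hw' : ⟪(poleVec d : 𝔼), (w : 𝔼)⟫ < τ := not_le.1 hw
    change |τ| ≤ |_|
    rw [abs_of_nonpos h, real_inner_comm]
    exact le_trans (by linarith) (neg_le_abs _)

theorem log_div_mul_le {p a q L K M : ℝ} (hp0 : 0 < p) (ha : 0 < a) (hp : log (8 / p) ≤ 2 * L)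
    (hq : 0 ≤ q) (hL : 1 ≤ L) (hM : M = (q + L) * L) (hA : exp (-(K * M)) ≤ a) :
    log (8 / (p * a)) ≤ (K + 2) * M := by
  have h1 : log (8 / (p * a)) = log (8 / p) - log a := by
    rw [← div_div, log_div (by positivity) ha.ne']
  have h2 := (le_log_iff_exp_le ha).2 hA
  have h4 : L ≤ M := by
    rw [hM]
    exact le_mul_of_one_le_left (by linarith) (by linarith)
  rw [h1]
  linarith

/-- The dimension enters here. With slope L and ϑ = 5L/ε the linear term is -5L, and the quadratic
term is of order L⁴ S/(ε²D) with S at most (K + 2)(q + L)L. It stays below L when D is at least a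
constant times (q + L)L⁴/ε², and 2600 is a sufficient constant, as π² ≤ 10. -/
theorem exponent_le {L ε S K q D : ℝ} (hD : 0 < D) (hε0 : 0 < ε) (hL : 0 < L) (hK : 0 ≤ K)
    (hq : 0 ≤ q) (hS : S ≤ (K + 2) * ((q + L) * L))
    (hd : 2600 * (K + 2) / ε ^ 2 * ((q + L) * L ^ 4) ≤ D) :
    -(5 * L / ε * ε) + π ^ 2 * (5 * L / ε * (9 * L * √(S / D))) ^ 2 / 8 ≤ -(4 * L) := by
  have hS0 : S / D ≤ (K + 2) * ((q + L) * L) / D := div_le_div_of_nonneg_right hS hD.le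
  have hsq : √(S / D) ^ 2 ≤ (K + 2) * ((q + L) * L) / D := by
    rcases le_total 0 (S / D) with h | h
    · rwa [Real.sq_sqrt h]
    · rw [Real.sqrt_eq_zero_of_nonpos h]
      exact (zero_pow two_ne_zero).trans_le (by positivity)
  have hpi : π ^ 2 ≤ 10 := by nlinarith [pi_lt_d2, pi_pos]
  have h1 : (5 * L / ε * (9 * L * √(S / D))) ^ 2 ≤
      2025 * L ^ 4 / ε ^ 2 * ((K + 2) * ((q + L) * L) / D) := by
    calc _ = 2025 * L ^ 4 / ε ^ 2 * √(S / D) ^ 2 := by ring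
      _ ≤ _ := by gcongr
  have h2 : 2025 * L ^ 4 / ε ^ 2 * ((K + 2) * ((q + L) * L) / D) ≤ 2025 / 2600 * L := by
    have h3 : 2025 * L ^ 4 / ε ^ 2 * ((K + 2) * ((q + L) * L) / D) =
      2025 / 2600 * L * ((2600 * (K + 2) / ε ^ 2 * ((q + L) * L ^ 4)) / D) := by
      field_simp
    rw [h3]
    refine mul_le_of_le_one_right (by positivity) ?_
    rw [div_le_one hD]
    exact hd
  have h4 : π ^ 2 * (5 * L / ε * (9 * L * √(S / D))) ^ 2 ≤ 10 * (2025 / 2600 * L) :=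
    mul_le_mul hpi (h1.trans h2) (sq_nonneg _) (by norm_num)
  rw [div_mul_cancel₀ _ hε0.ne']
  linarith

set_option maxHeartbeats 800000 in
/-- `cap_inter_deviation_le` with the parameters chosen in terms of `n`. -/
theorem cap_inter_deviation_le_of_dim [NeZero d] {n : ℕ} {τ ε K : ℝ} (hn : 0 < n) (hK : 0 ≤ K)
    (hε0 : 0 < ε) (hε : ε ≤ 1 / 10) (hp0 : 0 < capProb d τ) (hp1 : capProb d τ < 1)
    (hL1 : 1 ≤ log n) (hp : log (8 / capProb d τ) ≤ 2 * log n)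
    (hp' : log (4 / (1 - capProb d τ)) ≤ 2 * log n) (hβ : exp (-√√(log n)) ≤ ε)
    (hy : 18 / √√(log n) ≤ ε) (hnp : 2 / (n : ℝ) ^ 4 ≤ ε * capProb d τ)
    (hd : 2600 * (K + 2) / ε ^ 2 * ((n * capProb d τ + log n) * log n ^ 4) ≤ d)
    {A : Set (USphere d)} (hAm : MeasurableSet A)
    (hA : exp (-(K * ((n * capProb d τ + log n) * log n))) ≤ (unifSphere d).real A) :
    (unifSphere d).real {w | ¬((1 - 15 * ε) * capProb d τ * (unifSphere d).real A ≤
        (unifSphere d).real (A ∩ cap τ w) ∧ (unifSphere d).real (A ∩ cap τ w) ≤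
        (1 + 15 * ε) * capProb d τ * (unifSphere d).real A)} ≤ 8 / (n : ℝ) ^ 4 := by
  have hn0 : (0 : ℝ) < n := by exact_mod_cast hn
  have hd0 : (0 : ℝ) < d := by exact_mod_cast Nat.pos_of_ne_zero (NeZero.ne d)
  set p := capProb d τ with hpdef
  set L := log n with hL
  -- The slope is L = y⁴ and the smoothing width κ = y⁻³. Then lκ = y makes the leakage exp(-y)
  -- small, while moving a tail by κ costs about κ√L = 1/y. The width has to lie between 1/L and
  -- 1/√L.
  set y := √√L with hydef
  have hL0 : 0 < L := by linarith
  have hy2 : y ^ 2 = √L := Real.sq_sqrt (Real.sqrt_nonneg _)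
  have hy4 : y ^ 4 = L := by
    rw [show y ^ 4 = (y ^ 2) ^ 2 by ring, hy2, Real.sq_sqrt hL0.le]
  have hy0 : 0 < y := Real.sqrt_pos.2 (Real.sqrt_pos.2 hL0)
  have hy1 : 1 ≤ y := by
    rw [hydef, Real.one_le_sqrt, Real.one_le_sqrt]; exact hL1
  have hexpL : exp (-(4 * L)) = 1 / (n : ℝ) ^ 4 := by
    rw [exp_neg, show 4 * L = ((4 : ℕ) : ℝ) * L by norm_num, exp_nat_mul, exp_log hn0, one_div]
  have hM : (2600 : ℝ) * 200 ≤ 2600 * (K + 2) / ε ^ 2 := by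
    rw [le_div_iff₀ (by positivity)]
    nlinarith
  have hLL : L * L ^ 4 ≤ (n * p + L) * L ^ 4 := by
    gcongr
    have : 0 ≤ n * p := by positivity
    linarith
  have hdL : 2600 * 200 * (L * L ^ 4) ≤ d := le_trans (by gcongr) hd
  have hLle : L ≤ L * L ^ 4 := le_mul_of_one_le_right hL0.le (one_le_pow₀ hL1)
  -- Chosen so that η²d/8 = 4L, which makes the deviation probability of the norm at most 2/n⁴.
  set η := √(32 * L / d) with hη
  have hη2 : η ^ 2 = 32 * L / d := Real.sq_sqrt (by positivity)
  have hη1 : η ≤ 1 := by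
    rw [hη, Real.sqrt_le_one, div_le_one hd0]
    linarith
  have hζ : (gauss d).real {v : 𝔼 | η * √d < |‖v‖ - √d|} ≤ 2 / (n : ℝ) ^ 4 := by
    refine (gauss_norm_deviation_le d (Real.sqrt_nonneg _) hη1).trans_eq ?_
    rw [hη2, div_mul_cancel₀ _ hd0.ne', show 32 * L / 8 = 4 * L by ring, hexpL]
    ring
  have hτ : d * τ ^ 2 ≤ 32 * (2 * L) := by
    refine mul_sq_le_of_capProb hp0 hp1 (le_trans (log_le_log (by positivity) ?_) hp) hp'
    gcongr
    norm_num
  have hκ : η * |τ * √d| ≤ 1 / y ^ 3 := by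
    refine abs_le_of_sq_le_sq' ?_ (by positivity) |>.2
    rw [mul_pow, sq_abs, mul_pow, Real.sq_sqrt hd0.le, hη2, mul_comm (τ ^ 2)]
    calc 32 * L / d * (d * τ ^ 2) ≤ 32 * L / d * (32 * (2 * L)) := by gcongr
      _ = 2048 * L ^ 2 / d := by ring
      _ ≤ 1 / L ^ 2 := by
        rw [div_le_div_iff₀ hd0 (by positivity)]
        have h1 : 1 ≤ L := hL1
        have h2 : 2048 * L ^ 2 * L ^ 2 ≤ 2600 * 200 * (L * L ^ 4) := by
          have : 0 < L ^ 4 := by positivity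
          nlinarith
        linarith
      _ ≤ (1 / y ^ 3) ^ 2 := by
        rw [div_pow, one_pow, ← hy4]
        refine one_div_le_one_div_of_le (by positivity) ?_
        rw [← pow_mul, ← pow_mul]
        exact pow_le_pow_right₀ hy1 (by norm_num)
  have hβ' : exp (-(L * (1 / y ^ 3))) ≤ ε := by
    refine le_of_eq_of_le ?_ hβ
    rw [← hy4]
    congr 2
    field_simp
  have hb : log (2 / p) / y ^ 2 + y ^ 2 / 2 ≤ 5 / 2 * y ^ 2 := by
    have h1 : log (2 / p) ≤ 2 * y ^ 4 := by
      rw [hy4]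
      refine le_trans (log_le_log (by positivity) ?_) hp
      gcongr
      norm_num
    have h2 : log (2 / p) / y ^ 2 ≤ 2 * y ^ 2 := by
      rw [div_le_iff₀ (by positivity)]
      calc _ ≤ 2 * y ^ 4 := h1
        _ = _ := by ring
    linarith
  have hshift : 4 * (1 / y ^ 3) * (5 / 2 * y ^ 2) + 8 * (1 / y ^ 3) ^ 2 ≤ ε := by
    refine le_trans ?_ hy
    have h1 : 4 * (1 / y ^ 3) * (5 / 2 * y ^ 2) = 10 / y := by field_simp; norm_num
    have h2 : 8 * (1 / y ^ 3) ^ 2 ≤ 8 / y := by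
      rw [div_pow, one_pow, ← pow_mul, mul_one_div]
      gcongr
      exact le_self_pow₀ hy1 (by norm_num)
    rw [h1]
    refine (add_le_add_right h2 _).trans_eq ?_
    ring
  have hϑ : 1 ≤ 5 * L / ε := by
    rw [le_div_iff₀ hε0]
    linarith
  have hApos : 0 < (unifSphere d).real A := lt_of_lt_of_le (exp_pos _) hA
  have hmain := cap_inter_deviation_le hAm hApos hL0.le (by positivity) hκ hε0 hε hp0 hβ'
    (hζ.trans hnp) (by positivity) hb hshift hϑ
  refine hmain.trans ?_
  rw [← hpdef]
  set S := log (8 / (p * (unifSphere d).real A)) with hS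
  have hq : 0 ≤ n * p := mul_nonneg hn0.le hp0.le
  have hSle : S ≤ (K + 2) * ((n * p + L) * L) := log_div_mul_le hp0 hApos hp hq hL1 rfl hA
  have hexp : -(5 * L / ε * ε) + π ^ 2 * (5 * L / ε * (9 * L * √(S / d))) ^ 2 / 8 ≤ -(4 * L) :=
    exponent_le hd0 hε0 hL0 hK hq hSle hd
  have h6 := exp_le_exp.2 hexp
  rw [hexpL] at h6
  calc _ ≤ 2 / (n : ℝ) ^ 4 + 6 * (1 / (n : ℝ) ^ 4) := by gcongr
    _ = _ := by ring

end

/-! ### Replacing the edges of a random graph one at a time. -/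

section

open SimpleGraph

instance measurableSingletonClass_simpleGraph {V : Type*} [Countable V] :
    MeasurableSingletonClass (SimpleGraph V) where
  measurableSet_singleton G := by
    have h : ({G} : Set (SimpleGraph V)) = edgeSet ⁻¹' {G.edgeSet} := by
      ext H
      simp
    rw [h]
    exact measurable_edgeSet (measurableSet_singleton _)

/-- Resampling of the edge `jk` with probability `p`, as an operator on functions of a graph. -/
def flipAvg {V : Type*} (p : ℝ) (j k : V) (F : SimpleGraph V → ℝ) (G : SimpleGraph V) : ℝ :=
  p * F (G ⊔ edge j k) + (1 - p) * F (G \ edge j k)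

theorem sup_edge_sdiff {V : Type*} {G : SimpleGraph V} {j k : V} (h : ¬G.Adj j k) :
    (G ⊔ edge j k) \ edge j k = G := by
  rw [sup_sdiff_right_self, sdiff_edge _ h]

theorem sdiff_edge_sup {V : Type*} {G : SimpleGraph V} {j k : V} (h : G.Adj j k) :
    G \ edge j k ⊔ edge j k = G := by
  rw [sdiff_sup_self, sup_edge_of_adj _ h]

open scoped Classical in
theorem sum_simpleGraph_eq {V : Type*} [Fintype V] {j k : V} (hjk : j ≠ k)
    (h : SimpleGraph V → ℝ) :
    ∑ G, h G = ∑ G with ¬G.Adj j k, (h G + h (G ⊔ edge j k)) := by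
  rw [← Finset.sum_filter_add_sum_filter_not Finset.univ (fun G : SimpleGraph V => ¬G.Adj j k) h,
    Finset.sum_add_distrib]
  congr 1
  refine Finset.sum_nbij' (fun G => G \ edge j k) (fun G => G ⊔ edge j k) ?_ ?_ ?_ ?_ ?_
  · intro G hG
    simp [sdiff_adj, edge_adj, hjk]
  · intro G hG
    simp [edge_adj, hjk]
  · intro G hG
    simp only [not_not, Finset.mem_filter, Finset.mem_univ, true_and] at hG
    exact sdiff_edge_sup hG
  · intro G hG
    simp only [Finset.mem_filter, Finset.mem_univ, true_and] at hG
    exact sup_edge_sdiff hG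
  · intro G hG
    simp only [not_not, Finset.mem_filter, Finset.mem_univ, true_and] at hG
    rw [sdiff_edge_sup hG]

theorem binomialRandom_real_singleton {V : Type*} [Fintype V] (p : unitInterval)
    (G : SimpleGraph V) : (binomialRandom V p).real {G} =
      (p : ℝ) ^ G.edgeSet.ncard * (1 - p : ℝ) ^ ((Nat.card V).choose 2 - G.edgeSet.ncard) := by
  simp [measureReal_def, binomialRandom_singleton]

theorem ncard_edgeSet_le {V : Type*} [Fintype V] (G : SimpleGraph V) :
    G.edgeSet.ncard ≤ (Nat.card V).choose 2 := by
  classical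
  rw [Nat.card_eq_fintype_card, ← Sym2.card_diagSet_compl, Fintype.card_eq_nat_card,
    Nat.card_coe_set_eq]
  exact Set.ncard_le_ncard G.edgeSet_subset_compl_diagSet (Set.toFinite _)

theorem ncard_edgeSet_sup_edge {V : Type*} [Fintype V] {G : SimpleGraph V} {j k : V}
    (hjk : j ≠ k) (h : ¬G.Adj j k) : (G ⊔ edge j k).edgeSet.ncard = G.edgeSet.ncard + 1 := by
  rw [edgeSet_sup, edgeSet_edge_of_ne hjk, Set.union_singleton,
    Set.ncard_insert_of_notMem (by simpa using h) (Set.toFinite _)]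

/-- Graphs pair off as G without jk and G with jk, their weights are in ratio 1 - p to p, and
`flipAvg` replaces both values by the mean over the pair. -/
theorem integral_flipAvg_binomialRandom {V : Type*} [Fintype V] (p : unitInterval) {j k : V}
    (hjk : j ≠ k) (F : SimpleGraph V → ℝ) :
    ∫ G, flipAvg p j k F G ∂(binomialRandom V p) = ∫ G, F G ∂(binomialRandom V p) := by
  classical
  rw [integral_fintype (.of_finite), integral_fintype (.of_finite), sum_simpleGraph_eq hjk,
    sum_simpleGraph_eq hjk]
  refine Finset.sum_congr rfl fun G hG => ?_
  simp only [Finset.mem_filter, Finset.mem_univ, true_and] at hG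
  have h1 := ncard_edgeSet_sup_edge hjk hG
  have h2 := ncard_edgeSet_le (G ⊔ edge j k)
  obtain ⟨N, hN⟩ : ∃ N, (Nat.card V).choose 2 = G.edgeSet.ncard + 1 + N :=
    ⟨_, (Nat.add_sub_cancel' (h1 ▸ h2)).symm⟩
  simp only [binomialRandom_real_singleton, smul_eq_mul, flipAvg, h1, hN, sup_edge_sdiff hG,
    sdiff_edge _ hG, sup_assoc, sup_idem]
  rw [show G.edgeSet.ncard + 1 + N - (G.edgeSet.ncard + 1) = N by omega,
    show G.edgeSet.ncard + 1 + N - G.edgeSet.ncard = N + 1 by omega]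
  ring

/-- The pairs `i < l` of `Fin n` are ordered by `l`, then by `i`. A function of a graph depends
only on the pairs of rank below `m`. -/
def DependsBelow {n : ℕ} (m : ℕ) (F : SimpleGraph (Fin n) → ℝ) : Prop :=
  ∀ A B : SimpleGraph (Fin n),
    (∀ i l : Fin n, i < l → (l : ℕ) * n + i < m → (A.Adj i l ↔ B.Adj i l)) → F A = F B

theorem pair_rank_injective {n : ℕ} {i l j k : Fin n} (h : (l : ℕ) * n + i = (k : ℕ) * n + j) :
    i = j ∧ l = k := by
  have hn : 0 < n := i.pos
  have h1 := congrArg (· / n) h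
  have h2 := congrArg (· % n) h
  simp only [mul_comm _ n, Nat.mul_add_div hn, Nat.mul_add_mod, Nat.div_eq_of_lt i.2,
    Nat.div_eq_of_lt j.2, Nat.mod_eq_of_lt i.2, Nat.mod_eq_of_lt j.2, add_zero] at h1 h2
  exact ⟨Fin.ext h2, Fin.ext h1⟩

theorem dependsBelow_of_sup_sdiff {n : ℕ} {F : SimpleGraph (Fin n) → ℝ} {j k : Fin n}
    (hF : DependsBelow ((k : ℕ) * n + j + 1) F) :
    DependsBelow ((k : ℕ) * n + j) (fun G => F (G ⊔ edge j k)) ∧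
      DependsBelow ((k : ℕ) * n + j) (fun G => F (G \ edge j k)) := by
  have key : ∀ A B : SimpleGraph (Fin n),
      (∀ i l : Fin n, i < l → (l : ℕ) * n + i < (k : ℕ) * n + j → (A.Adj i l ↔ B.Adj i l)) →
      ∀ i l : Fin n, i < l → (l : ℕ) * n + i < (k : ℕ) * n + j + 1 →
      (i = j ∧ l = k) ∨ (A.Adj i l ↔ B.Adj i l) := by
    intro A B h i l hil hr
    rcases (Nat.lt_succ_iff.1 hr).eq_or_lt with hr | hr
    · exact Or.inl (pair_rank_injective hr)
    · exact Or.inr (h i l hil hr)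
  constructor
  · intro A B h
    refine hF _ _ fun i l hil hr => ?_
    rcases key A B h i l hil hr with ⟨rfl, rfl⟩ | h'
    · simp [edge_adj, hil.ne]
    · simp [h']
  · intro A B h
    refine hF _ _ fun i l hil hr => ?_
    rcases key A B h i l hil hr with ⟨rfl, rfl⟩ | h'
    · simp [edge_adj, hil.ne]
    · simp [h']

theorem flipAvg_mono {V : Type*} {p : ℝ} (h0 : 0 ≤ p) (h1 : p ≤ 1) (j k : V)
    {F : SimpleGraph V → ℝ} (hF : Monotone F) : Monotone (flipAvg p j k F) := by
  intro A B h
  have hA := hF (sup_le_sup_right h (edge j k))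
  have hB := hF (sdiff_le_sdiff_right (c := edge j k) h)
  have : 0 ≤ 1 - p := by linarith
  unfold flipAvg
  gcongr

theorem flipAvg_mem_Icc {V : Type*} {p : ℝ} (h0 : 0 ≤ p) (h1 : p ≤ 1) (j k : V)
    {F : SimpleGraph V → ℝ} (hF : ∀ G, F G ∈ Set.Icc (0 : ℝ) 1) (G : SimpleGraph V) :
    flipAvg p j k F G ∈ Set.Icc (0 : ℝ) 1 := by
  have hA := hF (G ⊔ edge j k)
  have hB := hF (G \ edge j k)
  have : 0 ≤ 1 - p := by linarith
  refine ⟨add_nonneg (mul_nonneg h0 hA.1) (mul_nonneg this hB.1), ?_⟩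
  unfold flipAvg
  nlinarith [hA.2, hB.2]

-- The effect of resampling is the discrete derivative in jk, which does not see that edge, times
-- the centred indicator of the edge. Under another law only the conditional probability of the edge
-- needs control.
open scoped Classical in
theorem sub_flipAvg {V : Type*} (p : ℝ) (j k : V) (F : SimpleGraph V → ℝ) (G : SimpleGraph V) :
    F G - flipAvg p j k F G =
      (F (G ⊔ edge j k) - F (G \ edge j k)) * ((if G.Adj j k then 1 else 0) - p) := by
  by_cases h : G.Adj j k
  · simp only [flipAvg, h, if_true, sup_edge_of_adj _ h]
    ring
  · simp only [flipAvg, h, if_false, sdiff_edge _ h]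
    ring

/-- Pairs are averaged out in decreasing rank until a constant is left; `flipAvg` preserves
monotonicity and the bounds 0 and 1. Some ranks below n² belong to no pair i < l, and `hskip` passes
over them. All pairs have rank below n², so no dependence hypothesis on the initial function is
needed. -/
theorem forall_dependsBelow_induction {n : ℕ} {p : unitInterval}
    {C : ℕ → (SimpleGraph (Fin n) → ℝ) → Prop}
    (hconst : ∀ F, DependsBelow 0 F → C 0 F) (hskip : ∀ m F, C m F → C (m + 1) F)
    (hstep : ∀ (j k : Fin n) (F : SimpleGraph (Fin n) → ℝ), j < k → Monotone F →
      (∀ G, F G ∈ Set.Icc (0 : ℝ) 1) → DependsBelow ((k : ℕ) * n + j + 1) F →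
      C ((k : ℕ) * n + j) (flipAvg p j k F) → C ((k : ℕ) * n + j + 1) F)
    {F : SimpleGraph (Fin n) → ℝ} (hF : Monotone F) (hF01 : ∀ G, F G ∈ Set.Icc (0 : ℝ) 1) :
    C (n ^ 2) F := by
  have main : ∀ m F, Monotone F → (∀ G, F G ∈ Set.Icc (0 : ℝ) 1) → DependsBelow m F → C m F := by
    intro m
    induction m with
    | zero => exact fun F _ _ h => hconst F h
    | succ m ih =>
      intro F hF hF01 hdep
      by_cases hm : ∃ j k : Fin n, j < k ∧ (k : ℕ) * n + j = m
      · obtain ⟨j, k, hjk, rfl⟩ := hm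
        refine hstep j k F hjk hF hF01 hdep (ih _ (flipAvg_mono p.2.1 p.2.2 j k hF)
          (flipAvg_mem_Icc p.2.1 p.2.2 j k hF01) fun A B h => ?_)
        have h1 := (dependsBelow_of_sup_sdiff hdep).1 A B h
        have h2 := (dependsBelow_of_sup_sdiff hdep).2 A B h
        simp only at h1 h2
        rw [flipAvg, flipAvg, h1, h2]
      · refine hskip m F (ih F hF hF01 fun A B h => hdep A B fun i l hil hr => h i l hil ?_)
        exact (Nat.lt_succ_iff.1 hr).lt_of_ne fun he => hm ⟨i, l, hil, he⟩
  refine main _ F hF hF01 fun A B h => ?_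
  congr 1
  have key : ∀ i l : Fin n, i < l → (A.Adj i l ↔ B.Adj i l) := by
    intro i l hil
    refine h i l hil ?_
    have h1 := i.2
    have h2 := l.2
    calc (l : ℕ) * n + i < (l : ℕ) * n + n := by omega
      _ = (l + 1) * n := by ring
      _ ≤ n * n := Nat.mul_le_mul_right n h2
      _ = n ^ 2 := (sq n).symm
  ext i l
  rcases lt_trichotomy i l with hil | rfl | hil
  · exact key i l hil
  · simp
  · rw [A.adj_comm, B.adj_comm]
    exact key l i hil

open scoped Classical in
/-- Replacing the edges one at a time by independent ones. -/
theorem neg_mul_le_integral_sub_binomialRandom {n : ℕ} (ν : Measure (SimpleGraph (Fin n)))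
    [IsProbabilityMeasure ν] (p : unitInterval) (s b : ℝ) (hb : 0 ≤ b)
    (H : ∀ j k : Fin n, j < k → ∀ c : SimpleGraph (Fin n) → ℝ, (∀ G, c G ∈ Set.Icc (0 : ℝ) 1) →
      DependsBelow ((k : ℕ) * n + j) c →
      -b ≤ s * ∫ G, c G * ((if G.Adj j k then 1 else 0) - (p : ℝ)) ∂ν)
    {F : SimpleGraph (Fin n) → ℝ} (hF : Monotone F) (hF01 : ∀ G, F G ∈ Set.Icc (0 : ℝ) 1) :
    -((n : ℝ) ^ 2 * b) ≤ s * (∫ G, F G ∂ν - ∫ G, F G ∂(binomialRandom (Fin n) p)) := by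
  have h := forall_dependsBelow_induction (p := p)
    (C := fun m F => -(m * b) ≤ s * (∫ G, F G ∂ν - ∫ G, F G ∂(binomialRandom (Fin n) p)))
    ?_ ?_ ?_ hF hF01
  · exact_mod_cast h
  · intro F hF
    have : F = fun _ => F ⊥ := funext fun G => hF _ _ (by simp)
    rw [this]
    simp
  · intro m F h
    refine le_trans ?_ h
    push_cast
    linarith
  · intro j k F hjk hF hF01 hdep h
    obtain ⟨h1, h2⟩ := dependsBelow_of_sup_sdiff hdep
    -- The discrete derivative is nonnegative because F is monotone, which makes a one-sided bound
    -- on the edge probability sufficient. It depends only on pairs of smaller rank.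
    have h3 := H j k hjk (fun G => F (G ⊔ edge j k) - F (G \ edge j k)) ?_ ?_
    · have h4 : ∫ G, F G ∂ν = ∫ G, flipAvg p j k F G ∂ν +
          ∫ G, (F (G ⊔ edge j k) - F (G \ edge j k)) * ((if G.Adj j k then 1 else 0) - (p : ℝ))
            ∂ν := by
        rw [← integral_add .of_finite .of_finite]
        refine integral_congr_ae (Eventually.of_forall fun G => ?_)
        have := sub_flipAvg (p : ℝ) j k F G
        simp only
        linarith
      rw [integral_flipAvg_binomialRandom p hjk.ne] at h
      rw [h4]
      push_cast at h ⊢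
      linarith
    · intro G
      have h4 := hF (sdiff_le.trans le_sup_left : G \ edge j k ≤ G ⊔ edge j k)
      have h5 := (hF01 (G ⊔ edge j k)).2
      have h6 := (hF01 (G \ edge j k)).1
      exact ⟨by linarith, by linarith⟩
    · intro A B hAB
      have h4 := h1 A B hAB
      have h5 := h2 A B hAB
      simp only at h4 h5 ⊢
      rw [h4, h5]

/-- The same induction takes the place of a coupling: resampling an edge with probability q in place
of p can only raise a monotone function. -/
theorem integral_binomialRandom_mono {n : ℕ} {p q : unitInterval} (hpq : p ≤ q)
    {F : SimpleGraph (Fin n) → ℝ} (hF : Monotone F) (hF01 : ∀ G, F G ∈ Set.Icc (0 : ℝ) 1) :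
    ∫ G, F G ∂(binomialRandom (Fin n) p) ≤ ∫ G, F G ∂(binomialRandom (Fin n) q) := by
  refine forall_dependsBelow_induction (p := p)
    (C := fun m F =>
      ∫ G, F G ∂(binomialRandom (Fin n) p) ≤ ∫ G, F G ∂(binomialRandom (Fin n) q))
    ?_ ?_ ?_ hF hF01
  · intro F hF
    have : F = fun _ => F ⊥ := funext fun G => hF _ _ (by simp)
    rw [this]
    simp
  · exact fun m F h => h
  · intro j k F hjk hF hF01 hdep h
    rw [integral_flipAvg_binomialRandom p hjk.ne] at h
    refine h.trans ?_
    rw [← integral_flipAvg_binomialRandom q hjk.ne F]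
    refine integral_mono .of_finite .of_finite fun G => ?_
    have h4 := hF (sdiff_le.trans le_sup_left : G \ edge j k ≤ G ⊔ edge j k)
    have h5 : (p : ℝ) ≤ q := hpq
    simp only [flipAvg]
    nlinarith

theorem monotone_indicator_of_isUpperSet {V : Type*} {P : Set (SimpleGraph V)}
    (hP : IsUpperSet P) : Monotone (P.indicator (fun _ => (1 : ℝ))) := by
  intro A B h
  by_cases hA : A ∈ P
  · simp [hA, hP h hA]
  · simp only [hA, not_false_eq_true, Set.indicator_of_notMem]
    exact Set.indicator_nonneg (fun _ _ => zero_le_one) _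

theorem indicator_one_mem_Icc {V : Type*} (P : Set V) (A : V) :
    P.indicator (fun _ => (1 : ℝ)) A ∈ Set.Icc (0 : ℝ) 1 :=
  ⟨Set.indicator_nonneg (fun _ _ => zero_le_one) _,
    Set.indicator_le_self' (fun _ _ => zero_le_one) _⟩

theorem binomialRandom_real_mono {n : ℕ} {p q : unitInterval} (hpq : p ≤ q)
    {P : Set (SimpleGraph (Fin n))} (hP : IsUpperSet P) :
    (binomialRandom (Fin n) p).real P ≤ (binomialRandom (Fin n) q).real P := by
  have h := integral_binomialRandom_mono hpq (monotone_indicator_of_isUpperSet hP)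
    (indicator_one_mem_Icc P)
  have hm : MeasurableSet P := P.toFinite.measurableSet
  simpa [integral_indicator hm] using h

end

/-! ### Resampling one point, and the patterns of its adjacencies. -/

section

variable {n d : ℕ}
local notation "𝔼" => EuclideanSpace ℝ (Fin d)

/-- The law of `n` independent uniform points of the sphere. -/
abbrev spherePi (n d : ℕ) : Measure (Fin n → USphere d) := Measure.pi fun _ => unifSphere d

theorem integrable_of_abs_le {Ω : Type*} [MeasurableSpace Ω] {μ : Measure Ω} [IsFiniteMeasure μ]
    {f : Ω → ℝ} (hf : Measurable f) {C : ℝ} (h : ∀ x, |f x| ≤ C) : Integrable f μ :=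
  Integrable.of_bound hf.aestronglyMeasurable C (ae_of_all _ h)

theorem measurable_uncurried_right {α β : Type*} [MeasurableSpace α] [MeasurableSpace β]
    {f : α → β → ℝ} (hf : Measurable fun q : α × β => f q.1 q.2) (a : α) : Measurable (f a) :=
  Measurable.comp (g := fun q : α × β => f q.1 q.2) hf (measurable_prodMk_left (x := a))

theorem measurable_uncurried_graph {α β : Type*} [MeasurableSpace α] [MeasurableSpace β]
    {f : α → β → ℝ} (hf : Measurable fun q : α × β => f q.1 q.2) {g : α → β} (hg : Measurable g) :
    Measurable fun a => f a (g a) :=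
  Measurable.comp (g := fun q : α × β => f q.1 q.2) hf (measurable_id.prodMk hg)

instance isProbabilityMeasure_unifSphere_of_neZero [NeZero d] :
    IsProbabilityMeasure (unifSphere d) :=
  isProbabilityMeasure_unifSphere (Nat.one_le_iff_ne_zero.2 (NeZero.ne d))

theorem measurable_update_prod (k : Fin n) :
    Measurable fun q : (Fin n → USphere d) × USphere d => Function.update q.1 k q.2 := by
  rw [measurable_pi_iff]
  intro i
  by_cases h : i = k
  · subst h
    simpa using measurable_snd
  · simp only [Function.update_of_ne h]
    exact (measurable_pi_apply i).comp measurable_fst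

theorem measurePreserving_update [NeZero d] (k : Fin n) :
    MeasurePreserving (fun q : (Fin n → USphere d) × USphere d => Function.update q.1 k q.2)
      ((spherePi n d).prod (unifSphere d)) (spherePi n d) := by
  refine ⟨measurable_update_prod k, (Measure.pi_eq fun s hs => ?_).symm⟩
  rw [Measure.map_apply (measurable_update_prod k) (MeasurableSet.univ_pi hs)]
  have h : (fun q : (Fin n → USphere d) × USphere d => Function.update q.1 k q.2) ⁻¹'
      Set.univ.pi s = (Set.univ.pi (Function.update s k Set.univ)) ×ˢ s k := by
    ext q
    simp only [Set.mem_preimage, Set.mem_univ_pi, Set.mem_prod]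
    constructor
    · intro h
      refine ⟨fun i => ?_, by simpa using h k⟩
      by_cases hi : i = k
      · subst hi
        simp
      · simpa [Function.update_of_ne hi] using h i
    · rintro ⟨h1, h2⟩ i
      by_cases hi : i = k
      · subst hi
        simpa using h2
      · simpa [Function.update_of_ne hi] using h1 i
  rw [h, Measure.prod_prod, Measure.pi_pi, ← Finset.mul_prod_erase _ _ (Finset.mem_univ k),
    ← Finset.mul_prod_erase Finset.univ (fun i => unifSphere d (s i)) (Finset.mem_univ k)]
  simp only [Function.update_self, measure_univ, one_mul]
  rw [mul_comm]
  congr 1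
  refine Finset.prod_congr rfl fun i hi => ?_
  rw [Function.update_of_ne (Finset.ne_of_mem_erase hi)]

/-- Refreshing one coordinate preserves the product law. This substitutes for conditioning on the
other points. -/
theorem integral_resample [NeZero d] (k : Fin n) {f : (Fin n → USphere d) → ℝ} (hf : Measurable f)
    {C : ℝ} (hC : ∀ V, |f V| ≤ C) : ∫ V, f V ∂(spherePi n d) =
      ∫ V, ∫ z, f (Function.update V k z) ∂(unifSphere d) ∂(spherePi n d) := by
  have h := measurePreserving_update (d := d) k
  rw [← integral_prod (fun q : (Fin n → USphere d) × USphere d => f (Function.update q.1 k q.2))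
    (integrable_of_abs_le (hf.comp h.measurable) fun q => hC _),
    ← integral_map (φ := fun q : (Fin n → USphere d) × USphere d => Function.update q.1 k q.2)
      h.measurable.aemeasurable hf.aestronglyMeasurable, h.map_eq]

open scoped Classical in
/-- The set of indices in `I` of those points that are joined to `z`. -/
def pattern (τ : ℝ) (I : Finset (Fin n)) (V : Fin n → USphere d) (z : USphere d) :
    Finset (Fin n) := {i ∈ I | τ ≤ ⟪(V i : 𝔼), (z : 𝔼)⟫}

theorem mem_pattern {τ : ℝ} {I : Finset (Fin n)} {V : Fin n → USphere d} {z : USphere d}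
    {i : Fin n} : i ∈ pattern τ I V z ↔ i ∈ I ∧ τ ≤ ⟪(V i : 𝔼), (z : 𝔼)⟫ := by
  simp [pattern]

/-- The points of the sphere with pattern `x`. -/
def patternSet (τ : ℝ) (I : Finset (Fin n)) (x : Finset (Fin n)) (V : Fin n → USphere d) :
    Set (USphere d) := {z | pattern τ I V z = x}

theorem measurableSet_pattern_eq (τ : ℝ) (I x : Finset (Fin n)) :
    MeasurableSet {q : (Fin n → USphere d) × USphere d | pattern τ I q.1 q.2 = x} := by
  have h : ∀ q : (Fin n → USphere d) × USphere d, pattern τ I q.1 q.2 = x ↔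
      ∀ i, ((i ∈ I ∧ τ ≤ ⟪(q.1 i : 𝔼), (q.2 : 𝔼)⟫) ↔ i ∈ x) := by
    intro q
    simp only [Finset.ext_iff, mem_pattern]
  simp only [h]
  rw [measurableSet_setOfPred]
  refine Measurable.forall fun i => Measurable.iff (Measurable.and measurable_const ?_)
    measurable_const
  rw [← measurableSet_setOfPred]
  exact measurableSet_le measurable_const (by fun_prop)

theorem measurableSet_patternSet (τ : ℝ) (I x : Finset (Fin n)) (V : Fin n → USphere d) :
    MeasurableSet (patternSet τ I x V) :=
  measurable_prodMk_left (x := V) (measurableSet_pattern_eq τ I x)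

theorem measurable_real_patternSet [NeZero d] (τ : ℝ) (I x : Finset (Fin n)) :
    Measurable fun V : Fin n → USphere d => (unifSphere d).real (patternSet τ I x V) :=
  (measurable_measure_prodMk_left (measurableSet_pattern_eq τ I x)).ennreal_toReal

theorem measurable_real_patternSet_inter_cap [NeZero d] (τ : ℝ) (I x : Finset (Fin n)) :
    Measurable fun q : (Fin n → USphere d) × USphere d =>
      (unifSphere d).real (patternSet τ I x q.1 ∩ cap τ q.2) := by
  have h : MeasurableSet {q : ((Fin n → USphere d) × USphere d) × USphere d |
      pattern τ I q.1.1 q.2 = x ∧ τ ≤ ⟪(q.2 : 𝔼), (q.1.2 : 𝔼)⟫} := by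
    have h1 : Measurable fun q : ((Fin n → USphere d) × USphere d) × USphere d =>
      ⟪(q.2 : 𝔼), (q.1.2 : 𝔼)⟫ := by fun_prop
    refine MeasurableSet.inter ?_ (measurableSet_le measurable_const h1)
    exact ((measurable_fst.comp measurable_fst).prodMk measurable_snd)
      (measurableSet_pattern_eq τ I x)
  exact (measurable_measure_prodMk_left h).ennreal_toReal

theorem measurable_real_patternSet_inter_cap_right [NeZero d] (τ : ℝ) (I x : Finset (Fin n))
    (V : Fin n → USphere d) :
    Measurable fun w : USphere d => (unifSphere d).real (patternSet τ I x V ∩ cap τ w) :=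
  measurable_uncurried_right (f := fun (V : Fin n → USphere d) (w : USphere d) =>
    (unifSphere d).real (patternSet τ I x V ∩ cap τ w))
    (measurable_real_patternSet_inter_cap τ I x) V

theorem sum_indicator_patternSet (τ : ℝ) (I : Finset (Fin n)) (V : Fin n → USphere d)
    (z : USphere d) (f : Finset (Fin n) → ℝ) :
    ∑ x, f x * (patternSet τ I x V).indicator (fun _ => (1 : ℝ)) z = f (pattern τ I V z) := by
  rw [Finset.sum_eq_single (pattern τ I V z)]
  · simp [patternSet]
  · intro x _ hx
    have : z ∉ patternSet τ I x V := fun h => hx h.symm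
    simp [this]
  · simp

theorem sum_real_patternSet [NeZero d] (τ : ℝ) (I : Finset (Fin n)) (V : Fin n → USphere d)
    (f : Finset (Fin n) → ℝ) :
    ∑ x, f x * (unifSphere d).real (patternSet τ I x V) =
      ∫ z, f (pattern τ I V z) ∂(unifSphere d) := by
  simp only [← sum_indicator_patternSet τ I V _ f]
  rw [integral_finsetSum]
  · refine Finset.sum_congr rfl fun x _ => ?_
    rw [integral_const_mul, integral_indicator_const _ (measurableSet_patternSet τ I x V)]
    simp
  · exact fun x _ => ((integrable_const _).indicator (measurableSet_patternSet τ I x V)).const_mul _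

/-- `m` is not within a factor `1 ± δ` of `p * a`. -/
def Deviates (δ p a m : ℝ) : Prop := ¬((1 - δ) * p * a ≤ m ∧ m ≤ (1 + δ) * p * a)

theorem measurableSet_deviates {Ω : Type*} [MeasurableSpace Ω] (δ p : ℝ) {a m : Ω → ℝ}
    (ha : Measurable a) (hm : Measurable m) : MeasurableSet {x | Deviates δ p (a x) (m x)} :=
  ((measurableSet_le (ha.const_mul _) hm).inter (measurableSet_le hm (ha.const_mul _))).compl

open scoped Classical in
/-- The total measure of the patterns whose intersection with the cap at `w` deviates. -/
def patternError (δ p τ : ℝ) (I : Finset (Fin n)) (V : Fin n → USphere d) (w : USphere d) : ℝ :=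
  ∑ x, (unifSphere d).real (patternSet τ I x V) *
    if Deviates δ p ((unifSphere d).real (patternSet τ I x V))
      ((unifSphere d).real (patternSet τ I x V ∩ cap τ w)) then 1 else 0

theorem measurable_patternError [NeZero d] (δ p τ : ℝ) (I : Finset (Fin n)) :
    Measurable fun q : (Fin n → USphere d) × USphere d => patternError δ p τ I q.1 q.2 := by
  classical
  refine Finset.measurable_sum _ fun x _ =>
    ((measurable_real_patternSet τ I x).comp measurable_fst).mul ?_
  exact Measurable.ite (measurableSet_deviates δ p
    ((measurable_real_patternSet τ I x).comp measurable_fst)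
    (measurable_real_patternSet_inter_cap τ I x)) measurable_const measurable_const

theorem measurable_patternError_apply [NeZero d] (δ p τ : ℝ) (I : Finset (Fin n)) (j : Fin n) :
    Measurable fun V : Fin n → USphere d => patternError δ p τ I V (V j) :=
  measurable_uncurried_graph (f := patternError δ p τ I) (measurable_patternError δ p τ I)
    (measurable_pi_apply j)

theorem patternError_nonneg (δ p τ : ℝ) (I : Finset (Fin n)) (V : Fin n → USphere d)
    (w : USphere d) : 0 ≤ patternError δ p τ I V w :=
  Finset.sum_nonneg fun x _ => mul_nonneg measureReal_nonneg (by split_ifs <;> norm_num)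

theorem patternError_le_one [NeZero d] (δ p τ : ℝ) (I : Finset (Fin n)) (V : Fin n → USphere d)
    (w : USphere d) : patternError δ p τ I V w ≤ 1 := by
  have h := sum_real_patternSet τ I V (fun _ => 1)
  simp only [one_mul, integral_const, probReal_univ, smul_eq_mul, mul_one] at h
  rw [← h]
  refine Finset.sum_le_sum fun x _ => mul_le_of_le_one_right measureReal_nonneg ?_
  split_ifs <;> norm_num

theorem abs_patternError_le_one [NeZero d] (δ p τ : ℝ) (I : Finset (Fin n))
    (V : Fin n → USphere d) (w : USphere d) : |patternError δ p τ I V w| ≤ 1 := by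
  rw [abs_of_nonneg (patternError_nonneg ..)]
  exact patternError_le_one ..

theorem geomGraph_adj {τ : ℝ} {V : Fin n → USphere d} {i j : Fin n} :
    (geomGraph τ V).Adj i j ↔ i ≠ j ∧ τ ≤ ⟪(V i : 𝔼), (V j : 𝔼)⟫ := Iff.rfl

/-- A pair of rank below kn + j either has larger endpoint below k, so does not involve the point at
k, or is ik with i < j. Hence that point matters only through its pattern on the vertices below j;
the ordering of pairs was chosen for this. -/
theorem geomGraph_update_congr {τ : ℝ} {V : Fin n → USphere d} {j k : Fin n} (hjk : j < k)
    {z z' : USphere d} (hz : pattern τ (Finset.Iio j) V z = pattern τ (Finset.Iio j) V z')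
    {c : SimpleGraph (Fin n) → ℝ} (hc : DependsBelow ((k : ℕ) * n + j) c) :
    c (geomGraph τ (Function.update V k z)) = c (geomGraph τ (Function.update V k z')) := by
  refine hc _ _ fun i l hil hr => ?_
  have hlk : l ≤ k := by
    by_contra h
    have h1 : (k : ℕ) + 1 ≤ l := not_le.1 h
    have h2 : ((k : ℕ) + 1) * n ≤ l * n := Nat.mul_le_mul_right n h1
    have h3 := j.2
    rw [add_mul, one_mul] at h2
    omega
  rw [geomGraph_adj, geomGraph_adj]
  rcases hlk.eq_or_lt with rfl | hlk
  · have hij : i < j := by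
      have : (i : ℕ) < j := by omega
      exact this
    have h := Finset.ext_iff.1 hz i
    simp only [mem_pattern, Finset.mem_Iio, hij, true_and] at h
    rw [Function.update_of_ne hil.ne, Function.update_self, Function.update_self, h,
      Function.update_of_ne hil.ne]
  · rw [Function.update_of_ne hlk.ne, Function.update_of_ne (hil.trans hlk).ne,
      Function.update_of_ne hlk.ne, Function.update_of_ne (hil.trans hlk).ne]

-- With the other points frozen, c is constant on each pattern set, so the integral is a sum over
-- patterns of c times σ(L ∩ cap) - q σ(L). The hypothesis `hs`, with a sign s and a density q,
-- bounds each term and lets one argument serve both sides of the sandwich.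
open scoped Classical in
theorem integral_update_ge [NeZero d] {τ δ p q s : ℝ}
    (hs : ∀ a m c : ℝ, 0 ≤ a → 0 ≤ m → m ≤ a → c ∈ Set.Icc (0 : ℝ) 1 →
      -(a * if Deviates δ p a m then 1 else 0) ≤ s * (c * (m - q * a)))
    {j k : Fin n} (hjk : j < k) {c : SimpleGraph (Fin n) → ℝ}
    (hc01 : ∀ G, c G ∈ Set.Icc (0 : ℝ) 1) (hc : DependsBelow ((k : ℕ) * n + j) c)
    (V : Fin n → USphere d) :
    -patternError δ p τ (Finset.Iio j) V (V j) ≤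
      s * ∫ z, c (geomGraph τ (Function.update V k z)) *
        ((if (geomGraph τ (Function.update V k z)).Adj j k then 1 else 0) - q) ∂(unifSphere d) := by
  set I := Finset.Iio j with hI
  have hfac : Function.FactorsThrough (fun z => c (geomGraph τ (Function.update V k z)))
      (pattern τ I V) := fun z z' hz => geomGraph_update_congr hjk hz hc
  -- The value of c as a function of the pattern. Patterns that do not occur get the default 0,
  -- which is harmless since their pattern sets are empty.
  set C : Finset (Fin n) → ℝ :=
    Function.extend (pattern τ I V) (fun z => c (geomGraph τ (Function.update V k z))) 0 with hC
  have hC01 : ∀ x, C x ∈ Set.Icc (0 : ℝ) 1 := by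
    intro x
    by_cases hx : ∃ z, pattern τ I V z = x
    · obtain ⟨z, rfl⟩ := hx
      rw [hC, hfac.extend_apply]
      exact hc01 _
    · rw [hC, Function.extend_apply' _ _ _ hx]
      simp
  have hL := fun x => measurableSet_patternSet τ I x V
  have hLc := fun x => (hL x).inter (measurableSet_cap τ (V j))
  have heq : ∀ z, c (geomGraph τ (Function.update V k z)) *
      ((if (geomGraph τ (Function.update V k z)).Adj j k then 1 else 0) - q) =
      ∑ x, C x * ((patternSet τ I x V ∩ cap τ (V j)).indicator (fun _ => (1 : ℝ)) z -
        q * (patternSet τ I x V).indicator (fun _ => (1 : ℝ)) z) := by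
    intro z
    have h1 : (geomGraph τ (Function.update V k z)).Adj j k ↔ z ∈ cap τ (V j) := by
      rw [geomGraph_adj, Function.update_of_ne hjk.ne, Function.update_self, real_inner_comm]
      exact and_iff_right hjk.ne
    have h2 : ∀ x, C x * ((patternSet τ I x V ∩ cap τ (V j)).indicator (fun _ => (1 : ℝ)) z -
        q * (patternSet τ I x V).indicator (fun _ => (1 : ℝ)) z) =
        (C x * ((if z ∈ cap τ (V j) then 1 else 0) - q)) *
          (patternSet τ I x V).indicator (fun _ => (1 : ℝ)) z := by
      intro x
      by_cases hx : z ∈ patternSet τ I x V <;> by_cases hz : z ∈ cap τ (V j) <;> simp [hx, hz]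
    rw [Finset.sum_congr rfl fun x _ => h2 x,
      sum_indicator_patternSet τ I V z (fun x => C x * ((if z ∈ cap τ (V j) then 1 else 0) - q)),
      hC, hfac.extend_apply]
    simp only [h1]
  simp only [heq]
  rw [integral_finsetSum, Finset.mul_sum, patternError, ← Finset.sum_neg_distrib]
  · refine Finset.sum_le_sum fun x _ => ?_
    rw [integral_const_mul, integral_sub ((integrable_const _).indicator (hLc x))
      (((integrable_const _).indicator (hL x)).const_mul _), integral_const_mul,
      integral_indicator_const _ (hLc x), integral_indicator_const _ (hL x)]
    simp only [smul_eq_mul, mul_one]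
    exact hs _ _ _ measureReal_nonneg measureReal_nonneg
      (measureReal_mono Set.inter_subset_left) (hC01 x)
  · exact fun x _ => (((integrable_const _).indicator (hLc x)).sub
      (((integrable_const _).indicator (hL x)).const_mul _)).const_mul _

theorem patternError_update {δ p τ : ℝ} {I : Finset (Fin n)} {j : Fin n} (hj : j ∉ I)
    (V : Fin n → USphere d) (w u : USphere d) :
    patternError δ p τ I (Function.update V j w) u = patternError δ p τ I V u := by
  have h : ∀ x, patternSet τ I x (Function.update V j w) = patternSet τ I x V := by
    intro x
    ext z
    have : pattern τ I (Function.update V j w) z = pattern τ I V z := by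
      ext i
      simp only [mem_pattern]
      refine and_congr_right fun hi => ?_
      rw [Function.update_of_ne (ne_of_mem_of_not_mem hi hj)]
    rw [patternSet, patternSet, Set.mem_ofPred_eq, Set.mem_ofPred_eq, this]
  exact Finset.sum_congr rfl fun x _ => by rw [h x]

/-- The patterns on I do not involve the point at j, so that point may be replaced by a fresh
uniform cap centre. -/
theorem integral_patternError_apply [NeZero d] (δ p τ : ℝ) {I : Finset (Fin n)} {j : Fin n}
    (hj : j ∉ I) : ∫ V, patternError δ p τ I V (V j) ∂(spherePi n d) =
      ∫ V, ∫ w, patternError δ p τ I V w ∂(unifSphere d) ∂(spherePi n d) := by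
  have hPEj := measurable_patternError_apply (d := d) δ p τ I j
  refine (integral_resample (d := d) j hPEj (fun V => abs_patternError_le_one ..)).trans ?_
  refine integral_congr_ae (ae_of_all _ fun V => integral_congr_ae (ae_of_all _ fun w => ?_))
  change patternError δ p τ I (Function.update V j w) (Function.update V j w j) = _
  rw [Function.update_self, patternError_update hj]

theorem integral_geomGraph_resample [NeZero d] (τ : ℝ) (k : Fin n) (f : SimpleGraph (Fin n) → ℝ) :
    Integrable (fun V => ∫ z, f (geomGraph τ (Function.update V k z)) ∂(unifSphere d))
      (spherePi n d) ∧
    ∫ V, f (geomGraph τ V) ∂(spherePi n d) =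
      ∫ V, ∫ z, f (geomGraph τ (Function.update V k z)) ∂(unifSphere d) ∂(spherePi n d) := by
  have hfm : Measurable f := measurable_of_finite f
  have hgm := measurable_geomGraph (n := n) (d := d) τ
  obtain ⟨B, hB⟩ : ∃ B, ∀ G, |f G| ≤ B := by
    obtain ⟨B, hB⟩ := (Set.finite_range fun G => |f G|).bddAbove
    exact ⟨B, fun G => hB ⟨G, rfl⟩⟩
  refine ⟨?_, integral_resample (d := d) k (hfm.comp hgm) (fun V => hB _)⟩
  exact (integrable_of_abs_le (hfm.comp (hgm.comp (measurable_update_prod k))) fun q => hB _ :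
      Integrable (fun q : (Fin n → USphere d) × USphere d =>
        f (geomGraph τ (Function.update q.1 k q.2)))
        ((spherePi n d).prod (unifSphere d))).integral_prod_left

open scoped Classical in
theorem integral_edge_ge [NeZero d] {τ δ p q s : ℝ}
    (hs : ∀ a m c : ℝ, 0 ≤ a → 0 ≤ m → m ≤ a → c ∈ Set.Icc (0 : ℝ) 1 →
      -(a * if Deviates δ p a m then 1 else 0) ≤ s * (c * (m - q * a)))
    {j k : Fin n} (hjk : j < k) {c : SimpleGraph (Fin n) → ℝ}
    (hc01 : ∀ G, c G ∈ Set.Icc (0 : ℝ) 1) (hc : DependsBelow ((k : ℕ) * n + j) c) :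
    -∫ V, ∫ w, patternError δ p τ (Finset.Iio j) V w ∂(unifSphere d) ∂(spherePi n d) ≤
      s * ∫ V, c (geomGraph τ V) *
        ((if (geomGraph τ V).Adj j k then 1 else 0) - q) ∂(spherePi n d) := by
  have hPEj := measurable_patternError_apply (d := d) δ p τ (Finset.Iio j) j
  obtain ⟨hint, h1⟩ := integral_geomGraph_resample (d := d) τ k
    (fun G => c G * ((if G.Adj j k then 1 else 0) - q))
  rw [← integral_patternError_apply δ p τ (Finset.notMem_Iio_self (b := j)), h1, ← integral_neg,
    ← integral_const_mul]
  exact integral_mono (integrable_of_abs_le hPEj fun V => abs_patternError_le_one ..).neg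
    (hint.const_mul s) fun V => integral_update_ge hs hjk hc01 hc V

/-! ### Mass of the exceptional patterns. -/

theorem exp_card_pattern (τ : ℝ) (I : Finset (Fin n)) (V : Fin n → USphere d) (z : USphere d) :
    exp (pattern τ I V z).card =
      ∏ i, (1 + (if i ∈ I then exp 1 - 1 else 0) * (cap τ z).indicator (fun _ => (1 : ℝ)) (V i)) := by
  classical
  have h : ∀ i, (1 + (if i ∈ I then exp 1 - 1 else 0) *
      (cap τ z).indicator (fun _ => (1 : ℝ)) (V i)) =
      if i ∈ pattern τ I V z then exp 1 else 1 := by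
    intro i
    have hi : V i ∈ cap τ z ↔ τ ≤ ⟪(V i : 𝔼), (z : 𝔼)⟫ := Iff.rfl
    by_cases h1 : i ∈ I <;> by_cases h2 : V i ∈ cap τ z <;>
      simp [mem_pattern, h1, h2, ← hi]
  rw [Finset.prod_congr rfl fun i _ => h i, Finset.prod_ite_mem, Finset.univ_inter,
    Finset.prod_const, ← exp_nat_mul, mul_one]

/-- For fixed z the pattern size is a sum of independent indicators of probability p, so each i
contributes at most 1 + (e - 1)p ≤ exp(2p). -/
theorem integral_exp_card_pattern_le [NeZero d] (τ : ℝ) (I : Finset (Fin n)) :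
    ∫ V, ∫ z, exp (pattern τ I V z).card ∂(unifSphere d) ∂(spherePi n d) ≤
      exp (2 * (n * capProb d τ)) := by
  have hm : Measurable fun q : (Fin n → USphere d) × USphere d =>
      exp (pattern τ I q.1 q.2).card := by
    have h : ∀ q : (Fin n → USphere d) × USphere d, exp (pattern τ I q.1 q.2).card =
        ∑ x : Finset (Fin n), exp x.card *
          {q : (Fin n → USphere d) × USphere d | pattern τ I q.1 q.2 = x}.indicator
            (fun _ => (1 : ℝ)) q := fun q =>
      (sum_indicator_patternSet τ I q.1 q.2 fun x => exp x.card).symm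
    simp only [h]
    exact Finset.measurable_sum _ fun x _ =>
      (measurable_const.indicator (measurableSet_pattern_eq τ I x)).const_mul _
  have hb : ∀ q : (Fin n → USphere d) × USphere d, |exp (pattern τ I q.1 q.2).card| ≤ exp n := by
    intro q
    rw [abs_of_pos (exp_pos _), exp_le_exp]
    exact_mod_cast (Finset.card_le_univ _).trans_eq (Fintype.card_fin n)
  rw [integral_integral_swap (integrable_of_abs_le hm hb)]
  have hle : ∀ z : USphere d, ∫ V, exp (pattern τ I V z).card ∂(spherePi n d) ≤
      exp (2 * (n * capProb d τ)) := by
    intro z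
    simp only [exp_card_pattern]
    rw [integral_fintype_prod_eq_prod (𝕜 := ℝ) (fun i v => 1 + (if i ∈ I then exp 1 - 1 else 0) *
      (cap τ z).indicator (fun _ => (1 : ℝ)) v)]
    have hcap : (unifSphere d).real (cap τ z) = capProb d τ := by
      rw [← unifSphere_real_cap τ z]
      congr 1
      ext w
      change τ ≤ _ ↔ τ ≤ _
      rw [real_inner_comm]
    have hi : ∀ i : Fin n, ∫ v, (1 + (if i ∈ I then exp 1 - 1 else 0) *
        (cap τ z).indicator (fun _ => (1 : ℝ)) v) ∂(unifSphere d) =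
        1 + (if i ∈ I then exp 1 - 1 else 0) * capProb d τ := by
      intro i
      rw [integral_add (integrable_const _)
        (((integrable_const _).indicator (measurableSet_cap τ z)).const_mul _),
        integral_const_mul, integral_indicator_const _ (measurableSet_cap τ z), hcap]
      simp
    rw [Finset.prod_congr rfl fun i _ => hi i]
    have hp : 0 ≤ capProb d τ := measureReal_nonneg
    have he : exp 1 - 1 ≤ 2 := by linarith [exp_one_lt_d9]
    have he0 : 0 ≤ exp 1 - 1 := by linarith [add_one_le_exp (1 : ℝ)]
    calc _ ≤ ∏ _i : Fin n, exp (2 * capProb d τ) := by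
          refine Finset.prod_le_prod (fun i _ => ?_) fun i _ => ?_
          · split_ifs <;> positivity
          · refine le_trans ?_ (add_one_le_exp _)
            split_ifs
            · nlinarith
            · linarith
      _ = _ := by
          rw [Finset.prod_const, Finset.card_univ, Fintype.card_fin, ← exp_nat_mul]
          ring_nf
  calc _ ≤ ∫ _z, exp (2 * (n * capProb d τ)) ∂(unifSphere d) :=
        integral_mono (integrable_of_abs_le hm hb).integral_prod_right (integrable_const _) hle
    _ = _ := by simp

theorem sum_inv_pow_card_le (hn : 0 < n) : ∑ x : Finset (Fin n), (1 / (n : ℝ)) ^ x.card ≤ 3 := by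
  have h := Fintype.sum_pow_mul_eq_add_pow (Fin n) (1 / (n : ℝ)) 1
  simp only [one_pow, mul_one, Fintype.card_fin] at h
  rw [h]
  have hn0 : (0 : ℝ) < n := by exact_mod_cast hn
  calc (1 / (n : ℝ) + 1) ^ n ≤ exp (1 / n) ^ n :=
        pow_le_pow_left₀ (by positivity) (add_one_le_exp _) n
    _ = exp 1 := by
        rw [← exp_nat_mul, mul_one_div_cancel hn0.ne']
    _ ≤ 3 := by linarith [exp_one_lt_d9]

open scoped Classical in
theorem integral_patternError [NeZero d] (δ p τ : ℝ) (I : Finset (Fin n)) (V : Fin n → USphere d) :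
    ∫ w, patternError δ p τ I V w ∂(unifSphere d) =
      ∑ x, (unifSphere d).real (patternSet τ I x V) *
        (unifSphere d).real {w | Deviates δ p ((unifSphere d).real (patternSet τ I x V))
          ((unifSphere d).real (patternSet τ I x V ∩ cap τ w))} := by
  have hm : ∀ x, MeasurableSet {w | Deviates δ p ((unifSphere d).real (patternSet τ I x V))
      ((unifSphere d).real (patternSet τ I x V ∩ cap τ w))} := fun x =>
    measurableSet_deviates δ p measurable_const
      (measurable_real_patternSet_inter_cap_right τ I x V)
  have h : ∀ x w, (if Deviates δ p ((unifSphere d).real (patternSet τ I x V))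
      ((unifSphere d).real (patternSet τ I x V ∩ cap τ w)) then (1 : ℝ) else 0) =
      {w | Deviates δ p ((unifSphere d).real (patternSet τ I x V))
        ((unifSphere d).real (patternSet τ I x V ∩ cap τ w))}.indicator (fun _ => (1 : ℝ)) w :=
    fun x w => by
      by_cases hx : Deviates δ p ((unifSphere d).real (patternSet τ I x V))
        ((unifSphere d).real (patternSet τ I x V ∩ cap τ w)) <;> simp [hx]
  simp only [patternError, h]
  rw [integral_finsetSum]
  · refine Finset.sum_congr rfl fun x _ => ?_
    rw [integral_const_mul, integral_indicator_const _ (hm x)]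
    simp
  · exact fun x _ => ((integrable_const _).indicator (hm x)).const_mul _

/-- Three cases for a pattern x. Sizes above D = 2np + 4 log n have total mean mass at most n⁻⁴ by
the exponential moment. Patterns of measure below n⁻⁴ n^(-|x|) sum to at most n⁻⁴(1 + 1/n)^n ≤ 3n⁻⁴.
The others have measure at least exp(-(4 + D) log n), so `hdev` applies and they contribute at most
8n⁻⁴. The total is 12n⁻⁴. -/
theorem integral_patternError_le [NeZero d] {δ p τ : ℝ} (hn : 0 < n) (hp : p = capProb d τ)
    (hL : 1 ≤ log n)
    (hdev : ∀ A : Set (USphere d), MeasurableSet A →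
      exp (-(8 * ((n * p + log n) * log n))) ≤ (unifSphere d).real A →
      (unifSphere d).real {w | Deviates δ p ((unifSphere d).real A)
        ((unifSphere d).real (A ∩ cap τ w))} ≤ 8 / (n : ℝ) ^ 4) (I : Finset (Fin n)) :
    ∫ V, ∫ w, patternError δ p τ I V w ∂(unifSphere d) ∂(spherePi n d) ≤ 12 / (n : ℝ) ^ 4 := by
  have hn0 : (0 : ℝ) < n := by exact_mod_cast hn
  have hp0 : 0 ≤ p := hp ▸ measureReal_nonneg
  set D : ℝ := 2 * (n * p) + 4 * log n with hD
  have hexpL : exp (-(4 * log n)) = 1 / (n : ℝ) ^ 4 := by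
    rw [exp_neg, show 4 * log (n : ℝ) = ((4 : ℕ) : ℝ) * log n by norm_num, exp_nat_mul,
      exp_log hn0, one_div]
  have hterm : ∀ (V : Fin n → USphere d) (x : Finset (Fin n)),
      (unifSphere d).real (patternSet τ I x V) *
        (unifSphere d).real {w | Deviates δ p ((unifSphere d).real (patternSet τ I x V))
          ((unifSphere d).real (patternSet τ I x V ∩ cap τ w))} ≤
      exp (-D) * (exp x.card * (unifSphere d).real (patternSet τ I x V)) +
        1 / (n : ℝ) ^ 4 * (1 / (n : ℝ)) ^ x.card +
        8 / (n : ℝ) ^ 4 * (unifSphere d).real (patternSet τ I x V) := by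
    intro V x
    set a := (unifSphere d).real (patternSet τ I x V) with ha
    have ha0 : 0 ≤ a := measureReal_nonneg
    set b := (unifSphere d).real {w | Deviates δ p a
      ((unifSphere d).real (patternSet τ I x V ∩ cap τ w))} with hb
    have hb1 : b ≤ 1 := measureReal_le_one
    have hb0 : 0 ≤ b := measureReal_nonneg
    have t1 : 0 ≤ exp (-D) * (exp x.card * a) := by positivity
    have t2 : 0 ≤ 1 / (n : ℝ) ^ 4 * (1 / (n : ℝ)) ^ x.card := by positivity
    have t3 : 0 ≤ 8 / (n : ℝ) ^ 4 * a := by positivity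
    have hab : a * b ≤ a := mul_le_of_le_one_right ha0 hb1
    by_cases hxD : D < x.card
    · have : a ≤ exp (-D) * (exp x.card * a) := by
        rw [← mul_assoc, ← exp_add]
        exact le_mul_of_one_le_left ha0 (one_le_exp (by linarith))
      linarith
    · by_cases hsmall : a < 1 / (n : ℝ) ^ 4 * (1 / (n : ℝ)) ^ x.card
      · linarith
      · have hA : exp (-(8 * ((n * p + log n) * log n))) ≤ a := by
          refine le_trans ?_ (not_lt.1 hsmall)
          have h1 : 1 / (n : ℝ) ^ 4 * (1 / (n : ℝ)) ^ x.card = exp (-((4 + x.card) * log n)) := by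
            rw [show -((4 + (x.card : ℝ)) * log n) = -(4 * log n) + x.card * (-log n) by ring,
              exp_add, hexpL, exp_nat_mul, exp_neg, exp_log hn0, one_div (n : ℝ)]
          rw [h1, exp_le_exp, neg_le_neg_iff, ← mul_assoc]
          have hx : (x.card : ℝ) ≤ D := not_lt.1 hxD
          refine mul_le_mul_of_nonneg_right ?_ (by linarith)
          have : 0 ≤ n * p := by positivity
          linarith
        have h2 : a * b ≤ a * (8 / (n : ℝ) ^ 4) :=
          mul_le_mul_of_nonneg_left (hdev _ (measurableSet_patternSet τ I x V) hA) ha0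
        linarith
  have hm := measurable_patternError (n := n) (d := d) δ p τ I
  have hsum1 : ∀ V : Fin n → USphere d, ∑ x, (unifSphere d).real (patternSet τ I x V) = 1 := by
    intro V
    simpa using sum_real_patternSet τ I V (fun _ => 1)
  have hmE : Measurable fun V : Fin n → USphere d =>
      ∑ x : Finset (Fin n), exp x.card * (unifSphere d).real (patternSet τ I x V) :=
    Finset.measurable_sum _ fun x _ => (measurable_real_patternSet τ I x).const_mul _
  have hiE : Integrable (fun V : Fin n → USphere d =>
      ∑ x : Finset (Fin n), exp x.card * (unifSphere d).real (patternSet τ I x V))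
      (spherePi n d) := by
    refine integrable_of_abs_le (C := ∑ x : Finset (Fin n), exp x.card) hmE fun V => ?_
    rw [abs_of_nonneg (Finset.sum_nonneg fun x _ => by positivity)]
    exact Finset.sum_le_sum fun x _ => mul_le_of_le_one_right (exp_pos _).le measureReal_le_one
  have hpt : ∀ V : Fin n → USphere d, ∫ w, patternError δ p τ I V w ∂(unifSphere d) ≤
      exp (-D) * ∑ x : Finset (Fin n), exp x.card * (unifSphere d).real (patternSet τ I x V) +
        11 / (n : ℝ) ^ 4 := by
    intro V
    rw [integral_patternError]
    refine (Finset.sum_le_sum fun x _ => hterm V x).trans ?_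
    rw [Finset.sum_add_distrib, Finset.sum_add_distrib, ← Finset.mul_sum, ← Finset.mul_sum,
      ← Finset.mul_sum, hsum1, mul_one, add_assoc]
    refine add_le_add_right ?_ _
    calc _ ≤ 1 / (n : ℝ) ^ 4 * 3 + 8 / (n : ℝ) ^ 4 := by
          gcongr
          exact sum_inv_pow_card_le hn
      _ = _ := by ring
  calc _ ≤ ∫ V, (exp (-D) * ∑ x : Finset (Fin n),
        exp x.card * (unifSphere d).real (patternSet τ I x V) + 11 / (n : ℝ) ^ 4)
        ∂(spherePi n d) := by
        refine integral_mono (Integrable.integral_prod_left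
          (integrable_of_abs_le hm fun q => abs_patternError_le_one ..))
          ((hiE.const_mul _).add (integrable_const _)) hpt
    _ = exp (-D) * ∫ V, ∫ z, exp (pattern τ I V z).card ∂(unifSphere d) ∂(spherePi n d) +
        11 / (n : ℝ) ^ 4 := by
        rw [integral_add (hiE.const_mul _) (integrable_const _), integral_const_mul]
        simp only [sum_real_patternSet τ I _ (fun x => exp x.card)]
        simp
    _ ≤ exp (-D) * exp (2 * (n * p)) + 11 / (n : ℝ) ^ 4 := by
        gcongr
        rw [hp]
        exact integral_exp_card_pattern_le τ I
    _ = _ := by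
        rw [← exp_add, show -D + 2 * (n * p) = -(4 * log n) by rw [hD]; ring, hexpL]
        ring

/-! ### The sandwich between two binomial random graphs. -/

open scoped Classical in
theorem neg_le_of_deviates {δ p a m c : ℝ} (hδ : δ ≤ 1) (hp : 0 ≤ p) (hp1 : (1 - δ) * p ≤ 1)
    (ha : 0 ≤ a) (hm : 0 ≤ m) (hc : c ∈ Set.Icc (0 : ℝ) 1) :
    -(a * if Deviates δ p a m then 1 else 0) ≤ 1 * (c * (m - (1 - δ) * p * a)) := by
  have h1 : 0 ≤ (1 - δ) * p := mul_nonneg (by linarith) hp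
  split_ifs with h
  · have h2 : (1 - δ) * p * a ≤ a := mul_le_of_le_one_left ha hp1
    nlinarith [hc.1, hc.2]
  · have h2 := (not_not.1 h).1
    have := mul_nonneg hc.1 (sub_nonneg.2 h2)
    linarith

open scoped Classical in
theorem neg_le_neg_of_deviates {δ p a m c : ℝ} (hδ : 0 ≤ δ) (hp : 0 ≤ p)
    (ha : 0 ≤ a) (hma : m ≤ a) (hc : c ∈ Set.Icc (0 : ℝ) 1) :
    -(a * if Deviates δ p a m then 1 else 0) ≤ (-1) * (c * (m - (1 + δ) * p * a)) := by
  have h1 : 0 ≤ (1 + δ) * p * a := by positivity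
  split_ifs with h
  · nlinarith [hc.1, hc.2]
  · have h2 := (not_not.1 h).2
    have := mul_nonneg hc.1 (sub_nonneg.2 h2)
    linarith

/-- The sandwich of the random geometric graph between two binomial random graphs. -/
theorem geomGraph_real_sandwich [NeZero d] {δ p τ : ℝ} (hn : 0 < n) (hp : p = capProb d τ)
    (hL : 1 ≤ log n) (hδ0 : 0 ≤ δ) (hδ1 : δ ≤ 1)
    (hdev : ∀ A : Set (USphere d), MeasurableSet A →
      exp (-(8 * ((n * p + log n) * log n))) ≤ (unifSphere d).real A →
      (unifSphere d).real {w | Deviates δ p ((unifSphere d).real A)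
        ((unifSphere d).real (A ∩ cap τ w))} ≤ 8 / (n : ℝ) ^ 4)
    {P : Set (SimpleGraph (Fin n))} (hP : IsUpperSet P) :
    (∀ q : unitInterval, (q : ℝ) = (1 - δ) * p →
      (SimpleGraph.binomialRandom (Fin n) q).real P - 12 / (n : ℝ) ^ 2 ≤
        ((spherePi n d).map (geomGraph τ)).real P) ∧
    (∀ q : unitInterval, (q : ℝ) = (1 + δ) * p →
      ((spherePi n d).map (geomGraph τ)).real P ≤
        (SimpleGraph.binomialRandom (Fin n) q).real P + 12 / (n : ℝ) ^ 2) := by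
  classical
  have hn0 : (0 : ℝ) < n := by exact_mod_cast hn
  have hp0 : 0 ≤ p := hp ▸ measureReal_nonneg
  have hgm := measurable_geomGraph (n := n) (d := d) τ
  have : IsProbabilityMeasure ((spherePi n d).map (geomGraph τ)) :=
    Measure.isProbabilityMeasure_map hgm.aemeasurable
  have hPm : MeasurableSet P := P.toFinite.measurableSet
  have key : ∀ (s : ℝ) (q : unitInterval), (∀ a m c : ℝ, 0 ≤ a → 0 ≤ m → m ≤ a →
      c ∈ Set.Icc (0 : ℝ) 1 →
      -(a * if Deviates δ p a m then 1 else 0) ≤ s * (c * (m - (q : ℝ) * a))) →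
      -(12 / (n : ℝ) ^ 2) ≤ s * (((spherePi n d).map (geomGraph τ)).real P -
        (SimpleGraph.binomialRandom (Fin n) q).real P) := by
    intro s q hs
    -- There are n² ranks, each costing at most 12/n⁴.
    have h := neg_mul_le_integral_sub_binomialRandom ((spherePi n d).map (geomGraph τ)) q s
      (12 / (n : ℝ) ^ 4) (by positivity) ?_ (monotone_indicator_of_isUpperSet hP)
      (indicator_one_mem_Icc P)
    · rw [integral_indicator_const _ hPm, integral_indicator_const _ hPm] at h
      simp only [smul_eq_mul, mul_one] at h
      refine le_trans (le_of_eq ?_) h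
      field_simp
    · intro j k hjk c hc01 hc
      rw [integral_map hgm.aemeasurable (measurable_of_finite _).aestronglyMeasurable]
      refine le_trans ?_ (integral_edge_ge (d := d) (τ := τ) (δ := δ) (p := p) hs hjk hc01 hc)
      exact neg_le_neg (integral_patternError_le hn hp hL hdev _)
  constructor
  · intro q hq
    have := key 1 q fun a m c ha hm _ hc => by
      rw [hq]
      exact neg_le_of_deviates hδ1 hp0 (hq ▸ q.2.2) ha hm hc
    linarith
  · intro q hq
    have := key (-1) q fun a m c ha _ hma hc => by
      rw [hq]
      exact neg_le_neg_of_deviates hδ0 hp0 ha hma hc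
    linarith

end

/-! ### Continuity and strict monotonicity of the probabilities of the geometric graph. -/

section

variable {n d : ℕ}
local notation "𝔼" => EuclideanSpace ℝ (Fin d)

theorem threshold_antitone (hd : 2 ≤ d) : Antitone (threshold d) := by
  intro p q hpq
  have h := capProb_threshold hd q
  refine le_csSup ⟨1, fun t ht => ht.1.2⟩ ⟨h.1, ?_⟩
  rw [h.2]
  exact hpq

theorem geomGraph_antitone (V : Fin n → USphere d) : Antitone fun τ => geomGraph τ V := by
  intro s t hst i j h
  exact ⟨h.1, hst.trans h.2⟩

theorem ae_inner_notMem [NeZero d] {B : Set ℝ} (hB : MeasurableSet B)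
    (h : ∀ v : USphere d, unifSphere d {w | ⟪(v : 𝔼), (w : 𝔼)⟫ ∈ B} = 0) :
    ∀ᵐ V ∂(spherePi n d), ∀ i j : Fin n, i ≠ j → ⟪(V i : 𝔼), (V j : 𝔼)⟫ ∉ B := by
  rw [ae_all_iff]
  intro i
  rw [ae_all_iff]
  intro j
  by_cases hij : i = j
  · simp [hij]
  · have hX : Measurable fun V : Fin n → USphere d => ⟪(V i : 𝔼), (V j : 𝔼)⟫ := by fun_prop
    have hm : MeasurableSet {V : Fin n → USphere d | ⟪(V i : 𝔼), (V j : 𝔼)⟫ ∈ B} := hX hB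
    have hp := measurePreserving_update (d := d) j
    have h0 : spherePi n d {V : Fin n → USphere d | ⟪(V i : 𝔼), (V j : 𝔼)⟫ ∈ B} = 0 := by
      rw [← hp.measure_preimage hm.nullMeasurableSet,
        Measure.measure_prod_null (hp.measurable hm)]
      refine Eventually.of_forall fun V => ?_
      refine Eq.trans (congrArg _ ?_) (h (V i))
      ext w
      simp [Function.update_of_ne hij]
    have h1 := measure_eq_zero_iff_ae_notMem.1 h0
    filter_upwards [h1] with V hV _
    exact hV

/-- The probability of a property of the random geometric graph with threshold `τ`. -/
def geomProb (n d : ℕ) (P : Set (SimpleGraph (Fin n))) (τ : ℝ) : ℝ :=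
  (spherePi n d).real {V | geomGraph τ V ∈ P}

theorem measurableSet_geomGraph_mem (P : Set (SimpleGraph (Fin n))) (τ : ℝ) :
    MeasurableSet {V : Fin n → USphere d | geomGraph τ V ∈ P} :=
  measurable_geomGraph τ P.toFinite.measurableSet

theorem map_geomGraph_real (P : Set (SimpleGraph (Fin n))) (τ : ℝ) :
    ((spherePi n d).map (geomGraph τ)).real P = geomProb n d P τ := by
  rw [map_measureReal_apply (measurable_geomGraph τ) P.toFinite.measurableSet]
  rfl

theorem rgg_real (P : Set (SimpleGraph (Fin n))) (p : unitInterval) :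
    (rgg n d p).real P = geomProb n d P (threshold d p) :=
  map_geomGraph_real P _

theorem geomProb_antitone [NeZero d] {P : Set (SimpleGraph (Fin n))} (hP : IsUpperSet P) :
    Antitone (geomProb n d P) := fun _ _ hst =>
  measureReal_mono fun V hV => hP (geomGraph_antitone V hst) hV

theorem eventually_geomGraph_eq {V : Fin n → USphere d} {t : ℝ}
    (hV : ∀ i j : Fin n, i ≠ j → ⟪(V i : 𝔼), (V j : 𝔼)⟫ ∉ ({t} : Set ℝ)) :
    ∀ᶠ s in nhds t, geomGraph s V = geomGraph t V := by
  have h : ∀ᶠ s in nhds t, ∀ i j : Fin n, i ≠ j →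
      (s ≤ ⟪(V i : 𝔼), (V j : 𝔼)⟫ ↔ t ≤ ⟪(V i : 𝔼), (V j : 𝔼)⟫) := by
    rw [eventually_all]
    intro i
    rw [eventually_all]
    intro j
    by_cases hij : i = j
    · simp [hij]
    · rcases lt_or_gt_of_ne (fun h => hV i j hij h : ⟪(V i : 𝔼), (V j : 𝔼)⟫ ≠ t) with h | h
      · filter_upwards [lt_mem_nhds h] with s hs _
        simp [not_le.2 h, not_le.2 hs]
      · filter_upwards [gt_mem_nhds h] with s hs _
        simp [h.le, hs.le]
  filter_upwards [h] with s hs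
  ext i j
  exact and_congr_right fun hij => hs i j hij

/-- Almost surely no inner product equals t, and then the graph is constant for thresholds near t.
-/
theorem continuous_geomProb [NeZero d] (hd : 2 ≤ d) (P : Set (SimpleGraph (Fin n))) :
    Continuous (geomProb n d P) := by
  have heq : geomProb n d P = fun t => ∫ V, {V : Fin n → USphere d |
      geomGraph t V ∈ P}.indicator (fun _ => (1 : ℝ)) V ∂(spherePi n d) := by
    funext t
    rw [integral_indicator_const _ (measurableSet_geomGraph_mem P t)]
    simp [geomProb]
  rw [heq, continuous_iff_continuousAt]
  intro t
  refine tendsto_integral_filter_of_dominated_convergence (fun _ => (1 : ℝ)) ?_ ?_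
    (integrable_const _) ?_
  · exact Eventually.of_forall fun s => (measurable_const.indicator
      (measurableSet_geomGraph_mem P s)).aestronglyMeasurable
  · refine Eventually.of_forall fun s => Eventually.of_forall fun V => ?_
    by_cases h : geomGraph s V ∈ P <;> simp [h]
  · have hties : ∀ v : USphere d, unifSphere d {w | ⟪(v : 𝔼), (w : 𝔼)⟫ ∈ ({t} : Set ℝ)} = 0 :=
      fun v => unifSphere_level_eq_zero hd v t
    filter_upwards [ae_inner_notMem (measurableSet_singleton t) hties] with V hV
    refine tendsto_const_nhds.congr' ?_
    filter_upwards [eventually_geomGraph_eq hV] with s hs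
    by_cases h : geomGraph t V ∈ P <;> simp [hs, h]

/-- Where the cap probability is flat, almost surely no inner product falls in [s, t). Hence it does
not matter which threshold of a given density is selected. -/
theorem geomProb_eq_of_capProb_eq [NeZero d] {s t : ℝ} (hst : s ≤ t)
    (h : capProb d s = capProb d t) (P : Set (SimpleGraph (Fin n))) :
    geomProb n d P s = geomProb n d P t := by
  have hnull : ∀ v : USphere d, unifSphere d {w | ⟪(v : 𝔼), (w : 𝔼)⟫ ∈ Set.Ico s t} = 0 := by
    intro v
    have h1 := unifSphere_real_cap s v
    have h2 := unifSphere_real_cap t v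
    have hsub : {w : USphere d | t ≤ ⟪(v : 𝔼), (w : 𝔼)⟫} ⊆ {w | s ≤ ⟪(v : 𝔼), (w : 𝔼)⟫} :=
      fun w hw => hst.trans hw
    have hm : MeasurableSet {w : USphere d | t ≤ ⟪(v : 𝔼), (w : 𝔼)⟫} :=
      measurableSet_le measurable_const (by fun_prop)
    have h3 := measureReal_sdiff (μ := unifSphere d) hsub hm
    rw [h1, h2, h, sub_self, measureReal_eq_zero_iff] at h3
    refine Eq.trans (congrArg _ ?_) h3
    ext w
    simp
  refine measureReal_congr ?_
  filter_upwards [ae_inner_notMem measurableSet_Ico hnull] with V hV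
  have : geomGraph s V = geomGraph t V := by
    ext i j
    refine and_congr_right fun hij => ⟨fun h1 => ?_, fun h1 => hst.trans h1⟩
    by_contra h2
    exact hV i j hij ⟨h1, not_le.1 h2⟩
  exact congrArg (· ∈ P) this

theorem isOpenPosMeasure_unifSphere [NeZero d] : (unifSphere d).IsOpenPosMeasure := by
  refine ⟨fun U hU hne h => ?_⟩
  rw [unifSphere, Measure.smul_apply, smul_eq_mul, mul_eq_zero] at h
  rcases h with h | h
  · exact ENNReal.inv_ne_zero.2 (measure_ne_top _ _) h
  · exact hU.measure_ne_zero _ hne h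

theorem preconnectedSpace_usphere (hd : 2 ≤ d) : PreconnectedSpace (USphere d) := by
  refine Subtype.preconnectedSpace (isPreconnected_sphere ?_ 0 1)
  rw [rank_eq_card_basis (EuclideanSpace.basisFun (Fin d) ℝ).toBasis, Fintype.card_fin]
  exact_mod_cast hd

theorem isClosed_geomGraph_mem {P : Set (SimpleGraph (Fin n))} (hP : IsUpperSet P) (t : ℝ) :
    IsClosed {V : Fin n → USphere d | geomGraph t V ∈ P} := by
  rw [← isOpen_compl_iff, isOpen_iff_mem_nhds]
  intro V hV
  have h : ∀ᶠ W in nhds V, ∀ i j : Fin n, ⟪(V i : 𝔼), (V j : 𝔼)⟫ < t →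
      ⟪(W i : 𝔼), (W j : 𝔼)⟫ < t := by
    rw [eventually_all]
    intro i
    rw [eventually_all]
    intro j
    by_cases hlt : ⟪(V i : 𝔼), (V j : 𝔼)⟫ < t
    · have hc : Continuous fun W : Fin n → USphere d => ⟪(W i : 𝔼), (W j : 𝔼)⟫ := by fun_prop
      filter_upwards [hc.continuousAt.eventually_lt_const hlt] with W hW _
      exact hW
    · simp [hlt]
  filter_upwards [h] with W hW hWP
  refine hV (hP ?_ hWP)
  intro i j hij
  refine ⟨hij.1, ?_⟩
  by_contra hlt
  exact not_le.2 (hW i j (not_le.1 hlt)) hij.2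

/-- The graph of the strict inequalities `s < ⟨V i, V j⟩`. -/
def openGeomGraph (s : ℝ) (V : Fin n → USphere d) : SimpleGraph (Fin n) where
  Adj i j := i ≠ j ∧ s < ⟪(V i : 𝔼), (V j : 𝔼)⟫
  symm := ⟨fun i j h => ⟨h.1.symm, by rw [real_inner_comm]; exact h.2⟩⟩
  loopless := ⟨fun _ h => h.1 rfl⟩

theorem isOpen_openGeomGraph_mem {P : Set (SimpleGraph (Fin n))} (hP : IsUpperSet P) (s : ℝ) :
    IsOpen {V : Fin n → USphere d | openGeomGraph s V ∈ P} := by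
  rw [isOpen_iff_mem_nhds]
  intro V hV
  have h : ∀ᶠ W in nhds V, ∀ i j : Fin n, s < ⟪(V i : 𝔼), (V j : 𝔼)⟫ →
      s < ⟪(W i : 𝔼), (W j : 𝔼)⟫ := by
    rw [eventually_all]
    intro i
    rw [eventually_all]
    intro j
    by_cases hlt : s < ⟪(V i : 𝔼), (V j : 𝔼)⟫
    · have hc : Continuous fun W : Fin n → USphere d => ⟪(W i : 𝔼), (W j : 𝔼)⟫ := by fun_prop
      filter_upwards [hc.continuousAt.eventually_const_lt hlt] with W hW _
      exact hW
    · simp [hlt]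
  filter_upwards [h] with W hW
  have hle : openGeomGraph s V ≤ openGeomGraph s W := fun i j hij => ⟨hij.1, hW i j hij.2⟩
  exact hP hle hV

/-- Suppose the probabilities were equal. The closed event C at threshold t lies in the open event O
of the strict threshold s, and O \ C is open and null. The product measure charges nonempty open
sets, so O = C is clopen. As a product of spheres of dimension at least one is connected, C is empty
or everything, contrary to `h0` and `h1`. -/
theorem geomProb_lt [NeZero d] (hd : 2 ≤ d) {P : Set (SimpleGraph (Fin n))} (hP : IsUpperSet P)
    {s t : ℝ} (hst : s < t) (h0 : 0 < geomProb n d P t) (h1 : geomProb n d P t < 1) :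
    geomProb n d P t < geomProb n d P s := by
  have := preconnectedSpace_usphere hd
  have : ∀ _ : Fin n, (unifSphere d).IsOpenPosMeasure := fun _ => isOpenPosMeasure_unifSphere
  have : (spherePi n d).IsOpenPosMeasure := 
    @Measure.pi.isOpenPosMeasure (Fin n) (fun _ => USphere d) _ _ (fun _ => unifSphere d) _
      (fun _ => inferInstance) this
  by_contra! hle
  set O := {V : Fin n → USphere d | openGeomGraph s V ∈ P} with hO
  set C := {V : Fin n → USphere d | geomGraph t V ∈ P} with hC
  have hOo : IsOpen O := isOpen_openGeomGraph_mem hP s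
  have hCc : IsClosed C := isClosed_geomGraph_mem hP t
  have hCO : C ⊆ O := fun V hV => by
    have hle : geomGraph t V ≤ openGeomGraph s V := fun i j hij => ⟨hij.1, hst.trans_le hij.2⟩
    exact hP hle hV
  have hOs : (spherePi n d).real O ≤ geomProb n d P s :=
    measureReal_mono fun V hV => by
      have hle : openGeomGraph s V ≤ geomGraph s V := fun i j hij => ⟨hij.1, hij.2.le⟩
      exact hP hle hV
  have hdiff : (spherePi n d).real (O \ C) = 0 := by
    refine le_antisymm ?_ measureReal_nonneg
    rw [measureReal_sdiff hCO (measurableSet_geomGraph_mem P t)]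
    have : (spherePi n d).real C = geomProb n d P t := rfl
    linarith
  rw [measureReal_eq_zero_iff, (hOo.sdiff hCc).measure_eq_zero_iff (spherePi n d)] at hdiff
  have hOC : O = C := (Set.sdiff_eq_empty.1 hdiff).antisymm hCO
  rcases isClopen_iff.1 (⟨hCc, hOC ▸ hOo⟩ : IsClopen C) with h | h
  · have : geomProb n d P t = 0 := by
      change (spherePi n d).real C = 0
      rw [h, measureReal_empty]
    linarith
  · have : geomProb n d P t = 1 := by
      change (spherePi n d).real C = 1
      rw [h, probReal_univ]
    linarith

theorem rgg_real_mono (hd : 2 ≤ d) {P : Set (SimpleGraph (Fin n))} (hP : IsUpperSet P) :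
    Monotone fun p => (rgg n d p).real P := by
  have : NeZero d := ⟨by omega⟩
  intro p q hpq
  simp only [rgg_real]
  exact geomProb_antitone hP (threshold_antitone hd hpq)

/-- Values strictly between two attained ones have exactly one preimage. -/
theorem exists_isInverseValue_rgg (hd : 2 ≤ d) {P : Set (SimpleGraph (Fin n))} (hP : IsUpperSet P)
    {p₁ p₂ : unitInterval} {y : ℝ} (h₁ : (rgg n d p₁).real P < y) (h₂ : y < (rgg n d p₂).real P) :
    ∃ q, IsInverseValue (fun p => (rgg n d p).real P) y q ∧ p₁ ≤ q ∧ q ≤ p₂ := by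
  have : NeZero d := ⟨by omega⟩
  have := isProbabilityMeasure_rgg (n := n) (by omega : 1 ≤ d) p₂
  have hmono := rgg_real_mono (n := n) hd hP
  have hp : p₁ ≤ p₂ := by
    by_contra h
    have := hmono (not_le.1 h).le
    simp only at this
    linarith
  have hy0 : 0 < y := lt_of_le_of_lt measureReal_nonneg h₁
  have hy1 : y < 1 := h₂.trans_le measureReal_le_one
  have hτ := threshold_antitone hd hp
  obtain ⟨τ, hτmem, hτy⟩ : y ∈ geomProb n d P '' Set.Icc (threshold d p₂) (threshold d p₁) :=
    intermediate_value_Icc' hτ (continuous_geomProb hd P).continuousOn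
      ⟨by rw [← rgg_real]; exact h₁.le, by rw [← rgg_real]; exact h₂.le⟩
  have hτ1 : τ ∈ Set.Icc (-1 : ℝ) 1 :=
    ⟨(capProb_threshold hd p₂).1.1.trans hτmem.1, hτmem.2.trans (capProb_threshold hd p₁).1.2⟩
  -- The threshold of density q may be larger than τ, but both have the same cap probability and so
  -- give the same probability of P.
  let q : unitInterval := ⟨capProb d τ, measureReal_nonneg, measureReal_le_one⟩
  have hq := capProb_threshold hd q
  have hqy : (rgg n d q).real P = y := by
    rw [rgg_real, ← hτy]
    refine (geomProb_eq_of_capProb_eq ?_ hq.2.symm P).symm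
    exact le_csSup ⟨1, fun t ht => ht.1.2⟩ ⟨hτ1, le_rfl⟩
  refine ⟨q, fun r => ⟨fun hr => ?_, fun hr => hr ▸ hqy⟩, ?_, ?_⟩
  · have hr' : (rgg n d r).real P = y := hr
    rw [rgg_real] at hr' hqy
    have heq : threshold d r = threshold d q := by
      rcases lt_trichotomy (threshold d r) (threshold d q) with h | h | h
      · have := geomProb_lt hd hP h (hqy ▸ hy0) (hqy ▸ hy1)
        linarith
      · exact h
      · have := geomProb_lt hd hP h (hr' ▸ hy0) (hr' ▸ hy1)
        linarith
    have h1 := (capProb_threshold hd r).2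
    rw [heq, hq.2] at h1
    exact Subtype.ext h1.symm
  · by_contra h
    have := hmono (not_le.1 h).le
    simp only [hqy] at this
    linarith
  · by_contra h
    have := hmono (not_le.1 h).le
    simp only [hqy] at this
    linarith

end

/-! ### Asymptotics and inverse values. -/

section

theorem tendsto_log_natCast : Tendsto (fun n : ℕ => log (n : ℝ)) atTop atTop :=
  tendsto_log_atTop.comp tendsto_natCast_atTop_atTop

theorem eventually_two_le_dim {pc : ℕ → unitInterval} {d : ℕ → ℕ}
    (hd : (fun n : ℕ => max ((n : ℝ) * (pc n : ℝ) * Real.log n ^ 4) (Real.log n ^ 5))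
      =o[atTop] (fun n => (d n : ℝ))) : ∀ᶠ n in atTop, 2 ≤ d n := by
  filter_upwards [hd.bound (by norm_num : (0 : ℝ) < 1 / 2),
    tendsto_log_natCast.eventually_ge_atTop 1] with n h1 h2
  have h3 : (1 : ℝ) ≤ log n ^ 5 := one_le_pow₀ h2
  rw [Real.norm_eq_abs, Real.norm_of_nonneg (Nat.cast_nonneg (d n))] at h1
  have h4 := (h3.trans (le_max_right _ _)).trans ((le_abs_self _).trans h1)
  have : (2 : ℝ) ≤ d n := by linarith
  exact_mod_cast this

/-- The sandwich for densities comparable to the critical one. -/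
theorem eventually_rgg_sandwich {pc : ℕ → unitInterval} {d : ℕ → ℕ}
    (hpc : (fun n : ℕ => 1 / (n : ℝ)) =O[atTop] (fun n => (pc n : ℝ)))
    (hd : (fun n : ℕ => max ((n : ℝ) * (pc n : ℝ) * Real.log n ^ 4) (Real.log n ^ 5))
      =o[atTop] (fun n => (d n : ℝ))) {δ : ℝ} (hδ0 : 0 < δ) (hδ1 : δ < 1) :
    ∀ᶠ n in atTop, ∀ p : unitInterval, (pc n : ℝ) / 2 ≤ p → (p : ℝ) ≤ 2 * pc n →
      (p : ℝ) ≤ 1 - δ → ∀ P : Set (SimpleGraph (Fin n)), IsUpperSet P →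
      (∀ q : unitInterval, (q : ℝ) = (1 - δ) * p →
        (SimpleGraph.binomialRandom (Fin n) q).real P - 12 / (n : ℝ) ^ 2 ≤
          (rgg n (d n) p).real P) ∧
      (∀ q : unitInterval, (q : ℝ) = (1 + δ) * p →
        (rgg n (d n) p).real P ≤
          (SimpleGraph.binomialRandom (Fin n) q).real P + 12 / (n : ℝ) ^ 2) := by
  obtain ⟨C, hC0, hC⟩ := hpc.exists_pos
  set ε := δ / 15 with hε
  have hε0 : 0 < ε := by positivity
  have hnat := tendsto_natCast_atTop_atTop (R := ℝ)
  have hroot : Tendsto (fun n : ℕ => √√(log (n : ℝ))) atTop atTop :=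
    tendsto_sqrt_atTop.comp (tendsto_sqrt_atTop.comp tendsto_log_natCast)
  -- Here 26000 = 2600(K + 2) with K = 8, and the factor 3 comes from (np + log n) log⁴ n ≤ 3M for p
  -- at most twice the critical density.
  have hc : 0 < ε ^ 2 / (26000 * 3) := by positivity
  filter_upwards [hC.bound, hd.bound hc, eventually_two_le_dim hd, eventually_gt_atTop 0,
    tendsto_log_natCast.eventually_ge_atTop 1, hnat.eventually_ge_atTop (16 * C),
    hnat.eventually_ge_atTop (4 / δ), hnat.eventually_ge_atTop (4 * C / ε),
    hroot.eventually_ge_atTop (log (1 / ε)), hroot.eventually_ge_atTop (18 / ε)]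
    with n hCn hdn hd2 hn hL hn1 hn2 hn3 hr1 hr2 p hp1 hp2 hpδ P hP
  have : NeZero (d n) := ⟨by omega⟩
  have hn0 : (0 : ℝ) < n := by exact_mod_cast hn
  have hn1' : (1 : ℝ) ≤ n := by exact_mod_cast hn
  rw [norm_of_nonneg (by positivity), norm_of_nonneg (pc n).2.1, div_le_iff₀ hn0] at hCn
  -- The hypothesis that the critical density is Ω(1/n) is used here: p ≥ 1/(2Cn) keeps log(8/p)
  -- below 2 log n and the norm error 2/n⁴ below εp.
  have hpn : 1 ≤ 2 * C * n * p := by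
    calc (1 : ℝ) ≤ C * pc n * n := hCn
      _ = 2 * C * n * (pc n / 2) := by ring
      _ ≤ _ := by gcongr
  have hp0 : (0 : ℝ) < p := by
    by_contra h
    have : (p : ℝ) = 0 := le_antisymm (not_lt.1 h) p.2.1
    rw [this] at hpn
    norm_num at hpn
  have hcap := (capProb_threshold hd2 p).2
  have hlog : ∀ x : ℝ, 0 < x → x ≤ (n : ℝ) ^ 2 → log x ≤ 2 * log n := by
    intro x hx hxn
    refine (log_le_log hx hxn).trans_eq ?_
    rw [log_pow]
    norm_num
  have hinvp : 1 / (p : ℝ) ≤ 2 * C * n := by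
    rw [div_le_iff₀ hp0]
    exact hpn
  have hr0 : 0 < √√(log (n : ℝ)) := Real.sqrt_pos.2 (Real.sqrt_pos.2 (by linarith))
  have hdim : 2600 * (8 + 2) / ε ^ 2 *
      ((n * capProb (d n) (threshold (d n) p) + log n) * log n ^ 4) ≤ d n := by
    rw [hcap]
    set M := max ((n : ℝ) * (pc n : ℝ) * Real.log n ^ 4) (Real.log n ^ 5) with hM
    have h1 : M ≤ ε ^ 2 / (26000 * 3) * d n := by
      refine (le_abs_self _).trans ?_
      rwa [norm_eq_abs, norm_of_nonneg (Nat.cast_nonneg _)] at hdn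
    have h2 : (n * (p : ℝ) + log n) * log n ^ 4 ≤ 3 * M := by
      have hL4 : 0 ≤ log (n : ℝ) ^ 4 := by positivity
      have h3 : n * (p : ℝ) * log n ^ 4 ≤ 2 * (n * pc n * log n ^ 4) := by
        calc n * (p : ℝ) * log n ^ 4 ≤ n * (2 * pc n) * log n ^ 4 := by gcongr
          _ = _ := by ring
      have h4 : n * (pc n : ℝ) * log n ^ 4 ≤ M := le_max_left _ _
      have h5 : log (n : ℝ) ^ 5 ≤ M := le_max_right _ _
      calc _ = n * (p : ℝ) * log n ^ 4 + log n ^ 5 := by ring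
        _ ≤ _ := by linarith
    calc _ ≤ 2600 * (8 + 2) / ε ^ 2 * (3 * (ε ^ 2 / (26000 * 3) * d n)) := by
          refine mul_le_mul_of_nonneg_left ?_ (by positivity)
          linarith
      _ = d n := by
          field_simp
          norm_num
  have hdev : ∀ A : Set (USphere (d n)), MeasurableSet A →
      exp (-(8 * ((n * (p : ℝ) + log n) * log n))) ≤ (unifSphere (d n)).real A →
      (unifSphere (d n)).real {w | Deviates δ p ((unifSphere (d n)).real A)
        ((unifSphere (d n)).real (A ∩ cap (threshold (d n) p) w))} ≤ 8 / (n : ℝ) ^ 4 := by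
    intro A hAm hA
    have h := cap_inter_deviation_le_of_dim (d := d n) (n := n) (τ := threshold (d n) p) (ε := ε)
      (K := 8) hn (by norm_num) hε0 (by rw [hε]; linarith) (hcap ▸ hp0)
      (by rw [hcap]; linarith) hL ?_ ?_ ?_ ?_ ?_ hdim hAm (by rw [hcap]; exact hA)
    · rw [hcap, show 15 * ε = δ by rw [hε]; ring] at h
      exact h
    · rw [hcap]
      refine hlog _ (by positivity) ?_
      calc 8 / (p : ℝ) = 8 * (1 / p) := by ring
        _ ≤ 8 * (2 * C * n) := by gcongr
        _ = 16 * C * n := by ring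
        _ ≤ n * n := by gcongr
        _ = _ := by ring
    · rw [hcap]
      have h1 : 4 / (1 - (p : ℝ)) ≤ 4 / δ := by
        gcongr
        linarith
      refine hlog _ (div_pos (by norm_num) (by linarith)) ((h1.trans hn2).trans ?_)
      exact le_self_pow₀ hn1' (by norm_num)
    · rw [log_div one_ne_zero hε0.ne', log_one, zero_sub] at hr1
      calc exp (-√√(log (n : ℝ))) ≤ exp (log ε) := exp_le_exp.2 (by linarith)
        _ = ε := exp_log hε0
    · rw [div_le_iff₀ hr0, mul_comm]
      rwa [div_le_iff₀ hε0] at hr2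
    · rw [hcap, div_le_iff₀ (by positivity)]
      have h1 : 4 * C ≤ n * ε := (div_le_iff₀ hε0).1 hn3
      have h2 : (n : ℝ) * n ≤ n ^ 4 := by
        rw [← sq]
        exact pow_le_pow_right₀ hn1' (by norm_num)
      have h3 : 2 * (2 * C) ≤ n * ε := by linarith
      calc (2 : ℝ) ≤ 2 * (2 * C * n * p) := by linarith
        _ = 2 * (2 * C) * (n * p) := by ring
        _ ≤ n * ε * (n * p) := by gcongr
        _ = ε * p * (n * n) := by ring
        _ ≤ _ := by gcongr
  have h := geomGraph_real_sandwich (d := d n) (τ := threshold (d n) p) hn hcap.symm hL hδ0.le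
    hδ1.le hdev hP
  exact h

theorem binomialRandom_threshold_bounds {n : ℕ} {P : Set (SimpleGraph (Fin n))}
    (hP : IsUpperSet P) {a b c : unitInterval} {ε δ : ℝ} (hε : ε < 1 / 2)
    (ha : (SimpleGraph.binomialRandom (Fin n) a).real P = ε)
    (hb : (SimpleGraph.binomialRandom (Fin n) b).real P = 1 - ε)
    (hc : (SimpleGraph.binomialRandom (Fin n) c).real P = 1 / 2)
    (hab : |(b : ℝ) - a| ≤ δ * c) (q : unitInterval) :
    ((1 + δ) * c ≤ q → 1 - ε ≤ (SimpleGraph.binomialRandom (Fin n) q).real P) ∧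
    ((q : ℝ) ≤ (1 - δ) * c → (SimpleGraph.binomialRandom (Fin n) q).real P ≤ ε) := by
  have hac : a ≤ c := by
    by_contra h
    have := binomialRandom_real_mono (not_le.1 h).le hP
    linarith
  have hcb : c ≤ b := by
    by_contra h
    have := binomialRandom_real_mono (not_le.1 h).le hP
    linarith
  have hac' : (a : ℝ) ≤ c := hac
  have hcb' : (c : ℝ) ≤ b := hcb
  have h1 := (abs_le.1 hab).2
  constructor
  · intro hq
    rw [← hb]
    exact binomialRandom_real_mono (show (b : ℝ) ≤ q by linarith) hP
  · intro hq
    rw [← ha]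
    exact binomialRandom_real_mono (show (q : ℝ) ≤ a by linarith) hP

/-- The threshold -1 also has density one and gives the complete graph. This covers critical
densities so close to 1 that the sandwich is unavailable above them. -/
theorem rgg_real_one {n d : ℕ} (hd : 2 ≤ d) {P : Set (SimpleGraph (Fin n))} (hP : IsUpperSet P)
    (hne : P.Nonempty) : (rgg n d 1).real P = 1 := by
  have : NeZero d := ⟨by omega⟩
  have h := capProb_threshold hd 1
  have hge : ∀ v w : USphere d, (-1 : ℝ) ≤
      ⟪(v : EuclideanSpace ℝ (Fin d)), (w : EuclideanSpace ℝ (Fin d))⟫ := by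
    intro v w
    have h := abs_real_inner_le_norm (v : EuclideanSpace ℝ (Fin d))
      (w : EuclideanSpace ℝ (Fin d))
    rw [norm_eq_of_mem_sphere, norm_eq_of_mem_sphere, one_mul] at h
    exact (abs_le.1 h).1
  have hcap : capProb d (-1) = 1 := by
    rw [capProb, show {v : USphere d × USphere d | (-1 : ℝ) ≤
      ⟪(v.1 : EuclideanSpace ℝ (Fin d)), (v.2 : EuclideanSpace ℝ (Fin d))⟫} = Set.univ from
      Set.eq_univ_of_forall fun v => hge _ _, probReal_univ]
  rw [rgg_real, ← geomProb_eq_of_capProb_eq h.1.1 (hcap.trans h.2.symm)]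
  have huniv : {V : Fin n → USphere d | geomGraph (-1) V ∈ P} = Set.univ := by
    refine Set.eq_univ_of_forall fun V => ?_
    obtain ⟨G, hG⟩ := hne
    have hle : G ≤ geomGraph (-1) V := fun i j hij => ⟨hij.ne, hge _ _⟩
    exact hP hle hG
  rw [geomProb, huniv, probReal_univ]

/-- Inverse values of increasing properties for the random geometric graph. -/
theorem exists_isInverseValue_near {n d : ℕ} (hd : 2 ≤ d) {P : Set (SimpleGraph (Fin n))}
    (hP : IsUpperSet P) {a b c : unitInterval} {y ε δ : ℝ} (hε0 : 0 < ε) (hε : ε < 1 / 2)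
    (hy0 : 2 * ε ≤ y) (hy1 : y ≤ 1 - 2 * ε) (hδ0 : 0 < δ) (hδ : δ ≤ 1 / 10)
    (ha : (SimpleGraph.binomialRandom (Fin n) a).real P = ε)
    (hb : (SimpleGraph.binomialRandom (Fin n) b).real P = 1 - ε)
    (hc : (SimpleGraph.binomialRandom (Fin n) c).real P = 1 / 2)
    (hab : |(b : ℝ) - a| ≤ δ * c) (hn : 12 / (n : ℝ) ^ 2 < ε)
    (hsand : ∀ p : unitInterval, (c : ℝ) / 2 ≤ p → (p : ℝ) ≤ 2 * c → (p : ℝ) ≤ 1 - δ →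
      (∀ q : unitInterval, (q : ℝ) = (1 - δ) * p →
        (SimpleGraph.binomialRandom (Fin n) q).real P - 12 / (n : ℝ) ^ 2 ≤
          (rgg n d p).real P) ∧
      (∀ q : unitInterval, (q : ℝ) = (1 + δ) * p →
        (rgg n d p).real P ≤
          (SimpleGraph.binomialRandom (Fin n) q).real P + 12 / (n : ℝ) ^ 2)) :
    ∃ q, IsInverseValue (fun p => (rgg n d p).real P) y q ∧ |(q : ℝ) - c| ≤ 7 * δ * c := by
  have hbd := binomialRandom_threshold_bounds hP hε ha hb hc hab
  have hc0 : 0 ≤ (c : ℝ) := c.2.1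
  have hc1 : (c : ℝ) ≤ 1 := c.2.2
  have hcδ : 0 ≤ δ * (c : ℝ) := by positivity
  -- The witness is (1 - 4δ)c: its upper comparison density (1 + δ)(1 - 4δ)c is at most (1 - δ)c,
  -- below the critical window.
  have hlow : ∃ p : unitInterval, (1 - 7 * δ) * (c : ℝ) ≤ p ∧ (rgg n d p).real P < y := by
    have h4 : 0 ≤ 1 - 4 * δ := by linarith
    have hp0 : 0 ≤ (1 - 4 * δ) * (c : ℝ) := mul_nonneg h4 hc0
    have hp1 : (1 - 4 * δ) * (c : ℝ) ≤ 1 - 4 * δ := mul_le_of_le_one_right h4 hc1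
    have hq0 : 0 ≤ (1 + δ) * ((1 - 4 * δ) * (c : ℝ)) := by positivity
    have hqle : (1 + δ) * ((1 - 4 * δ) * (c : ℝ)) ≤ (1 - δ) * c := by nlinarith
    have hq1 : (1 + δ) * ((1 - 4 * δ) * (c : ℝ)) ≤ 1 := by nlinarith
    refine ⟨⟨(1 - 4 * δ) * c, hp0, by linarith⟩, by change _ ≤ (1 - 4 * δ) * (c : ℝ); nlinarith,
      ?_⟩
    have h := (hsand ⟨(1 - 4 * δ) * c, hp0, by linarith⟩
      (by change _ ≤ (1 - 4 * δ) * (c : ℝ); nlinarith)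
      (by change (1 - 4 * δ) * (c : ℝ) ≤ _; nlinarith)
      (by change (1 - 4 * δ) * (c : ℝ) ≤ _; linarith)).2
      ⟨(1 + δ) * ((1 - 4 * δ) * c), hq0, hq1⟩ rfl
    have h2 := (hbd ⟨(1 + δ) * ((1 - 4 * δ) * c), hq0, hq1⟩).2 hqle
    linarith
  have hhigh : ∃ p : unitInterval, (p : ℝ) ≤ (1 + 7 * δ) * (c : ℝ) ∧ y < (rgg n d p).real P := by
    -- The sandwich requires p ≤ 1 - δ. If (1 + 4δ)c exceeds this bound, then 1 ≤ (1 + 7δ)c because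
    -- δ ≤ 1/10, and p = 1 serves.
    by_cases hcase : (1 + 4 * δ) * (c : ℝ) ≤ 1 - δ
    · have hp0 : 0 ≤ (1 + 4 * δ) * (c : ℝ) := by positivity
      have h1δ : 0 ≤ 1 - δ := by linarith
      have hq0 : 0 ≤ (1 - δ) * ((1 + 4 * δ) * (c : ℝ)) := mul_nonneg h1δ hp0
      have hqle : (1 + δ) * (c : ℝ) ≤ (1 - δ) * ((1 + 4 * δ) * c) := by nlinarith
      have hq1 : (1 - δ) * ((1 + 4 * δ) * (c : ℝ)) ≤ 1 := by nlinarith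
      refine ⟨⟨(1 + 4 * δ) * c, hp0, by linarith⟩, by change (1 + 4 * δ) * (c : ℝ) ≤ _; nlinarith,
        ?_⟩
      have h := (hsand ⟨(1 + 4 * δ) * c, hp0, by linarith⟩
        (by change _ ≤ (1 + 4 * δ) * (c : ℝ); nlinarith)
        (by change (1 + 4 * δ) * (c : ℝ) ≤ _; nlinarith) hcase).1
        ⟨(1 - δ) * ((1 + 4 * δ) * c), hq0, hq1⟩ rfl
      have h2 := (hbd ⟨(1 - δ) * ((1 + 4 * δ) * c), hq0, hq1⟩).1 hqle
      linarith
    · refine ⟨1, ?_, ?_⟩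
      · have h := not_le.1 hcase
        change (1 : ℝ) ≤ _
        nlinarith
      · rw [rgg_real_one hd hP]
        · linarith
        · by_contra hne
          rw [Set.not_nonempty_iff_eq_empty.1 hne, measureReal_empty] at ha
          linarith
  obtain ⟨p₁, hp₁, hlt₁⟩ := hlow
  obtain ⟨p₂, hp₂, hlt₂⟩ := hhigh
  obtain ⟨q, hq, h1, h2⟩ := exists_isInverseValue_rgg hd hP hlt₁ hlt₂
  refine ⟨q, hq, ?_⟩
  have h1' : (p₁ : ℝ) ≤ q := h1
  have h2' : (q : ℝ) ≤ p₂ := h2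
  rw [abs_le]
  constructor <;> linarith

theorem isInverseValue_one_sub {f : unitInterval → ℝ} {y : ℝ} {q : unitInterval}
    (h : IsInverseValue f (1 - y) q) : IsInverseValue (fun p => 1 - f p) y q := by
  intro p
  rw [← h p]
  constructor <;> intro h' <;> linarith

theorem eventually_exists_isInverseValue (P : ∀ n : ℕ, Set (SimpleGraph (Fin n)))
    (hP : ∀ n, IsUpperSet (P n) ∨ IsLowerSet (P n)) (pc : ℕ → unitInterval)
    (hsharp : HasSharpThreshold
      (fun n p => (SimpleGraph.binomialRandom (Fin n) p).real (P n)) pc)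
    (hpc : (fun n : ℕ => 1 / (n : ℝ)) =O[atTop] (fun n => (pc n : ℝ))) (d : ℕ → ℕ)
    (hd : (fun n : ℕ => max ((n : ℝ) * (pc n : ℝ) * Real.log n ^ 4) (Real.log n ^ 5))
      =o[atTop] (fun n => (d n : ℝ))) {y δ : ℝ} (hy0 : 0 < y) (hy1 : y < 1) (hδ0 : 0 < δ)
    (hδ : δ ≤ 1 / 10) :
    ∀ᶠ n in atTop, ∃ q, IsInverseValue (fun p => (rgg n (d n) p).real (P n)) y q ∧
      |(q : ℝ) - pc n| ≤ 7 * δ * pc n := by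
  set ε := min y (1 - y) / 4 with hε
  have hm0 : 0 < min y (1 - y) := lt_min hy0 (by linarith)
  have hε0 : 0 < ε := by positivity
  have hεy : 4 * ε ≤ y := by
    rw [hε]
    linarith [min_le_left y (1 - y)]
  have hεy' : 4 * ε ≤ 1 - y := by
    rw [hε]
    linarith [min_le_right y (1 - y)]
  have hε1 : ε < 1 / 2 := by linarith
  obtain ⟨hcrit, hwin⟩ := hsharp
  obtain ⟨a, b, hab, ho⟩ := hwin ε hε0 hε1
  have hsq : Tendsto (fun n : ℕ => 12 / (n : ℝ) ^ 2) atTop (nhds 0) :=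
    tendsto_const_nhds.div_atTop ((tendsto_pow_atTop two_ne_zero).comp tendsto_natCast_atTop_atTop)
  filter_upwards [hcrit, hab, ho.bound hδ0, eventually_rgg_sandwich hpc hd hδ0 (by linarith),
    eventually_two_le_dim hd, hsq.eventually_lt_const hε0] with n hcn habn hon hsn hdn hqn
  rw [norm_eq_abs, norm_of_nonneg (pc n).2.1] at hon
  have hfa : (SimpleGraph.binomialRandom (Fin n) (a n)).real (P n) = ε := (habn.1 _).2 rfl
  have hfb : (SimpleGraph.binomialRandom (Fin n) (b n)).real (P n) = 1 - ε := (habn.2 _).2 rfl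
  have hfc : (SimpleGraph.binomialRandom (Fin n) (pc n)).real (P n) = 1 / 2 := (hcn _).2 rfl
  rcases hP n with hup | hlow
  · exact exists_isInverseValue_near hdn hup hε0 hε1 (by linarith) (by linarith) hδ0 hδ hfa hfb hfc
      hon hqn fun p h1 h2 h3 => hsn p h1 h2 h3 _ hup
  · have hm : MeasurableSet (P n) := (P n).toFinite.measurableSet
    have hup : IsUpperSet (P n)ᶜ := hlow.compl
    have hon' : |(a n : ℝ) - b n| ≤ δ * pc n := by rwa [abs_sub_comm]
    -- Passing to the complement exchanges the densities at levels ε and 1 - ε.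
    obtain ⟨q, hq, hqc⟩ := exists_isInverseValue_near (y := 1 - y) hdn hup (a := b n) (b := a n)
      (c := pc n) hε0 hε1 (by linarith) (by linarith) hδ0 hδ
      (by rw [probReal_compl_eq_one_sub hm, hfb]; ring)
      (by rw [probReal_compl_eq_one_sub hm, hfa])
      (by rw [probReal_compl_eq_one_sub hm, hfc]; norm_num)
      hon' hqn fun p h1 h2 h3 => hsn p h1 h2 h3 _ hup
    refine ⟨q, ?_, hqc⟩
    have h := isInverseValue_one_sub hq
    have heq : (fun p => (rgg n (d n) p).real (P n)) =
        fun p => 1 - (rgg n (d n) p).real (P n)ᶜ := by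
      funext p
      have := isProbabilityMeasure_rgg (n := n) (by omega : 1 ≤ d n) p
      rw [probReal_compl_eq_one_sub hm]
      ring
    rw [heq]
    exact h

/-- The inverse value is unique, so a sequence chosen without reference to δ satisfies the bounds
for every δ. The default 0 is used only at the finitely many n where none exists. -/
theorem exists_inverse_sequence {f : ℕ → unitInterval → ℝ} {pc : ℕ → unitInterval} {y : ℝ}
    (h : ∀ δ : ℝ, 0 < δ → δ ≤ 1 / 10 → ∀ᶠ n in atTop, ∃ q, IsInverseValue (f n) y q ∧
      |(q : ℝ) - pc n| ≤ 7 * δ * pc n) :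
    ∃ q : ℕ → unitInterval, (∀ᶠ n in atTop, IsInverseValue (f n) y (q n)) ∧
      (fun n => (q n : ℝ) - pc n) =o[atTop] fun n => (pc n : ℝ) := by
  classical
  set q : ℕ → unitInterval := fun n =>
    if hn : ∃ q, IsInverseValue (f n) y q then hn.choose else 0 with hq
  have hspec : ∀ n, (∃ q, IsInverseValue (f n) y q) → IsInverseValue (f n) y (q n) := by
    intro n hn
    simp only [hq, hn, dif_pos]
    exact hn.choose_spec
  refine ⟨q, ?_, ?_⟩
  · filter_upwards [h (1 / 10) (by norm_num) le_rfl] with n hn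
    obtain ⟨r, hr, _⟩ := hn
    exact hspec n ⟨r, hr⟩
  · refine IsLittleO.of_bound fun c hc => ?_
    have hδ : 0 < min (c / 7) (1 / 10) := lt_min (by positivity) (by norm_num)
    filter_upwards [h _ hδ (min_le_right _ _)] with n hn
    obtain ⟨r, hr, hrc⟩ := hn
    have heq : q n = r := (hr (q n)).1 ((hspec n ⟨r, hr⟩ (q n)).2 rfl)
    rw [heq, norm_eq_abs, norm_of_nonneg (pc n).2.1]
    refine hrc.trans (mul_le_mul_of_nonneg_right ?_ (pc n).2.1)
    linarith [min_le_left (c / 7) (1 / 10)]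

end

end

end SharpThresholds

theorem theorem2
    (P : ∀ n : ℕ, Set (SimpleGraph (Fin n)))
    (hP : ∀ n, IsUpperSet (P n) ∨ IsLowerSet (P n))
    (pc : ℕ → unitInterval)
    (hsharp : SharpThresholds.HasSharpThreshold
      (fun n p => (SimpleGraph.binomialRandom (Fin n) p).real (P n)) pc)
    (hpc : (fun n : ℕ => 1 / (n : ℝ)) =O[atTop] (fun n => (pc n : ℝ)))
    (d : ℕ → ℕ)
    (hd : (fun n : ℕ => max ((n : ℝ) * (pc n : ℝ) * Real.log n ^ 4) (Real.log n ^ 5))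
      =o[atTop] (fun n => (d n : ℝ))) :
    ∃ qc : ℕ → unitInterval,
      SharpThresholds.HasSharpThreshold
        (fun n p => (SharpThresholds.rgg n (d n) p).real (P n)) qc ∧
      (fun n => (qc n : ℝ)) ~[atTop] (fun n => (pc n : ℝ)) := by
  -- All fixed levels have inverse values within o(pc) of pc. Level 1/2 gives the critical
  -- probability; the difference of levels 1 - ε and ε gives the window.
  have key : ∀ y : ℝ, 0 < y → y < 1 → ∃ q : ℕ → unitInterval,
      (∀ᶠ n in atTop, SharpThresholds.IsInverseValue
        (fun p => (SharpThresholds.rgg n (d n) p).real (P n)) y (q n)) ∧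
      (fun n => (q n : ℝ) - pc n) =o[atTop] fun n => (pc n : ℝ) := fun y hy0 hy1 =>
    SharpThresholds.exists_inverse_sequence fun δ hδ0 hδ =>
      SharpThresholds.eventually_exists_isInverseValue P hP pc hsharp hpc d hd hy0 hy1 hδ0 hδ
  obtain ⟨qc, hqc, hqo⟩ := key (1 / 2) (by norm_num) (by norm_num)
  have hequiv : (fun n => (qc n : ℝ)) ~[atTop] (fun n => (pc n : ℝ)) := hqo
  refine ⟨qc, ⟨hqc, fun ε hε0 hε1 => ?_⟩, hequiv⟩
  obtain ⟨a, ha, hao⟩ := key ε hε0 (by linarith)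
  obtain ⟨b, hb, hbo⟩ := key (1 - ε) (by linarith) (by linarith)
  refine ⟨a, b, ha.and hb, ?_⟩
  refine IsLittleO.trans_isBigO ?_ hequiv.isBigO_symm
  refine (hbo.sub hao).congr_left fun n => ?_
  ring
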